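/- Let $f:Y\to X$ be a separated morphism of quasi-compact quasi-separated schemes which is decomposable, i.e. $f$ is a composition of an affine morphism $Y\to Z$ and a proper morphism $Z\to X$. A $Y$-modification of $X$ is a factorization $Y\xrightarrow{f_i}X_i\xrightarrow{g_i}X$ of $f$ with $f_i$ schematically dominant and $g_i$ proper; $X_j$ dominates $X_i$ if there is an $X$-morphism $X_j\to X_i$ compatible with $f_j$ and $f_i$. Let $\mathrm{RZ}_Y(X)=\varprojlim_i X_i$ be the projective limit of the topological spaces of all $Y$-modifications, with projections $\pi_i$, and equip it with the sheaf of rings $\mathcal O_{\mathrm{RZ}}=\varinjlim_i\pi_i^{-1}\mathcal O_{X_i}$. Let $\mathrm{Val}_Y(X)$ be the set of triples $\mathbf y=(y,R,\phi)$ where $y\in Y$, $R$ is a valuation ring of the residue field $k(y)$, and $\phi:\mathrm{Spec}(R)\to X$ is a morphism compatible with $\mathrm{Spec}(k(y))\to Y$ such that the induced morphism $\mathrm{Spec}(k(y))\to \mathrm{Spec}(R)\times_X Y$ is a closed immersion. Let $\mathcal O_{\mathbf y}$ be the preimage of $R$ in $\mathcal O_{Y,y}$. By the valuative criterion $\phi$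 lifts uniquely to a morphism $\phi_i:\mathrm{Spec}(R)\to X_i$ for every $Y$-modification $X_i$, compatibly with $\mathrm{Spec}(k(y))\to Y\to X_i$; let $x_i$ be the image of the closed point. The points $x_i$ define a point $\psi(\mathbf y)\in\mathrm{RZ}_Y(X)$, and the homomorphisms $\mathcal O_{X_i,x_i}\to\mathcal O_{X_i,f_i(y)}\to\mathcal O_{Y,y}$ have images in $\mathcal O_{\mathbf y}$ and induce a natural homomorphism $\mathcal O_{\mathrm{RZ},\psi(\mathbf y)}\to\mathcal O_{\mathbf y}$. Then there is a map $\lambda:\mathrm{RZ}_Y(X)\to\mathrm{Val}_Y(X)$ such that for every $\mathbf x\in\mathrm{RZ}_Y(X)$ one has $\psi(\lambda(\mathbf x))=\mathbf x$ and the natural homomorphism $\mathcal O_{\mathrm{RZ},\mathbf x}\to\mathcal O_{\lambda(\mathbf x)}$ is an isomorphism. In particular, $\lambda$ is a section of $\psi$, $\psi$ is surjective, and each stalk $\mathcal O_{\mathrm{RZ},\mathbf x}$ is a semi-valuation ring: the valuation $|\ |$ induced on it through $\mathcal O_{\lambda(\mathbf x)}\to R\subset k(y)$, where $\lambda(\mathbf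 x)=(y,R,\phi)$, is such that every zero divisor lies in the kernel of $|\ |$ and $|g|\le|h|\ne 0$ implies $h\mid g$. -/

import Mathlib

open CategoryTheory CategoryTheory.Limits AlgebraicGeometry TopologicalSpace Opposite IsLocalRing

universe u

noncomputable section

namespace RelativeRZ

variable {Y X : Scheme.{u}}

/-- `f` is decomposable if it is an affine morphism `Y ⟶ Z` followed by a proper morphism
`Z ⟶ X`. -/
def IsDecomposable (f : Y ⟶ X) : Prop :=
  ∃ (Z : Scheme.{u}) (g : Y ⟶ Z) (h : Z ⟶ X), IsAffineHom g ∧ IsProper h ∧ g ≫ h = f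

/-! ### Modifications -/

/-- A `Y`-modification of `X`: a factorization of `f : Y ⟶ X` into a schematically dominant
morphism `ι : Y ⟶ obj` and a proper morphism `π : obj ⟶ X`. -/
structure Modification (f : Y ⟶ X) : Type (u + 1) where
  obj : Scheme.{u}
  ι : Y ⟶ obj
  π : obj ⟶ X
  fac : ι ≫ π = f
  dominant : IsSchemeTheoreticallyDominant ι
  proper : IsProper π

/-- `N.Dom M` is the type of morphisms by which the modification `N` dominates `M`: the
`X`-morphisms `N ⟶ M` compatible with the morphisms from `Y`. -/
@[ext]
structure Modification.Dom {f : Y ⟶ X} (N M : Modification f) : Type u where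
  hom : N.obj ⟶ M.obj
  ι_hom : N.ι ≫ hom = M.ι
  hom_π : hom ≫ M.π = N.π

/-- Every modification dominates itself. -/
def Modification.Dom.id {f : Y ⟶ X} (M : Modification f) : M.Dom M :=
  ⟨𝟙 _, Category.comp_id _, Category.id_comp _⟩

/-- Domination is transitive. -/
def Modification.Dom.comp {f : Y ⟶ X} {P N M : Modification f} (b : P.Dom N) (a : N.Dom M) :
    P.Dom M :=
  ⟨b.hom ≫ a.hom, by rw [← Category.assoc, b.ι_hom, a.ι_hom],
    by rw [Category.assoc, a.hom_π, b.hom_π]⟩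

/-! ### The space `RZ_Y(X)` -/

/-- The relative Riemann-Zariski space `RZ_Y(X)`: the projective limit of the
underlying spaces of all `Y`-modifications of `X`. -/
def RZ (f : Y ⟶ X) : Type (u + 1) :=
  { x : (M : Modification f) → M.obj //
    ∀ (N M : Modification f) (h : N.Dom M), h.hom (x N) = x M }

/-- The projective limit topology. -/
instance (f : Y ⟶ X) : TopologicalSpace (RZ f) :=
  inferInstanceAs (TopologicalSpace { x : (M : Modification f) → M.obj //
    ∀ (N M : Modification f) (h : N.Dom M), h.hom (x N) = x M })

/-- The projection of `RZ_Y(X)` to a modification. -/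
def RZ.proj {f : Y ⟶ X} (M : Modification f) (x : RZ f) : M.obj := x.1 M

lemma RZ.continuous_proj {f : Y ⟶ X} (M : Modification f) : Continuous (RZ.proj M) :=
  (continuous_apply M).comp continuous_subtype_val

/-- The preimage in `RZ_Y(X)` of an open subset of a modification. -/
def RZ.preimage {f : Y ⟶ X} (M : Modification f) (V : M.obj.Opens) : Opens (RZ f) :=
  ⟨RZ.proj M ⁻¹' V, V.isOpen.preimage (RZ.continuous_proj M)⟩

/-! ### The sheaf of regular functions

`𝒪 = colim π_M⁻¹ 𝒪_M`, the colimit being taken over all modifications `M`. The presheaf inverse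
image of `𝒪_M` has as sections over `U` the colimit of `Γ(M, V)` over the opens `V` of `M` with
`U ⊆ π_M⁻¹ V`; so the presheaf colimit of the inverse images has as sections over `U` the colimit
of `Γ(M, V)` over all pairs `(M, V)` with `U ⊆ π_M⁻¹ V`. This is a left Kan extension; the sheaf
`𝒪` is the sheafification. -/

/-- Pairs of a modification and an open subset of it. -/
structure Chart (f : Y ⟶ X) : Type (u + 1) where
  M : Modification f
  V : M.obj.Opens

/-- A morphism `c ⟶ d` of charts: a morphism by which `d.M` dominates `c.M` and which maps `d.V`
into `c.V`. -/
@[ext]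
structure Chart.Hom {f : Y ⟶ X} (c d : Chart f) : Type u where
  dom : d.M.Dom c.M
  maps : d.V ≤ dom.hom ⁻¹ᵁ c.V

instance (f : Y ⟶ X) : Category.{u} (Chart f) where
  Hom c d := Chart.Hom c d
  id c := ⟨Modification.Dom.id c.M, fun _ hx ↦ hx⟩
  comp a b := ⟨b.dom.comp a.dom, fun _ hx ↦ a.maps (b.maps hx)⟩
  id_comp a := Chart.Hom.ext (Modification.Dom.ext (Category.comp_id a.dom.hom))
  comp_id a := Chart.Hom.ext (Modification.Dom.ext (Category.id_comp a.dom.hom))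
  assoc a b c := Chart.Hom.ext (Modification.Dom.ext
    (Category.assoc c.dom.hom b.dom.hom a.dom.hom).symm)

/-- The universe lift of a commutative ring, as a functor. -/
def uliftRing : CommRingCat.{u} ⥤ CommRingCat.{u + 1} where
  obj A := CommRingCat.of (ULift.{u + 1} A)
  map {A B} φ := CommRingCat.ofHom
    ((ULift.ringEquiv (R := B)).symm.toRingHom.comp
      (φ.hom.comp (ULift.ringEquiv (R := A)).toRingHom))

/-- `(M, V) ↦ Γ(M, V)`. -/
def chartSections (f : Y ⟶ X) : Chart f ⥤ CommRingCat.{u} where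
  obj c := Γ(c.M.obj, c.V)
  map {c d} a := Scheme.Hom.appLE (Chart.Hom.dom a).hom c.V d.V (Chart.Hom.maps a)
  map_id c := by
    change Scheme.Hom.appLE (𝟙 c.M.obj) c.V c.V _ = _
    exact (Category.id_comp _).trans (c.M.obj.presheaf.map_id _)
  map_comp {c d e} a b := by
    change Scheme.Hom.appLE ((Chart.Hom.dom b).hom ≫ (Chart.Hom.dom a).hom) c.V e.V _ = _
    rw [Scheme.Hom.appLE_comp_appLE]

/-- `(M, V) ↦ π_M⁻¹ V`. -/
def chartOpen (f : Y ⟶ X) : Chart f ⥤ (Opens (TopCat.of (RZ f)))ᵒᵖ where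
  obj c := op (RZ.preimage c.M c.V)
  map {c d} a := (homOfLE (show RZ.preimage d.M d.V ≤ RZ.preimage c.M c.V from fun x hx ↦ by
    have h := x.2 d.M c.M (Chart.Hom.dom a)
    change x.1 c.M ∈ c.V
    rw [← h]
    exact Chart.Hom.maps a hx)).op

instance (f : Y ⟶ X) (U : (Opens (TopCat.of (RZ f)))ᵒᵖ) :
    HasColimitsOfShape (CostructuredArrow (chartOpen f) U) CommRingCat.{u + 1} :=
  (hasColimitsOfSizeShrink.{u, u + 1, u + 1, u + 1} CommRingCat.{u + 1}).has_colimits_of_shape _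

/-- The presheaf colimit of the inverse images of the structure sheaves of all modifications. -/
def preStructureSheaf (f : Y ⟶ X) : TopCat.Presheaf CommRingCat.{u + 1} (TopCat.of (RZ f)) :=
  (chartOpen f).leftKanExtension (chartSections f ⋙ uliftRing)

/-- The sheaf `𝒪` of regular functions on `RZ_Y(X)`. -/
def structureSheaf (f : Y ⟶ X) : TopCat.Sheaf CommRingCat.{u + 1} (TopCat.of (RZ f)) :=
  (presheafToSheaf (Opens.grothendieckTopology (TopCat.of (RZ f))) CommRingCat.{u + 1}).obj
    (preStructureSheaf f)

/-- The stalk `𝒪_x` of the sheaf of regular functions. -/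
abbrev RZ.stalk {f : Y ⟶ X} (x : RZ f) : CommRingCat.{u + 1} :=
  TopCat.Presheaf.stalk (X := TopCat.of (RZ f)) (structureSheaf f).presheaf x

/-- A compatible family of morphisms from the sections of a presheaf over the neighborhoods of a
point induces a morphism from the stalk. -/
def stalkDesc {T : TopCat.{u + 1}} (F : TopCat.Presheaf CommRingCat.{u + 1} T) (x : T)
    {A : CommRingCat.{u + 1}} (g : ∀ U : Opens T, x ∈ U → (F.obj (op U) ⟶ A))
    (hg : ∀ (U W : Opens T) (i : U ⟶ W) (hU : x ∈ U) (hW : x ∈ W),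
      F.map i.op ≫ g U hU = g W hW) : F.stalk x ⟶ A :=
  colimit.desc ((OpenNhds.inclusion x).op ⋙ F)
    { pt := A
      ι :=
        { app := fun U ↦ g U.unop.1 U.unop.2
          naturality := fun U W i ↦ by
            refine (hg _ _ ((OpenNhds.inclusion x).map i.unop) W.unop.2 U.unop.2).trans ?_
            exact (Category.comp_id _).symm } }

/-- Sheafification does not change the stalks: the inverse of the canonical isomorphism. -/
def stalkSheafifyInv {T : TopCat.{u + 1}} (F : TopCat.Presheaf CommRingCat.{u + 1} T) (x : T) :
    TopCat.Presheaf.stalk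
      ((presheafToSheaf (Opens.grothendieckTopology T) CommRingCat.{u + 1}).obj F).obj x ⟶
    F.stalk x :=
  (@asIso _ _ _ _ ((TopCat.Presheaf.stalkFunctor CommRingCat.{u + 1} x).map
    (CategoryTheory.toSheafify (Opens.grothendieckTopology T) F))
    (TopCat.Presheaf.stalkFunctor_map_unit_toSheafify_isIso x CommRingCat.{u + 1} F)).inv

/-! ### The set `Val_Y(X)` -/

/-- The inclusion of the generic point `Spec κ(y) ⟶ Spec R` for a valuation ring `R` of `κ(y)`. -/
def specIncl {y : Y} (R : ValuationSubring (Y.residueField y)) :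
    Spec (Y.residueField y) ⟶ Spec (CommRingCat.of R) :=
  Spec.map (CommRingCat.ofHom R.subtype)

/-- `Val_Y(X)`: triples `(y, R, φ)` of a point `y` of `Y`, a valuation ring `R` of `κ(y)` and a
morphism `φ : Spec R ⟶ X` compatible with `Spec κ(y) ⟶ Y`, such that the induced
morphism `Spec κ(y) ⟶ Spec R ×[X] Y` is a closed immersion. -/
structure Val (f : Y ⟶ X) : Type u where
  y : Y
  R : ValuationSubring (Y.residueField y)
  φ : Spec (CommRingCat.of R) ⟶ X
  comm : specIncl R ≫ φ = Y.fromSpecResidueField y ≫ f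
  closed : IsClosedImmersion (pullback.lift (specIncl R) (Y.fromSpecResidueField y) comm)

namespace Val

variable {f : Y ⟶ X} (v : Val f)

/-- The ring `𝒪_v`: the preimage of the valuation ring `R` in `𝒪_{Y,y}`. -/
def ring : Subring (Y.presheaf.stalk v.y) := v.R.toSubring.comap (Y.residue v.y).hom

/-- The valuative criterion: `φ` lifts uniquely to every modification. -/
lemma existsUnique_lift (M : Modification f) :
    ∃! φ : Spec (CommRingCat.of v.R) ⟶ M.obj,
      φ ≫ M.π = v.φ ∧ specIncl v.R ≫ φ = Y.fromSpecResidueField v.y ≫ M.ι := by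
  have hp := M.proper
  have hv : ValuativeCriterion M.π := by
    have := hp
    rw [IsProper.eq_valuativeCriterion] at this
    exact this.1.1.1
  let S : ValuativeCommSq M.π :=
    { R := v.R
      K := Y.residueField v.y
      i₁ := Y.fromSpecResidueField v.y ≫ M.ι
      i₂ := v.φ
      commSq := ⟨by rw [Category.assoc, M.fac]; exact v.comm.symm⟩ }
  obtain ⟨⟨⟨l⟩, hl⟩⟩ := hv S
  refine ⟨l.l, ⟨l.fac_right, l.fac_left⟩, fun φ hφ ↦ ?_⟩
  exact congrArg CommSq.LiftStruct.l (hl ⟨φ, hφ.2, hφ.1⟩)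

/-- The lift of `φ` to a modification. -/
def lift (M : Modification f) : Spec (CommRingCat.of v.R) ⟶ M.obj :=
  (v.existsUnique_lift M).choose

lemma lift_π (M : Modification f) : v.lift M ≫ M.π = v.φ :=
  (v.existsUnique_lift M).choose_spec.1.1

lemma specIncl_lift (M : Modification f) :
    specIncl v.R ≫ v.lift M = Y.fromSpecResidueField v.y ≫ M.ι :=
  (v.existsUnique_lift M).choose_spec.1.2

lemma lift_hom {N M : Modification f} (h : N.Dom M) : v.lift N ≫ h.hom = v.lift M := by
  refine (v.existsUnique_lift M).unique ⟨?_, ?_⟩ ⟨v.lift_π M, v.specIncl_lift M⟩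
  · rw [Category.assoc, h.hom_π, v.lift_π]
  · rw [← Category.assoc, v.specIncl_lift, Category.assoc, h.ι_hom]

/-- The center of `R` on a modification: the image of the closed point of `Spec R`. -/
def center (M : Modification f) : M.obj := v.lift M (closedPoint v.R)

/-- The map `ψ : Val_Y(X) → RZ_Y(X)`, given by the centers on all modifications. -/
def psi (v : Val f) : RZ f :=
  ⟨fun M ↦ v.center M, fun N M h ↦ by
    change (v.lift N ≫ h.hom) (closedPoint v.R) = _
    rw [v.lift_hom h]; rfl⟩

/-- The center on `M` is a specialization of the image of `y`. -/
lemma specializes_center (M : Modification f) : M.ι v.y ⤳ v.center M := by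
  have h := (IsLocalRing.specializes_closedPoint
    (specIncl v.R (closedPoint (Y.residueField v.y)))).map (v.lift M).continuous
  have e : v.lift M (specIncl v.R (closedPoint (Y.residueField v.y))) = M.ι v.y := by
    change (specIncl v.R ≫ v.lift M) (closedPoint (Y.residueField v.y)) = _
    rw [v.specIncl_lift]
    exact congrArg M.ι (Scheme.fromSpecResidueField_apply _ _)
  rw [e] at h
  exact h

/-- The homomorphism `𝒪_{M, x_M} ⟶ 𝒪_{M, ι y} ⟶ 𝒪_{Y, y}`, where `x_M` is the center on `M`. -/
def stalkToStalk (M : Modification f) :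
    M.obj.presheaf.stalk (v.center M) ⟶ Y.presheaf.stalk v.y :=
  M.obj.presheaf.stalkSpecializes (v.specializes_center M) ≫ M.ι.stalkMap v.y

lemma stalkToStalk_residue (M : Modification f) :
    v.stalkToStalk M ≫ Y.residue v.y =
      Scheme.stalkClosedPointTo (v.lift M) ≫ CommRingCat.ofHom v.R.subtype := by
  apply Spec.map_injective
  rw [← cancel_mono (M.obj.fromSpecStalk (v.center M))]
  have h₁ : Spec.map (v.stalkToStalk M) ≫ M.obj.fromSpecStalk (v.center M) =
      Y.fromSpecStalk v.y ≫ M.ι := by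
    rw [stalkToStalk, Spec.map_comp, Category.assoc,
      Scheme.SpecMap_stalkSpecializes_fromSpecStalk, Scheme.SpecMap_stalkMap_fromSpecStalk]
  have h₂ : Spec.map (Scheme.stalkClosedPointTo (v.lift M)) ≫ M.obj.fromSpecStalk (v.center M) =
      v.lift M := Scheme.Spec_stalkClosedPointTo_fromSpecStalk (v.lift M)
  have h₃ := v.specIncl_lift M
  calc Spec.map (v.stalkToStalk M ≫ Y.residue v.y) ≫ M.obj.fromSpecStalk (v.center M)
      = Spec.map (Y.residue v.y) ≫ Spec.map (v.stalkToStalk M) ≫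
          M.obj.fromSpecStalk (v.center M) := by rw [Spec.map_comp, Category.assoc]
    _ = specIncl v.R ≫ v.lift M := by
        rw [h₁, h₃, Scheme.fromSpecResidueField, Category.assoc]
    _ = specIncl v.R ≫ Spec.map (Scheme.stalkClosedPointTo (v.lift M)) ≫
          M.obj.fromSpecStalk (v.center M) := congrArg (specIncl v.R ≫ ·) h₂.symm
    _ = _ := (Category.assoc _ _ _).symm.trans
        (congrArg (· ≫ M.obj.fromSpecStalk (v.center M)) (Spec.map_comp _ _).symm)

lemma stalkToStalk_mem (M : Modification f) (a : M.obj.presheaf.stalk (v.center M)) :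
    (v.stalkToStalk M).hom a ∈ v.ring := by
  have h := congrArg (fun φ ↦ φ.hom a) (v.stalkToStalk_residue M)
  change (Y.residue v.y).hom ((v.stalkToStalk M).hom a) ∈ v.R
  have h' : (Y.residue v.y).hom ((v.stalkToStalk M).hom a) =
      v.R.subtype ((Scheme.stalkClosedPointTo (v.lift M)).hom a) := h
  rw [h']
  exact Subtype.property _

/-- The homomorphism `𝒪_{M, x_M} → 𝒪_v`. -/
def stalkToRing (M : Modification f) : M.obj.presheaf.stalk (v.center M) →+* v.ring :=
  (v.stalkToStalk M).hom.codRestrict v.ring (v.stalkToStalk_mem M)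

/-- The homomorphism `Γ(M, V) → 𝒪_{M, x_M} → 𝒪_v` for a chart `(M, V)` with `x_M ∈ V`. -/
def sectionsToRing (c : Chart f) (h : v.center c.M ∈ c.V) :
    (chartSections f).obj c ⟶ CommRingCat.of v.ring :=
  c.M.obj.presheaf.germ c.V (v.center c.M) h ≫ CommRingCat.ofHom (v.stalkToRing c.M)

lemma germ_stalkToStalk (M : Modification f) (V : M.obj.Opens) (h : v.center M ∈ V)
    (h' : v.y ∈ M.ι ⁻¹ᵁ V) :
    M.obj.presheaf.germ V (v.center M) h ≫ v.stalkToStalk M =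
      M.ι.appLE V (M.ι ⁻¹ᵁ V) le_rfl ≫ Y.presheaf.germ (M.ι ⁻¹ᵁ V) v.y h' := by
  rw [stalkToStalk, TopCat.Presheaf.germ_stalkSpecializes_assoc, Scheme.Hom.germ_stalkMap,
    Scheme.Hom.appLE_eq_app]

lemma map_sectionsToRing {c d : Chart f} (a : c ⟶ d) (hc : v.center c.M ∈ c.V)
    (hd : v.center d.M ∈ d.V) :
    (chartSections f).map a ≫ v.sectionsToRing d hd = v.sectionsToRing c hc := by
  have hc' : v.y ∈ c.M.ι ⁻¹ᵁ c.V := (v.specializes_center c.M).mem_open c.V.isOpen hc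
  have hd' : v.y ∈ d.M.ι ⁻¹ᵁ d.V := (v.specializes_center d.M).mem_open d.V.isOpen hd
  have hle : d.M.ι ⁻¹ᵁ d.V ≤ c.M.ι ⁻¹ᵁ c.V := by
    rw [← (Chart.Hom.dom a).ι_hom]
    exact fun x hx ↦ Chart.Hom.maps a hx
  have key : Scheme.Hom.appLE (Chart.Hom.dom a).hom c.V d.V (Chart.Hom.maps a) ≫
      d.M.obj.presheaf.germ d.V (v.center d.M) hd ≫ v.stalkToStalk d.M =
      c.M.obj.presheaf.germ c.V (v.center c.M) hc ≫ v.stalkToStalk c.M := by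
    rw [v.germ_stalkToStalk _ _ _ hd', v.germ_stalkToStalk _ _ _ hc',
      Scheme.Hom.appLE_comp_appLE_assoc,
      ← Y.presheaf.germ_res (homOfLE hle) v.y hd', Scheme.Hom.appLE_map_assoc]
    congr 1
    simp only [(Chart.Hom.dom a).ι_hom]
  refine CommRingCat.hom_ext (RingHom.ext fun s ↦ Subtype.ext ?_)
  exact congrArg (fun φ ↦ φ.hom s) key

/-- The homomorphisms `Γ(M, V) → 𝒪_v`, for the charts `(M, V)` such that `U ⊆ π_M⁻¹ V`, where `U`
is an open neighborhood of `ψ(v)`. -/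
def preSectionsCocone (U : Opens (TopCat.of (RZ f))) (hU : v.psi ∈ U) :
    Cocone (CostructuredArrow.proj (chartOpen f) (op U) ⋙ chartSections f ⋙ uliftRing) where
  pt := uliftRing.obj (CommRingCat.of v.ring)
  ι :=
    { app := fun c ↦ uliftRing.map (v.sectionsToRing c.left (c.hom.unop.le hU))
      naturality := fun c d a ↦
        (congrArg uliftRing.map (v.map_sectionsToRing a.left (c.hom.unop.le hU)
          (d.hom.unop.le hU))).trans (Category.comp_id _).symm }

/-- The homomorphism from the sections over `U` of the presheaf colimit to `𝒪_v`, for an open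
neighborhood `U` of `ψ(v)`, induced by the homomorphisms `Γ(M, V) → 𝒪_v`. -/
def preSectionsToRing (U : Opens (TopCat.of (RZ f))) (hU : v.psi ∈ U) :
    (preStructureSheaf f).obj (op U) ⟶ uliftRing.obj (CommRingCat.of v.ring) :=
  ((chartOpen f).isPointwiseLeftKanExtensionLeftKanExtensionUnit
    (chartSections f ⋙ uliftRing) (op U)).desc (v.preSectionsCocone U hU)

lemma map_preSectionsToRing {U W : Opens (TopCat.of (RZ f))} (i : U ⟶ W) (hU : v.psi ∈ U)
    (hW : v.psi ∈ W) :
    (preStructureSheaf f).map i.op ≫ v.preSectionsToRing U hU = v.preSectionsToRing W hW := by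
  refine ((chartOpen f).isPointwiseLeftKanExtensionLeftKanExtensionUnit
    (chartSections f ⋙ uliftRing) (op W)).hom_ext fun c ↦ ?_
  have h₁ := ((chartOpen f).isPointwiseLeftKanExtensionLeftKanExtensionUnit
    (chartSections f ⋙ uliftRing) (op U)).fac (v.preSectionsCocone U hU)
      (CostructuredArrow.mk (c.hom ≫ i.op))
  have h₂ := ((chartOpen f).isPointwiseLeftKanExtensionLeftKanExtensionUnit
    (chartSections f ⋙ uliftRing) (op W)).fac (v.preSectionsCocone W hW) c
  refine Eq.trans ?_ (h₁.trans h₂.symm)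
  change (((chartOpen f).leftKanExtensionUnit (chartSections f ⋙ uliftRing)).app c.left ≫
      (preStructureSheaf f).map c.hom) ≫ (preStructureSheaf f).map i.op ≫
        v.preSectionsToRing U hU =
    (((chartOpen f).leftKanExtensionUnit (chartSections f ⋙ uliftRing)).app c.left ≫
      (preStructureSheaf f).map (c.hom ≫ i.op)) ≫ v.preSectionsToRing U hU
  rw [Functor.map_comp]
  have aux : ∀ {a b c d e : CommRingCat.{u + 1}} (α : a ⟶ b) (β : b ⟶ c) (γ : c ⟶ d) (δ : d ⟶ e),
      (α ≫ β) ≫ γ ≫ δ = (α ≫ β ≫ γ) ≫ δ := by intros; simp only [Category.assoc]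
  exact aux _ _ _ _

/-- The natural homomorphism `𝒪_x → 𝒪_v` for a point `v` of `Val_Y(X)` and `x = ψ(v)`: it is
induced by the homomorphisms `𝒪_{M, x_M} → 𝒪_v`, where `M` runs over all modifications. -/
def comparison (x : RZ f) (h : v.psi = x) : x.stalk →+* v.ring :=
  (ULift.ringEquiv (R := v.ring)).toRingHom.comp
    (stalkSheafifyInv (T := TopCat.of (RZ f)) (preStructureSheaf f) x ≫
      stalkDesc (T := TopCat.of (RZ f)) (preStructureSheaf f) x
        (A := uliftRing.obj (CommRingCat.of v.ring))
        (fun U hU ↦ v.preSectionsToRing U (h ▸ hU))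
        (fun _ _ i hU hW ↦ v.map_preSectionsToRing i (h ▸ hU) (h ▸ hW))).hom

end Val

/-! ### Semi-valuation rings -/

/-- A valuation `w` makes the ring `A` a semi-valuation ring if every zero divisor of `A` lies in
the kernel of `w` and `w g ≤ w h ≠ 0` implies `h ∣ g`. -/
structure IsSemivaluation {A Γ : Type*} [CommRing A] [LinearOrderedCommGroupWithZero Γ]
    (w : Valuation A Γ) : Prop where
  eq_zero_of_mul_eq_zero : ∀ a b : A, b ≠ 0 → a * b = 0 → w a = 0
  dvd_of_le : ∀ g h : A, w g ≤ w h → w h ≠ 0 → h ∣ g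

/-- The valuation of `𝒪_v` given by the valuation ring `R` of `κ(y)`. -/
def Val.valuation {f : Y ⟶ X} (v : Val f) : Valuation v.ring v.R.ValueGroup :=
  v.R.valuation.comap ((Y.residue v.y).hom.comp v.ring.subtype)

end RelativeRZ

end

/-!
Let `x` be a point of `RZ_Y(X)`. The preimages in `Y` of the neighborhoods of the projections of `x`
to the modifications are called big open subsets. The point `λ(x) = (y, R, φ)` is found in the
limit: the neighborhoods of `y` are the big open subsets, the elements of `𝒪_{Y,y}` that come from
local rings of modifications at `x` form a subring `A`, and `R` is the image of `A` in `κ(y)`. What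
makes this work is the following fact about functions (`RZ.exists_principal`): if `g₁, …, gₙ` are
functions on a big open subset and one of them is `1`, then on the preimage of a neighborhood of `x`
in some modification `N` they are all multiples of one of them, with coefficients from `𝒪_N`.

This is a blow-up. Since `f` is decomposable, `Y` is affine over some modification, hence over a
cofinal family of them, so that `f` may be assumed affine and the `g_m` to be sections of `f_* 𝒪_Y`
over an affine open subset `V` of `X`. The submodule that they generate extends to a submodule of
finite type `L ∋ 1` of `f_* 𝒪_Y` on all of `X` (`exists_isLocGenOn_top`). Over an affine open subset
where `L` is generated by functions `b₁, …, bₙ` without common zero, the schematic image of `Y` in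
projective space under `[b₁ : … : bₙ]` is a modification, on whose charts the `b_m` are multiples of
one of them (`BlowUp`, `nonempty_blowUp`). It depends only on `L` (`LocalGens.exists_compat`), so
these modifications agree on overlaps. As `Y` is schematically dense in them, the identifications
are unique, hence compatible, and the modifications glue to a proper `X`-scheme (`exists_glued`), in
which the schematic image of `Y` is the desired modification (`exists_modification_principal`).

The center `y` exists (`RZ.exists_center`) because the functions on an affine big open subset that
are not invertible on any big open subset form a prime ideal. For the sum of two such functions,
suppose that `g + h` is invertible on a big open subset. The fact above for `1` and
`s = g / (g + h)` shows that `s` is invertible on a big open subset, whence so is `g`, or that `s`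
comes from a local ring of a modification, in which `s` or `1 - s` is invertible.

For `b ∈ 𝒪_{Y,y}` the fact above for `1` and `b` shows that `b ∈ A` or `b⁻¹ ∈ A`
(`RZ.regular_dichotomy`). Thus `A` contains the maximal ideal of `𝒪_{Y,y}`, is the preimage of its
image `R` in `κ(y)`, and `R` is a valuation ring, which dominates the local rings of the
modifications at `x` (`RZ.isLocalHom_toValuationSubring`). So the morphisms from `Spec R` to the
modifications send the closed point to the projections of `x`, which is `ψ(λ(x)) = x`
(`RZ.psi_toVal`). That `Spec κ(y) ⟶ Spec R ×[X] Y` is a closed immersion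
(`RZ.isClosedImmersion_lift`) holds since every function near `y` extends to `Spec R ×[N] Y` for a
modification `N` over which it is defined.

Finally `𝒪_{RZ,x} → 𝒪_{λ(x)} = A` is surjective by the definition of `A`, and injective because a
function on a modification that vanishes on a big open subset vanishes, by schematic density, near
the projection of `x` to a bigger modification (`RZ.bijective_comparison_toVal`). An element of
`𝒪_{λ(x)}` of non-zero value is invertible in `𝒪_{Y,y}`, which gives the statement about the
valuation (`Val.isSemivaluation`).
-/

noncomputable section

namespace RelativeRZ

/-! ### Schematically dominant morphisms -/

section

/-- A morphism is schematically dominant onto its schematic image: the schematic image of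
`g.toImage` is a closed subscheme of that of `g` whose ideal is contained in the kernel of `g`. -/
instance isSchemeTheoreticallyDominant_toImage {Z T : Scheme.{u}} (g : Z ⟶ T) :
    IsSchemeTheoreticallyDominant g.toImage := by
  let i := g.toImage.imageι
  have hk : (i ≫ g.imageι).ker ≤ g.imageι.ker := by
    have e : g = g.toImage.toImage ≫ i ≫ g.imageι := by simp [i]
    rw [show g.imageι.ker = g.ker by simp]
    conv_rhs => rw [e]
    exact Scheme.Hom.le_ker_comp _ _
  have h : IsClosedImmersion.lift (i ≫ g.imageι) g.imageι hk ≫ i = 𝟙 _ := by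
    rw [← cancel_mono g.imageι, Category.assoc, IsClosedImmersion.lift_fac, Category.id_comp]
  refine ⟨?_⟩
  rw [← Scheme.IdealSheafData.ker_subschemeι g.toImage.ker, eq_bot_iff,
    ← Scheme.Hom.ker_eq_bot_of_isIso (𝟙 g.image), ← h]
  exact Scheme.Hom.le_ker_comp _ _

/-- Two morphisms over `X` to a separated `X`-scheme which agree on a schematically dominant `Z ⟶
T` are equal: their equalizer is a closed subscheme of `T` through which `Z` factors. -/
lemma ext_of_isSchemeTheoreticallyDominant {Z T N X : Scheme.{u}} (g : Z ⟶ T)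
    [IsSchemeTheoreticallyDominant g] {a b : T ⟶ N} (p : N ⟶ X) [IsSeparated p]
    (h : a ≫ p = b ≫ p) (hg : g ≫ a = g ≫ b) : a = b := by
  let T' : Over X := Over.mk (a ≫ p)
  let N' : Over X := Over.mk p
  let a' : T' ⟶ N' := Over.homMk a
  let b' : T' ⟶ N' := Over.homMk b h.symm
  have : IsSeparated N'.hom := ‹_›
  let g' : Over.mk (g ≫ a ≫ p) ⟶ T' := Over.homMk g
  have hl : g = (equalizer.lift (f := a') (g := b') g' (by ext1; exact hg)).left ≫
      (equalizer.ι a' b').left := by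
    rw [← Over.comp_left, equalizer.lift_ι]; rfl
  have hk : (equalizer.ι a' b').left.ker = ⊥ := by
    rw [eq_bot_iff, ← g.ker_eq_bot, hl]
    exact Scheme.Hom.le_ker_comp _ _
  have : IsIso (equalizer.ι a' b').left := IsClosedImmersion.isIso_iff_ker_eq_bot.mpr hk
  rw [← cancel_epi (equalizer.ι a' b').left]
  exact congr($(equalizer.condition a' b').left)

/-- A morphism whose restriction to a schematically dominant subobject factors through a closed
immersion factors through it. -/
lemma exists_factor_isClosedImmersion {Z T N P : Scheme.{u}} (g : Z ⟶ T)
    [IsSchemeTheoreticallyDominant g] (c : N ⟶ P) [IsClosedImmersion c] (h : T ⟶ P) (k : Z ⟶ N)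
    (e : g ≫ h = k ≫ c) : ∃ l : T ⟶ N, l ≫ c = h ∧ g ≫ l = k := by
  have hk : c.ker ≤ h.ker := by
    have h1 : (g ≫ h).ker = h.ker := by
      rw [Scheme.Hom.ker_comp, g.ker_eq_bot, Scheme.IdealSheafData.map_bot]
    rw [← h1, e]
    exact Scheme.Hom.le_ker_comp _ _
  refine ⟨IsClosedImmersion.lift c h hk, IsClosedImmersion.lift_fac _ _ _, ?_⟩
  rw [← cancel_mono c, Category.assoc, IsClosedImmersion.lift_fac, e]

namespace Modification

variable {Y X : Scheme.{u}} {f : Y ⟶ X}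

attribute [instance] Modification.proper Modification.dominant

lemma quasiCompact_ι [QuasiCompact f] (M : Modification f) : QuasiCompact M.ι := by
  have : QuasiCompact (M.ι ≫ M.π) := by rw [M.fac]; infer_instance
  exact .of_comp M.ι M.π

/-- The schematic image of `Y` in a proper `X`-scheme. -/
def ofProper {P : Scheme.{u}} (j : Y ⟶ P) (p : P ⟶ X) [QuasiCompact j] [IsProper p]
    (h : j ≫ p = f) :
    Modification f where
  obj := j.image
  ι := j.toImage
  π := j.imageι ≫ p
  fac := by rw [j.toImage_imageι_assoc, h]
  dominant := inferInstance
  proper := inferInstance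

/-- The morphism from `Y` to the fibre product of two modifications. -/
def toProd (M N : Modification f) : Y ⟶ pullback M.π N.π :=
  pullback.lift M.ι N.ι (by rw [M.fac, N.fac])

instance [QuasiCompact f] (M N : Modification f) : QuasiCompact (M.toProd N) := by
  have : QuasiCompact (M.toProd N ≫ pullback.fst _ _ ≫ M.π) := by
    rwa [toProd, pullback.lift_fst_assoc, M.fac]
  exact .of_comp _ (pullback.fst _ _ ≫ M.π)

/-- The join of two modifications: the schematic image of `Y` in their fibre product. -/
def join [QuasiCompact f] (M N : Modification f) : Modification f :=
  ofProper (M.toProd N) (pullback.fst M.π N.π ≫ M.π)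
    (by rw [toProd, pullback.lift_fst_assoc, M.fac])

/-- The join of two modifications dominates the first one. -/
def joinLeft [QuasiCompact f] (M N : Modification f) : (M.join N).Dom M where
  hom := Scheme.Hom.imageι _ ≫ pullback.fst _ _
  ι_hom := (Scheme.Hom.toImage_imageι_assoc _ _).trans (pullback.lift_fst _ _ _)
  hom_π := Category.assoc _ _ _

/-- The join of two modifications dominates the second one. -/
def joinRight [QuasiCompact f] (M N : Modification f) : (M.join N).Dom N where
  hom := Scheme.Hom.imageι _ ≫ pullback.snd _ _
  ι_hom := (Scheme.Hom.toImage_imageι_assoc _ _).trans (pullback.lift_snd _ _ _)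
  hom_π := (Category.assoc _ _ _).trans (by rw [← pullback.condition]; rfl)

lemma Dom.isAffineHom {N M : Modification f} (a : N.Dom M) [IsAffineHom M.ι] : IsAffineHom N.ι := by
  have : IsSeparated (a.hom ≫ M.π) := by rw [a.hom_π]; infer_instance
  have : IsSeparated a.hom := .of_comp a.hom M.π
  have : IsAffineHom (N.ι ≫ a.hom) := by rw [a.ι_hom]; infer_instance
  exact .of_comp _ a.hom

/-- If `f` is affine over a proper `X`-scheme `Z`, then `Y` is affine over its schematic image in
`Z`. -/
lemma exists_isAffineHom (hf : IsDecomposable f) : ∃ M : Modification f, IsAffineHom M.ι := by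
  obtain ⟨Z, g, h, hg, hh, e⟩ := hf
  refine ⟨ofProper g h e, ?_⟩
  have : IsAffineHom (g.toImage ≫ g.imageι) := by rw [g.toImage_imageι]; infer_instance
  exact .of_comp g.toImage g.imageι

end Modification

end

/-! ### Projective space over an affine base -/

section

lemma ι_appLE_top {Z : Scheme.{u}} (W : Z.Opens) :
    W.ι.appLE W ⊤ (by simp) = W.topIso.inv := by
  simp only [Scheme.Hom.appLE, Scheme.Opens.ι_app, Scheme.Opens.topIso_inv,
    Scheme.Opens.toScheme_presheaf_map]
  exact (Z.presheaf.map_comp _ _).symm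

namespace ProjSpace

variable (R : CommRingCat.{u}) (n : ℕ)

/-- The grading of the polynomial ring by degree, indexed by all of `ℕ`. -/
abbrev grading : ℕ → Submodule R (MvPolynomial (Fin n) R) :=
  MvPolynomial.homogeneousSubmodule (Fin n) R

instance : GradedAlgebra (grading R n) := MvPolynomial.gradedAlgebra

instance : IsScalarTower R (grading R n 0) (MvPolynomial (Fin n) R) :=
  .of_algebraMap_eq (R := R) (S := grading R n 0) (A := MvPolynomial (Fin n) R) fun _ ↦ rfl

/-- Projective space with `n` homogeneous coordinates. -/
abbrev PSpace : Scheme.{u} := Proj (grading R n)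

lemma bijective_algebraMap_zero : Function.Bijective (algebraMap R (grading R n 0)) := by
  refine ⟨fun a b h ↦ ?_, fun ⟨p, hp⟩ ↦ ?_⟩
  · exact MvPolynomial.C_injective (Fin n) R (congrArg Subtype.val h)
  · have := (MvPolynomial.totalDegree_zero_iff_isHomogeneous _).mpr hp
    rw [MvPolynomial.totalDegree_eq_zero_iff_eq_C] at this
    exact ⟨_, Subtype.ext this.symm⟩

instance : IsIso (CommRingCat.ofHom (algebraMap R (grading R n 0))) :=
  (ConcreteCategory.isIso_iff_bijective _).mpr (bijective_algebraMap_zero R n)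

instance : Algebra.FiniteType (grading R n 0) (MvPolynomial (Fin n) R) :=
  Algebra.FiniteType.of_restrictScalars_finiteType R _ _

/-- The structure morphism of projective space. -/
def toSpec : PSpace R n ⟶ Spec R :=
  Proj.toSpecZero (grading R n) ≫ Spec.map (CommRingCat.ofHom (algebraMap R (grading R n 0)))

instance : IsProper (toSpec R n) := by unfold toSpec; infer_instance

/-- The standard chart of projective space on which the `l`-th coordinate is invertible. -/
abbrev chart (l : Fin n) : (PSpace R n).Opens := Proj.basicOpen (grading R n) (MvPolynomial.X l)

variable {R n}

lemma X_mem (l : Fin n) : (MvPolynomial.X l : MvPolynomial (Fin n) R) ∈ grading R n 1 :=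
  MvPolynomial.isHomogeneous_X R l

/-- The ratio of two homogeneous coordinates, as an element of the coordinate ring of a chart. -/
def awayRatio (l m : Fin n) : HomogeneousLocalization.Away (grading R n) (MvPolynomial.X l) :=
  HomogeneousLocalization.Away.mk (grading R n) (X_mem l) 1 (MvPolynomial.X m)
    (by simpa using X_mem m)

lemma val_awayRatio_mul (l m : Fin n) :
    (awayRatio (R := R) l m).val * algebraMap (MvPolynomial (Fin n) R) _ (MvPolynomial.X l) =
      algebraMap (MvPolynomial (Fin n) R) _ (MvPolynomial.X m) := by
  rw [awayRatio, HomogeneousLocalization.Away.val_mk, Localization.mk_eq_mk']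
  simp

/-- The ratio of two homogeneous coordinates, as a section over a chart. -/
def ratio (l m : Fin n) : Γ(PSpace R n, chart R n l) :=
  (Proj.awayToSection (grading R n) (MvPolynomial.X l)).hom (awayRatio l m)

lemma adjoin_zero_range_X :
    Algebra.adjoin (grading R n 0) (Set.range (MvPolynomial.X : Fin n → MvPolynomial (Fin n) R)) =
      ⊤ := by
  rw [← top_le_iff]
  intro x _
  induction x using MvPolynomial.induction_on with
  | C a => exact Subalgebra.algebraMap_mem _ (algebraMap R (grading R n 0) a)
  | add p q hp hq => exact add_mem (hp trivial) (hq trivial)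
  | mul_X p i hp => exact mul_mem (hp trivial) (Algebra.subset_adjoin ⟨i, rfl⟩)

lemma iSup_chart : ⨆ l, chart R n l = ⊤ :=
  Proj.iSup_basicOpen_eq_top' (grading R n) _ (fun i ↦ ⟨1, X_mem i⟩) adjoin_zero_range_X

/-- The standard chart as the spectrum of the degree zero part of the localization at `X_l`. -/
abbrev chartι (l : Fin n) :
    Spec (.of <| HomogeneousLocalization.Away (grading R n) (MvPolynomial.X l)) ⟶ PSpace R n :=
  Proj.awayι (grading R n) (MvPolynomial.X l) (X_mem l) one_pos

lemma opensRange_chartι (l : Fin n) : (chartι (R := R) l).opensRange = chart R n l :=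
  Proj.opensRange_awayι _ _ _ _

lemma le_preimage_chartι (l : Fin n) : ⊤ ≤ chartι (R := R) l ⁻¹ᵁ chart R n l := by
  rw [← opensRange_chartι]; simp

lemma awayToSection_appLE (l : Fin n) :
    Proj.awayToSection (grading R n) (MvPolynomial.X l) ≫
      (chartι l).appLE (chart R n l) ⊤ (le_preimage_chartι l) = (Scheme.ΓSpecIso _).inv := by
  let D := Proj.basicOpen (grading R n) (MvPolynomial.X l)
  let e := Proj.basicOpenIsoSpec (grading R n) (MvPolynomial.X l) (X_mem l) one_pos
  have h : e.hom.appTop = (Scheme.ΓSpecIso _).hom ≫ Proj.awayToSection (grading R n)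
      (MvPolynomial.X l) ≫ D.topIso.inv :=
    Proj.basicOpenToSpec_app_top (grading R n) (MvPolynomial.X l)
  have h' : D.ι.appLE D ⊤ (by simp) = D.topIso.inv :=
    ι_appLE_top _
  have h₁ : (chartι l).appLE (chart R n l) ⊤ (le_preimage_chartι l) =
      D.topIso.inv ≫ e.inv.appTop := by
    rw [← h', Scheme.Hom.appTop, ← Scheme.Hom.appLE_eq_app e.inv]
    exact (Scheme.Hom.appLE_comp_appLE _ _ _ _ _ _ _).symm
  have h₂ : e.hom.appTop ≫ e.inv.appTop = 𝟙 _ := by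
    rw [← Scheme.Hom.comp_appTop]; simp
  rw [h₁, ← cancel_epi (Scheme.ΓSpecIso _).hom, ← h₂.trans (Iso.hom_inv_id _).symm, h]
  simp only [Category.assoc]

/-- In degree zero, `F / X_l ^ k` is the value of `F` at the ratios `X_m / X_l`. -/
lemma away_mk_eq (l : Fin n) (k : ℕ) (F : MvPolynomial (Fin n) R) (hF : F ∈ grading R n k)
    (hF' : F ∈ grading R n (k • 1)) :
    HomogeneousLocalization.Away.mk (grading R n) (X_mem l) k F hF' =
      MvPolynomial.eval₂Hom ((algebraMap (grading R n 0) (HomogeneousLocalization.Away (grading R n)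
        (MvPolynomial.X l))).comp (algebraMap R _)) (awayRatio l) F := by
  let L := Localization.Away (MvPolynomial.X l : MvPolynomial (Fin n) R)
  let v : HomogeneousLocalization.Away (grading R n) (MvPolynomial.X l : MvPolynomial (Fin n) R)
      →+* L :=
    algebraMap _ _
  let t : L := algebraMap (MvPolynomial (Fin n) R) L (MvPolynomial.X l)
  have ht : IsUnit t := IsLocalization.Away.algebraMap_isUnit _
  have hr : ∀ m, v (awayRatio l m) * t = algebraMap (MvPolynomial (Fin n) R) L (MvPolynomial.X m) :=
      val_awayRatio_mul l
  have hm : v (HomogeneousLocalization.Away.mk (grading R n) (X_mem l) k F hF') * t ^ k =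
      algebraMap (MvPolynomial (Fin n) R) L F := by
    change (HomogeneousLocalization.Away.mk (grading R n) (X_mem l) k F _).val * _ = _
    rw [HomogeneousLocalization.Away.val_mk, Localization.mk_eq_mk']
    simpa using IsLocalization.mk'_spec L F (⟨MvPolynomial.X l ^ k, k, rfl⟩ : Submonoid.powers _)
  apply HomogeneousLocalization.val_injective
  apply (ht.pow k).mul_right_cancel
  refine hm.trans ?_
  change _ = v _ * _
  have h₁ : algebraMap (MvPolynomial (Fin n) R) L F =
      MvPolynomial.eval₂Hom ((algebraMap (MvPolynomial (Fin n) R) L).comp MvPolynomial.C)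
        (fun m ↦ v (awayRatio l m) * t) F := by
    congr 1
    apply MvPolynomial.ringHom_ext
    · intro a; simp
    · intro m; simp [hr]
  rw [h₁, MvPolynomial.coe_eval₂Hom, MvPolynomial.coe_eval₂Hom, MvPolynomial.eval₂_eq',
    MvPolynomial.eval₂_eq', map_sum, Finset.sum_mul]
  refine Finset.sum_congr rfl fun d hd ↦ ?_
  have hdk : ∑ i, d i = k := by
    have := hF (MvPolynomial.mem_support_iff.mp hd)
    simpa [Finsupp.weight_apply, Finsupp.sum_fintype] using this
  simp only [mul_pow, Finset.prod_mul_distrib, Finset.prod_pow_eq_pow_sum, hdk, map_mul, map_prod,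
    map_pow, mul_assoc]
  congr 1

lemma away_ringHom_ext (l : Fin n) {B : Type*} [CommRing B]
    (α β : HomogeneousLocalization.Away (grading R n) (MvPolynomial.X l) →+* B)
    (h : ∀ a : R, α (algebraMap (grading R n 0) _ (algebraMap R _ a)) =
      β (algebraMap (grading R n 0) _ (algebraMap R _ a)))
    (h' : ∀ m, α (awayRatio l m) = β (awayRatio l m)) : α = β := by
  let γ : MvPolynomial (Fin n) R →+* HomogeneousLocalization.Away (grading R n)
      (MvPolynomial.X l) :=
    MvPolynomial.eval₂Hom ((algebraMap (grading R n 0) _).comp (algebraMap R _)) (awayRatio l)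
  have hγ : α.comp γ = β.comp γ := by
    apply MvPolynomial.ringHom_ext
    · intro a; simpa [γ] using h a
    · intro m; simpa [γ] using h' m
  ext x
  obtain ⟨k, F, hF, rfl⟩ := HomogeneousLocalization.Away.mk_surjective (grading R n) (X_mem l) x
  rw [away_mk_eq l k F (by simpa using hF) hF]
  exact congr($hγ F)

lemma chartι_toSpec (l : Fin n) : chartι l ≫ toSpec R n =
    Spec.map (CommRingCat.ofHom ((algebraMap (grading R n 0) _).comp (algebraMap R _))) := by
  rw [toSpec, Proj.awayι_toSpecZero_assoc, ← Spec.map_comp]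
  rfl

/-- A morphism to projective space is determined by its structure morphism and, locally, by the
ratios of the coordinates. -/
lemma hom_ext {Z : Scheme.{u}} {a b : Z ⟶ PSpace R n} (h : a ≫ toSpec R n = b ≫ toSpec R n)
    (H : ∀ z : Z, ∃ (l : Fin n) (W : Z.Opens) (_ : z ∈ W) (ha : W ≤ a ⁻¹ᵁ chart R n l)
      (hb : W ≤ b ⁻¹ᵁ chart R n l), ∀ m,
        (a.appLE (chart R n l) W ha).hom (ratio l m) =
          (b.appLE (chart R n l) W hb).hom (ratio l m)) :
    a = b := by
  choose l W hzW ha hb hr using H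
  have hW : IsOpenCover W := .mk (by ext z; simpa using ⟨z, hzW z⟩)
  refine (Z.openCoverOfIsOpenCover W hW).hom_ext _ _ fun (z : Z) ↦ ?_
  change (W z).ι ≫ a = (W z).ι ≫ b
  have ha' : Set.range ((W z).ι ≫ a) ⊆ Set.range (chartι (R := R) (l z)) := by
    rintro _ ⟨w, rfl⟩
    exact (opensRange_chartι (l z)).ge (ha z w.2)
  have hb' : Set.range ((W z).ι ≫ b) ⊆ Set.range (chartι (R := R) (l z)) := by
    rintro _ ⟨w, rfl⟩
    exact (opensRange_chartι (l z)).ge (hb z w.2)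
  rw [← IsOpenImmersion.lift_fac (chartι (l z)) ((W z).ι ≫ a) ha',
    ← IsOpenImmersion.lift_fac (chartι (l z)) ((W z).ι ≫ b) hb']
  congr 1
  apply ext_of_isAffine
  rw [← cancel_epi (Scheme.ΓSpecIso _).inv]
  have key (c : Z ⟶ PSpace R n) (hc : W z ≤ c ⁻¹ᵁ chart R n (l z))
      (hc' : Set.range ((W z).ι ≫ c) ⊆ Set.range (chartι (R := R) (l z))) (m) :
      (((Scheme.ΓSpecIso _).inv ≫
        (IsOpenImmersion.lift (chartι (l z)) ((W z).ι ≫ c) hc').appTop).hom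
        (awayRatio (l z) m)) = ((W z).ι.appLE (W z) ⊤ (by simp)).hom
          ((c.appLE (chart R n (l z)) (W z) hc).hom (ratio (l z) m)) := by
    rw [← awayToSection_appLE, Scheme.Hom.appTop, ← Scheme.Hom.appLE_eq_app]
    have e₁ := Scheme.Hom.appLE_comp_appLE (IsOpenImmersion.lift (chartι (l z)) ((W z).ι ≫ c) hc')
      (chartι (l z)) (chart R n (l z)) ⊤ ⊤ (le_preimage_chartι _) le_top
    have e₂ := Scheme.Hom.appLE_comp_appLE (W z).ι c (chart R n (l z)) (W z) ⊤ hc (by simp)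
    simp only [IsOpenImmersion.lift_fac] at e₁
    exact congr($(e₁.trans e₂.symm).hom (ratio (l z) m))
  have key' (c : Z ⟶ PSpace R n)
      (hc' : Set.range ((W z).ι ≫ c) ⊆ Set.range (chartι (R := R) (l z))) (r : R) :
      (((Scheme.ΓSpecIso _).inv ≫
        (IsOpenImmersion.lift (chartι (l z)) ((W z).ι ≫ c) hc').appTop).hom
        (algebraMap (grading R n 0) _ (algebraMap R _ r))) =
        (((Scheme.ΓSpecIso _).inv ≫ ((W z).ι ≫ c ≫ toSpec R n).appTop).hom r) := by
    have e₁ : (W z).ι ≫ c ≫ toSpec R n = IsOpenImmersion.lift (chartι (l z)) ((W z).ι ≫ c) hc' ≫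
        Spec.map (CommRingCat.ofHom ((algebraMap (grading R n 0) _).comp (algebraMap R _))) := by
      rw [← chartι_toSpec, IsOpenImmersion.lift_fac_assoc, Category.assoc]
    rw [e₁, Scheme.Hom.comp_appTop, ← Scheme.ΓSpecIso_inv_naturality_assoc]
    rfl
  ext1
  apply away_ringHom_ext
  · intro r
    rw [key', key', h]
  · intro m
    rw [key _ (ha z), key _ (hb z)]
    exact congrArg _ (hr z m)

/-- On the locus where `c l = f X_l` is invertible, the morphism given by `f` is the one to the
chart of `X_l` which corresponds to the ratios `c m / c l`. -/
lemma exists_ι_comp_fromOfGlobalSections {Z : Scheme.{u}} (f : MvPolynomial (Fin n) R →+* Γ(Z, ⊤))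
    (hf : (HomogeneousIdeal.irrelevant (grading R n)).toIdeal.map f = ⊤) (l : Fin n) :
    ∃ (q : HomogeneousLocalization.Away (grading R n) (MvPolynomial.X l) →+*
        Localization.Away (f (MvPolynomial.X l)))
      (θ : (Z.basicOpen (f (MvPolynomial.X l))).toScheme ⟶
        Spec (.of (Localization.Away (f (MvPolynomial.X l))))),
      (∀ m, q (awayRatio l m) * algebraMap _ _ (f (MvPolynomial.X l)) =
        algebraMap _ _ (f (MvPolynomial.X m))) ∧
      θ ≫ Spec.map (CommRingCat.ofHom (algebraMap Γ(Z, ⊤) _)) = Scheme.Opens.ι _ ≫ Z.toSpecΓ ∧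
      Scheme.Opens.ι _ ≫ Proj.fromOfGlobalSections (grading R n) f hf =
        θ ≫ Spec.map (CommRingCat.ofHom q) ≫ chartι l := by
  let x := f (MvPolynomial.X l)
  let g : Localization.Away (MvPolynomial.X l : MvPolynomial (Fin n) R) →+* Localization.Away x :=
    IsLocalization.map (M := .powers (MvPolynomial.X l)) (T := .powers x) _ f (by
      rw [← Submonoid.map_le_iff_le_comap, Submonoid.map_powers])
  refine ⟨g.comp (algebraMap _ _), (Z.isoOfEq (Z.toSpecΓ_preimage_basicOpen x)).inv ≫
    Z.toSpecΓ ∣_ _ ≫ (basicOpenIsoSpecAway _).hom, fun m ↦ ?_, ?_, ?_⟩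
  · have := congrArg g (val_awayRatio_mul l m)
    rw [map_mul] at this
    simpa [g, IsLocalization.map_eq] using this
  · simp only [Category.assoc, basicOpenIsoSpecAway_hom_SpecMap, Scheme.isoOfEq_inv]
    refine (congrArg (_ ≫ ·) (morphismRestrict_ι Z.toSpecΓ _)).trans ?_
    rw [Scheme.homOfLE_ι_assoc]
  · have h := Proj.fromOfGlobalSections_resLE (grading R n) f hf one_pos (X_mem l)
    rw [← Scheme.Hom.resLE_comp_ι _
      (Proj.fromOfGlobalSections_preimage_basicOpen _ f hf one_pos (X_mem l)).ge, h,
      Proj.toBasicOpenOfGlobalSections]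
    simp only [Category.assoc, Proj.basicOpenIsoSpec_inv_ι]
    rfl

lemma fromOfGlobalSections_appLE_ratio {Z : Scheme.{u}} (f : MvPolynomial (Fin n) R →+* Γ(Z, ⊤))
    (hf : (HomogeneousIdeal.irrelevant (grading R n)).toIdeal.map f = ⊤) (c : Fin n → Γ(Z, ⊤))
    (hc : ∀ l, f (MvPolynomial.X l) = c l) (l m : Fin n)
    (e : Z.basicOpen (c l) ≤ Proj.fromOfGlobalSections (grading R n) f hf ⁻¹ᵁ chart R n l) :
    ((Proj.fromOfGlobalSections (grading R n) f hf).appLE (chart R n l) (Z.basicOpen (c l)) e).hom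
        (ratio l m) * (Z.presheaf.map (homOfLE le_top).op).hom (c l) =
      (Z.presheaf.map (homOfLE le_top).op).hom (c m) := by
  obtain rfl : (fun l ↦ f (MvPolynomial.X l)) = c := funext hc
  obtain ⟨q, θ, hq, hθ, hι⟩ := exists_ι_comp_fromOfGlobalSections f hf l
  let W := Z.basicOpen (f (MvPolynomial.X l))
  have h₁ : W.ι.appLE W ⊤ (by simp) = W.topIso.inv :=
    ι_appLE_top _
  have hinj : Function.Injective (W.ι.appLE W ⊤ (by simp)).hom := by
    rw [h₁]
    exact ((ConcreteCategory.isIso_iff_bijective _).mp inferInstance).1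
  have hres (x : Γ(Z, ⊤)) : (W.ι.appLE W ⊤ (by simp)).hom
      ((Z.presheaf.map (homOfLE (le_top : W ≤ ⊤)).op).hom x) =
        ((Scheme.ΓSpecIso _).inv ≫ θ.appTop).hom (algebraMap _ _ x) := by
    have e₁ := congrArg (fun k ↦ (Scheme.ΓSpecIso _).inv ≫ k.appTop) hθ
    simp only [Scheme.Hom.comp_appTop, ← Scheme.ΓSpecIso_inv_naturality_assoc] at e₁
    have e₂ := congrArg (fun k ↦ k.hom x) e₁
    refine Eq.trans ?_ e₂.symm
    have e₃ := Scheme.Hom.map_appLE W.ι (V := ⊤) (U := W) (U' := ⊤) (by simp)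
        (homOfLE (le_top : W ≤ ⊤)).op
    refine (congrArg (fun k ↦ k.hom x) e₃).trans ?_
    have e₆ : (Scheme.ΓSpecIso Γ(Z, ⊤)).inv ≫ Z.toSpecΓ.appTop ≫ W.ι.appTop =
        W.ι.appLE ⊤ ⊤ (by simp) := by
      rw [Scheme.toSpecΓ_appTop, Iso.inv_hom_id_assoc]
      exact (Scheme.Hom.appLE_eq_app _).symm
    exact (congrArg (fun k ↦ k.hom x) e₆).symm
  have hrat : (W.ι.appLE W ⊤ (by simp)).hom
      (((Proj.fromOfGlobalSections (grading R n) f hf).appLE (chart R n l) W e).hom (ratio l m)) =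
        ((Scheme.ΓSpecIso _).inv ≫ θ.appTop).hom (q (awayRatio l m)) := by
    have e₁ := Scheme.Hom.appLE_comp_appLE W.ι (Proj.fromOfGlobalSections (grading R n) f hf)
      (chart R n l) W ⊤ e (by simp)
    refine (congrArg (fun k ↦ k.hom (ratio l m)) e₁).trans ?_
    change W.ι ≫ _ = _ at hι
    simp only [hι]
    have e₂ := Scheme.Hom.appLE_comp_appLE (θ ≫ Spec.map (CommRingCat.ofHom q)) (chartι l)
      (chart R n l) ⊤ ⊤ (le_preimage_chartι _) le_top
    simp only [Category.assoc] at e₂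
    refine (congrArg (fun k ↦ k.hom (ratio l m)) e₂).symm.trans ?_
    have e₃ := congrArg (fun k ↦ k.hom (awayRatio l m)) (awayToSection_appLE (R := R) l)
    refine (congrArg ((θ ≫ Spec.map (CommRingCat.ofHom q)).appLE ⊤ ⊤ le_top).hom e₃).trans ?_
    have e₄ := Scheme.ΓSpecIso_inv_naturality (CommRingCat.ofHom q)
    have e₅ : (θ ≫ Spec.map (CommRingCat.ofHom q)).appLE ⊤ ⊤ le_top =
        (Spec.map (CommRingCat.ofHom q)).appTop ≫ θ.appTop :=
      Scheme.Hom.appLE_eq_app _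
    rw [e₅]
    refine (congrArg (fun k ↦ (k ≫ θ.appTop).hom (awayRatio l m)) e₄).symm
  apply hinj
  rw [map_mul, hres, hres, hrat, ← map_mul, hq]

/-- Functions `c l` on `Z` without common zero are the homogeneous coordinates of a morphism to
projective space. -/
lemma exists_hom {Z : Scheme.{u}} (φ : Z ⟶ Spec R) (c : Fin n → Γ(Z, ⊤))
    (hc : Ideal.span (Set.range c) = ⊤) :
    ∃ h : Z ⟶ PSpace R n, h ≫ toSpec R n = φ ∧
      ∀ l, ∃ e : h ⁻¹ᵁ chart R n l = Z.basicOpen (c l), ∀ m,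
        (h.appLE (chart R n l) (Z.basicOpen (c l)) e.ge).hom (ratio l m) *
          (Z.presheaf.map (homOfLE le_top).op).hom (c l) =
            (Z.presheaf.map (homOfLE le_top).op).hom (c m) := by
  let f : MvPolynomial (Fin n) R →+* Γ(Z, ⊤) :=
    MvPolynomial.eval₂Hom ((Scheme.ΓSpecIso R).inv ≫ φ.appTop).hom c
  have hfX (l) : f (MvPolynomial.X l) = c l := MvPolynomial.eval₂Hom_X' _ _ _
  have hf : (HomogeneousIdeal.irrelevant (grading R n)).toIdeal.map f = ⊤ := by
    rw [← top_le_iff, ← hc, Ideal.span_le]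
    rintro _ ⟨l, rfl⟩
    rw [← hfX]
    exact Ideal.mem_map_of_mem f (HomogeneousIdeal.mem_irrelevant_of_mem _ one_pos (X_mem l))
  refine ⟨Proj.fromOfGlobalSections (grading R n) f hf, ?_, fun l ↦ ?_⟩
  · rw [toSpec, Proj.fromOfGlobalSections_toSpecZero_assoc, ← Spec.map_comp,
      ← CommRingCat.ofHom_comp]
    have : (f.comp (algebraMap (grading R n 0) _)).comp (algebraMap R (grading R n 0)) =
        ((Scheme.ΓSpecIso R).inv ≫ φ.appTop).hom := by
      ext r
      exact MvPolynomial.eval₂Hom_C _ _ _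
    rw [this, CommRingCat.ofHom_hom, Spec.map_comp, ← Scheme.toSpecΓ_naturality_assoc]
    simp
  · have e := Proj.fromOfGlobalSections_preimage_basicOpen (grading R n) f hf one_pos (X_mem l)
    have e' := e
    rw [hfX] at e'
    exact ⟨e', fun m ↦ fromOfGlobalSections_appLE_ratio f hf c hfX l m _⟩

end ProjSpace

end

/-! ### Blow-ups over an affine base -/

section

/-- The restriction of a global section to an open subset. -/
abbrev resTop {Z : Scheme.{u}} (W : Z.Opens) : Γ(Z, ⊤) →+* Γ(Z, W) :=
  (Z.presheaf.map (homOfLE le_top).op).hom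

lemma appLE_resTop {Z T : Scheme.{u}} (g : Z ⟶ T) {U : T.Opens} {W : Z.Opens} (e : W ≤ g ⁻¹ᵁ U)
    (x : Γ(T, ⊤)) : (g.appLE U W e).hom (resTop U x) = resTop W (g.appTop.hom x) := by
  have e₁ := Scheme.Hom.map_appLE g e (homOfLE (le_top : U ≤ ⊤)).op
  have e₂ := Scheme.Hom.appLE_map g (U := ⊤) (V := ⊤) (le_top : ⊤ ≤ g ⁻¹ᵁ ⊤)
      (homOfLE (le_top : W ≤ ⊤)).op
  have e₃ : g.appLE ⊤ ⊤ le_top = g.appTop := Scheme.Hom.appLE_eq_app _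
  rw [e₃] at e₂
  exact (congrArg (fun k ↦ k.hom x) (e₁.trans e₂.symm))

lemma isUnit_resTop_of_le_basicOpen {Z : Scheme.{u}} {W : Z.Opens} {x : Γ(Z, ⊤)}
    (h : W ≤ Z.basicOpen x) : IsUnit (resTop W x) := by
  have h₁ : IsUnit ((Z.presheaf.map (homOfLE (le_top : Z.basicOpen x ≤ ⊤)).op).hom x) :=
    RingedSpace.isUnit_res_basicOpen Z.toRingedSpace x
  have h₂ := h₁.map (Z.presheaf.map (homOfLE h).op).hom
  have h₃ := Z.presheaf.map_comp (homOfLE (le_top : Z.basicOpen x ≤ ⊤)).op (homOfLE h).op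
  exact (congrArg (fun k ↦ IsUnit (k.hom x)) h₃).mpr h₂

/-- The blow-up of `X` along functions `c l` on `Y` without common zero: the schematic image of
`Y` in the projective space over `X` under the morphism with homogeneous coordinates `c l`. Of
this scheme the structure records the `chart l` on which the `l`-th coordinate is invertible, the
functions `ratio l m` on it which induce `c m / c l` on `Y`, and in `exists_lift` its mapping
property: if `T` contains `Z` schematically densely and the pullbacks of the `c m` to `Z` are, up
to a unit, restrictions of functions on `T` without common zero, then `Z ⟶ Y ⟶ obj` extends to
`T`. -/
structure BlowUp {Y X : Scheme.{u}} (f : Y ⟶ X) {n : ℕ} (c : Fin n → Γ(Y, ⊤)) where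
  obj : Scheme.{u}
  ι : Y ⟶ obj
  π : obj ⟶ X
  fac : ι ≫ π = f
  dominant : IsSchemeTheoreticallyDominant ι
  quasiCompact : QuasiCompact ι
  proper : IsProper π
  chart : Fin n → obj.Opens
  iSup_chart : ⨆ l, chart l = ⊤
  preimage_chart : ∀ l, ι ⁻¹ᵁ chart l = Y.basicOpen (c l)
  ratio : ∀ l : Fin n, Fin n → Γ(obj, chart l)
  ratio_mul : ∀ l m, (ι.appLE (chart l) (Y.basicOpen (c l)) (preimage_chart l).ge).hom (ratio l m) *
    resTop _ (c l) = resTop _ (c m)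
  exists_lift : ∀ {Z T : Scheme.{u}} (t : Z ⟶ T) [IsSchemeTheoreticallyDominant t] (u : T ⟶ X)
    (s : Z ⟶ Y) (_ : t ≫ u = s ≫ f) (d : Fin n → Γ(T, ⊤)) (_ : Ideal.span (Set.range d) = ⊤)
    (e : Γ(Z, ⊤)) (_ : IsUnit e) (_ : ∀ m, t.appTop.hom (d m) * e = s.appTop.hom (c m)),
      ∃ k : T ⟶ obj, t ≫ k = s ≫ ι ∧ k ≫ π = u

lemma iSup_basicOpen_eq_top_of_span {Z : Scheme.{u}} {n : ℕ} (c : Fin n → Γ(Z, ⊤))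
    (h : Ideal.span (Set.range c) = ⊤) : ⨆ l, Z.basicOpen (c l) = ⊤ := by
  have := Z.zeroLocus_span (U := ⊤) (Set.range c)
  rw [h] at this
  ext1
  apply compl_injective
  simp only [TopologicalSpace.Opens.coe_iSup, Set.compl_iUnion, ← Scheme.zeroLocus_singleton,
      ← Scheme.zeroLocus_iUnion, Set.iUnion_singleton_eq_range, TopologicalSpace.Opens.coe_top,
      Set.compl_univ]
  rw [← this]; simp

/-- Over an affine base the blow-up exists. The extension to `T` is the morphism to projective
space given by the functions on `T`; it lands in the schematic image of `Y` since it does so on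
`Z`. -/
lemma nonempty_blowUp {Y X : Scheme.{u}} [IsAffine X] (f : Y ⟶ X) [QuasiCompact f] {n : ℕ}
    (c : Fin n → Γ(Y, ⊤)) (hc : Ideal.span (Set.range c) = ⊤) : Nonempty (BlowUp f c) := by
  obtain ⟨q, hq, hq'⟩ := ProjSpace.exists_hom (f ≫ X.isoSpec.hom) c hc
  choose hch hrat using hq'
  have hqc : QuasiCompact q := by
    have : QuasiCompact (q ≫ ProjSpace.toSpec _ n) := by rw [hq]; infer_instance
    exact .of_comp q (ProjSpace.toSpec _ n)
  refine ⟨{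
    obj := q.image
    ι := q.toImage
    π := q.imageι ≫ ProjSpace.toSpec _ n ≫ X.isoSpec.inv
    fac := by rw [q.toImage_imageι_assoc, reassoc_of% hq]; simp
    dominant := inferInstance
    quasiCompact := inferInstance
    proper := inferInstance
    chart := fun l ↦ q.imageι ⁻¹ᵁ ProjSpace.chart _ n l
    iSup_chart := by
      rw [← Scheme.Hom.preimage_iSup, ProjSpace.iSup_chart]; rfl
    preimage_chart := fun l ↦ by
      rw [← hch, ← Scheme.Hom.comp_preimage, q.toImage_imageι]
    ratio := fun l m ↦ (q.imageι.appLE (ProjSpace.chart _ n l) _ le_rfl).hom (ProjSpace.ratio l m)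
    ratio_mul := fun l m ↦ ?_
    exists_lift := ?_ }⟩
  · refine Eq.trans ?_ (hrat l m)
    congr 1
    have e := Scheme.Hom.appLE_comp_appLE q.toImage q.imageι (ProjSpace.chart _ n l)
      (q.imageι ⁻¹ᵁ ProjSpace.chart _ n l) (Y.basicOpen (c l)) le_rfl (by
        rw [← hch, ← Scheme.Hom.comp_preimage, q.toImage_imageι])
    refine (congrArg (fun k ↦ k.hom (ProjSpace.ratio l m)) e).trans ?_
    simp only [q.toImage_imageι]
  · intro Z T t _ u s hts d hd e he hde
    obtain ⟨h, hh, hh'⟩ := ProjSpace.exists_hom (u ≫ X.isoSpec.hom) d hd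
    choose hch₂ hrat₂ using hh'
    have key : t ≫ h = s ≫ q := by
      apply ProjSpace.hom_ext
      · rw [Category.assoc, hh, Category.assoc, hq, reassoc_of% hts]
      · intro z
        have hz : t z ∈ ⨆ l, T.basicOpen (d l) := by
          rw [iSup_basicOpen_eq_top_of_span d hd]; trivial
        obtain ⟨l, hl⟩ := Opens.mem_iSup.mp hz
        have hb : t ⁻¹ᵁ T.basicOpen (d l) ≤ s ⁻¹ᵁ Y.basicOpen (c l) := by
          rw [Scheme.preimage_basicOpen_top, Scheme.preimage_basicOpen_top]
          have := hde l
          calc _ = Z.basicOpen (t.appTop.hom (d l) * e) := by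
                rw [Scheme.basicOpen_mul, Scheme.basicOpen_of_isUnit _ he, inf_top_eq]
            _ ≤ _ := by rw [this]
        have ha : t ⁻¹ᵁ T.basicOpen (d l) ≤ (t ≫ h) ⁻¹ᵁ ProjSpace.chart _ n l := by
          rw [Scheme.Hom.comp_preimage, hch₂]
        have hb' : t ⁻¹ᵁ T.basicOpen (d l) ≤ (s ≫ q) ⁻¹ᵁ ProjSpace.chart _ n l := by
          rwa [Scheme.Hom.comp_preimage, hch]
        refine ⟨l, t ⁻¹ᵁ T.basicOpen (d l), hl, ha, hb', fun m ↦ ?_⟩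
        have e₁ := Scheme.Hom.appLE_comp_appLE t h (ProjSpace.chart _ n l) (T.basicOpen (d l))
          (t ⁻¹ᵁ T.basicOpen (d l)) (hch₂ l).ge le_rfl
        have e₂ := Scheme.Hom.appLE_comp_appLE s q (ProjSpace.chart _ n l) (Y.basicOpen (c l))
          (t ⁻¹ᵁ T.basicOpen (d l)) (hch l).ge hb
        have f₁ := congrArg (t.appLE (T.basicOpen (d l)) (t ⁻¹ᵁ T.basicOpen (d l)) le_rfl).hom
            (hrat₂ l m)
        have f₂ := congrArg (s.appLE (Y.basicOpen (c l)) (t ⁻¹ᵁ T.basicOpen (d l)) hb).hom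
            (hrat l m)
        rw [map_mul] at f₁ f₂
        rw [← e₁, ← e₂]
        erw [appLE_resTop, appLE_resTop] at f₁ f₂
        have hu : IsUnit (resTop (t ⁻¹ᵁ T.basicOpen (d l)) (s.appTop.hom (c l))) := by
          apply isUnit_resTop_of_le_basicOpen
          rw [← Scheme.preimage_basicOpen_top]; exact hb
        apply hu.mul_right_cancel
        refine Eq.trans ?_ f₂.symm
        rw [← hde, ← hde, map_mul, map_mul, ← mul_assoc]
        exact congrArg (· * _) f₁
    obtain ⟨k, hk, hk'⟩ := exists_factor_isClosedImmersion t q.imageι h (s ≫ q.toImage)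
      (by rw [key, Category.assoc, q.toImage_imageι])
    refine ⟨k, hk', ?_⟩
    rw [reassoc_of% hk, reassoc_of% hh]
    simp

end

/-! ### Gluing modifications -/

section

variable {Y X : Scheme.{u}} {f : Y ⟶ X}

namespace Modification

/-- The morphism to `X` of a modification of an open subset of `X`. -/
def base {V : X.Opens} (M : Modification (f ∣_ V)) : M.obj ⟶ X := M.π ≫ V.ι

lemma ι_base {V : X.Opens} (M : Modification (f ∣_ V)) : M.ι ≫ M.base = (f ⁻¹ᵁ V).ι ≫ f := by
  rw [base, reassoc_of% M.fac, morphismRestrict_ι]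

lemma base_mem {V : X.Opens} (M : Modification (f ∣_ V)) (z : M.obj) : M.base z ∈ V :=
  (M.π z).2

instance {V : X.Opens} (M : Modification (f ∣_ V)) : IsSeparated M.base := by
  unfold base; infer_instance

/-- Morphisms `t` and `m` from a scheme `T` to modifications of two open subsets of `X` are
compatible if they have the same composition with the morphisms to `X` and if `m` agrees with the
morphism from `Y` wherever `t` does. The second condition is about all test schemes `Z`, which
makes it stable under composition and transitive. -/
structure Compat {V W : X.Opens} (M : Modification (f ∣_ V)) (N : Modification (f ∣_ W))
    {T : Scheme.{u}} (t : T ⟶ M.obj) (m : T ⟶ N.obj) : Prop where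
  base : t ≫ M.base = m ≫ N.base
  eq : ∀ {Z : Scheme.{u}} (z : Z ⟶ T) (a : Z ⟶ (f ⁻¹ᵁ V).toScheme) (b : Z ⟶ (f ⁻¹ᵁ W).toScheme),
    z ≫ t = a ≫ M.ι → a ≫ (f ⁻¹ᵁ V).ι = b ≫ (f ⁻¹ᵁ W).ι → z ≫ m = b ≫ N.ι

namespace Compat

variable {V W W' : X.Opens} {M : Modification (f ∣_ V)} {N : Modification (f ∣_ W)}
  {N' : Modification (f ∣_ W')} {T : Scheme.{u}} {t : T ⟶ M.obj} {m m' : T ⟶ N.obj}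

lemma refl (t : T ⟶ M.obj) : Compat M M t t :=
  ⟨rfl, fun z a b h h' ↦ by rw [h, (cancel_mono _).mp h']⟩

lemma comp (h : Compat M N t m) {T' : Scheme.{u}} (r : T' ⟶ T) : Compat M N (r ≫ t) (r ≫ m) :=
  ⟨by rw [Category.assoc, h.base, Category.assoc], fun z a b h₁ h₂ ↦ by
    rw [← Category.assoc]
    exact h.eq _ a b (by rw [Category.assoc, h₁]) h₂⟩

lemma exists_lift (h : Compat M N t m) {Z : Scheme.{u}} (z : Z ⟶ T) (a : Z ⟶ (f ⁻¹ᵁ V).toScheme)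
    (ha : z ≫ t = a ≫ M.ι) :
    ∃ b : Z ⟶ (f ⁻¹ᵁ W).toScheme, a ≫ (f ⁻¹ᵁ V).ι = b ≫ (f ⁻¹ᵁ W).ι := by
  refine ⟨IsOpenImmersion.lift (f ⁻¹ᵁ W).ι (a ≫ (f ⁻¹ᵁ V).ι) ?_,
    (IsOpenImmersion.lift_fac _ _ _).symm⟩
  rintro _ ⟨w, rfl⟩
  rw [Scheme.Opens.range_ι]
  change f _ ∈ W
  have : (z ≫ m) ≫ N.base = (a ≫ (f ⁻¹ᵁ V).ι) ≫ f := by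
    rw [Category.assoc, ← h.base, reassoc_of% ha, M.ι_base, Category.assoc]
  rw [← Scheme.Hom.comp_apply, ← this, Scheme.Hom.comp_apply]
  exact N.base_mem _

lemma trans (h : Compat M N t m) {m'' : T ⟶ N'.obj} (h' : Compat N N' m m'') :
    Compat M N' t m'' :=
  ⟨h.base.trans h'.base, fun z a b h₁ h₂ ↦ by
    obtain ⟨b', hb'⟩ := h.exists_lift z a h₁
    exact h'.eq z b' b (h.eq z a b' h₁ hb') (hb'.symm.trans h₂)⟩

/-- For an open immersion `t` there is at most one compatible `m`, as it is determined on the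
preimage of `Y`, which is schematically dense. -/
lemma unique [QuasiCompact f] [IsOpenImmersion t] (h : Compat M N t m) (h' : Compat M N t m') :
    m = m' := by
  have := M.quasiCompact_ι
  have hd : IsSchemeTheoreticallyDominant (pullback.fst t M.ι) := inferInstance
  refine ext_of_isSchemeTheoreticallyDominant (pullback.fst t M.ι) N.base
    (h.base.symm.trans h'.base) ?_
  obtain ⟨b, hb⟩ := h.exists_lift _ _ (pullback.condition (f := t) (g := M.ι))
  rw [h.eq _ _ b pullback.condition hb, h'.eq _ _ b pullback.condition hb]

/-- By uniqueness, compatible morphisms that exist locally glue. -/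
lemma exists_of_forall_exists [QuasiCompact f] (V W : X.Opens) (M : Modification (f ∣_ V))
    (N : Modification (f ∣_ W))
    (H : ∀ z : M.obj, M.base z ∈ W → ∃ (T : M.obj.Opens) (m : T.toScheme ⟶ N.obj),
      z ∈ T ∧ Compat M N T.ι m) :
    ∃ m : (M.base ⁻¹ᵁ W).toScheme ⟶ N.obj, Compat M N (M.base ⁻¹ᵁ W).ι m := by
  choose T m hz hm using fun z : (M.base ⁻¹ᵁ W).toScheme ↦ H z.1 z.2
  let 𝒰 : (M.base ⁻¹ᵁ W).toScheme.OpenCover := (M.base ⁻¹ᵁ W).toScheme.openCoverOfIsOpenCover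
    (fun z ↦ (M.base ⁻¹ᵁ W).ι ⁻¹ᵁ T z) (.mk (by ext z; simpa using ⟨z, hz z⟩))
  have hr (z) : ∃ r : 𝒰.X z ⟶ (T z).toScheme, r ≫ (T z).ι = 𝒰.f z ≫ (M.base ⁻¹ᵁ W).ι :=
    ⟨(M.base ⁻¹ᵁ W).ι ∣_ T z, morphismRestrict_ι _ _⟩
  choose r hr using hr
  have hm' (z) : Compat M N (𝒰.f z ≫ (M.base ⁻¹ᵁ W).ι) (r z ≫ m z) := by
    rw [← hr]; exact (hm z).comp _
  have hg : ∀ x y, pullback.fst (𝒰.f x) (𝒰.f y) ≫ r x ≫ m x = pullback.snd (𝒰.f x) (𝒰.f y) ≫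
      r y ≫ m y := by
    intro x y
    have h₁ := (hm' x).comp (pullback.fst (𝒰.f x) (𝒰.f y))
    have h₂ := (hm' y).comp (pullback.snd (𝒰.f x) (𝒰.f y))
    rw [← pullback.condition_assoc] at h₂
    exact h₁.unique h₂
  refine ⟨𝒰.glueMorphisms _ hg, ⟨?_, ?_⟩⟩
  · refine 𝒰.hom_ext _ _ fun x ↦ ?_
    rw [Scheme.Cover.ι_glueMorphisms_assoc, ← (hm' x).base, Category.assoc]
  · intro Z z a b h₁ h₂
    refine Scheme.Cover.hom_ext (𝒰.pullback₁ z) _ _ fun (x : 𝒰.I₀) ↦ ?_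
    change pullback.fst z (𝒰.f x) ≫ _ = pullback.fst z (𝒰.f x) ≫ _
    rw [pullback.condition_assoc, Scheme.Cover.ι_glueMorphisms,
      (hm' x).eq (pullback.snd z (𝒰.f x)) (pullback.fst z (𝒰.f x) ≫ a) (pullback.fst z (𝒰.f x) ≫ b)]
    · simp only [Category.assoc]
    · rw [← pullback.condition_assoc, h₁, Category.assoc]
    · rw [Category.assoc, h₂, Category.assoc]

end Compat

end Modification

section Gluing

variable {I : Type u} (V : I → X.Opens)

/-- Open subsets of the members of a cover, together with a choice of a member containing them.
They are preordered by inclusion regardless of this choice, so that the modifications of two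
members are identified over an open subset of both. -/
structure SubOpen : Type u where
  idx : I
  U : X.Opens
  le : U ≤ V idx

variable {V} (hV : IsOpenCover V)

/-- The cover of `X` by open subsets of the members of a given cover. -/
def subOpenCover : X.OpenCover where
  I₀ := SubOpen V
  X j := j.U.toScheme
  f j := j.U.ι
  mem₀ := by
    rw [Scheme.presieve₀_mem_precoverage_iff]
    refine ⟨fun x ↦ ?_, inferInstance⟩
    obtain ⟨i, hi⟩ := hV.exists_mem x
    exact ⟨⟨i, V i, le_rfl⟩, by simpa using hi⟩

instance : Preorder (subOpenCover hV).I₀ := Preorder.lift SubOpen.U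

lemma opensRange_subOpenCover (j : (subOpenCover hV).I₀) :
    ((subOpenCover hV).f j).opensRange = SubOpen.U j :=
  Scheme.Opens.opensRange_ι (SubOpen.U j)

include hV in
lemma isBasis_subOpen : Opens.IsBasis (Set.range fun i : SubOpen V ↦ i.U) := by
  rw [Opens.isBasis_iff_nbhd]
  intro U x hx
  obtain ⟨i, hi⟩ := hV.exists_mem x
  exact ⟨_, ⟨⟨i, U ⊓ V i, inf_le_right⟩, rfl⟩, ⟨hx, hi⟩, inf_le_left⟩

instance : (subOpenCover hV).LocallyDirected :=
  .ofIsBasisOpensRange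
    (fun {i j} ↦ by rw [opensRange_subOpenCover, opensRange_subOpenCover]; rfl) <| by
    have e : (fun j ↦ ((subOpenCover hV).f j).opensRange) = fun j : SubOpen V ↦ j.U :=
      funext (opensRange_subOpenCover hV)
    exact (congrArg (fun g ↦ Opens.IsBasis (Set.range g)) e).mpr (isBasis_subOpen hV)

variable (M : ∀ i, Modification (f ∣_ V i))
  (H : ∀ i k, ∃ m : ((M i).base ⁻¹ᵁ V k).toScheme ⟶ (M k).obj,
    (M i).Compat (M k) (Scheme.Opens.ι _) m)

/-- The part of a modification over an open subset. -/
abbrev gluePiece (j : SubOpen V) : Scheme.{u} := ((M j.idx).base ⁻¹ᵁ j.U).toScheme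

include H in
lemma exists_glueMap (j k : SubOpen V) (h : j.U ≤ k.U) :
    ∃ m : gluePiece M j ⟶ gluePiece M k,
      (M j.idx).Compat (M k.idx) (Scheme.Opens.ι _) (m ≫ Scheme.Opens.ι _) := by
  obtain ⟨m, hm⟩ := H j.idx k.idx
  have hle : (M j.idx).base ⁻¹ᵁ j.U ≤ (M j.idx).base ⁻¹ᵁ V k.idx := fun z hz ↦ k.le (h hz)
  have hm' := hm.comp (Scheme.homOfLE _ hle)
  rw [Scheme.homOfLE_ι] at hm'
  have hr : Set.range (Scheme.homOfLE _ hle ≫ m) ⊆ Set.range ((M k.idx).base ⁻¹ᵁ k.U).ι := by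
    rintro _ ⟨z, rfl⟩
    rw [Scheme.Opens.range_ι]
    change (M k.idx).base _ ∈ k.U
    rw [← Scheme.Hom.comp_apply, ← hm'.base, Scheme.Hom.comp_apply]
    exact h z.2
  refine ⟨IsOpenImmersion.lift ((M k.idx).base ⁻¹ᵁ k.U).ι _ hr, ?_⟩
  rwa [IsOpenImmersion.lift_fac]

/-- The transition morphism between the parts of two modifications over open subsets `j.U ≤ k.U`:
the unique one which is compatible with the morphisms from `Y`. -/
def glueMap {j k : SubOpen V} (h : j.U ≤ k.U) : gluePiece M j ⟶ gluePiece M k :=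
  (exists_glueMap M H j k h).choose

lemma compat_glueMap {j k : SubOpen V} (h : j.U ≤ k.U) :
    (M j.idx).Compat (M k.idx) (Scheme.Opens.ι _) (glueMap M H h ≫ Scheme.Opens.ι _) :=
  (exists_glueMap M H j k h).choose_spec

lemma glueMap_unique [QuasiCompact f] {j k : SubOpen V} (h : j.U ≤ k.U)
    (m : gluePiece M j ⟶ gluePiece M k)
    (hm : (M j.idx).Compat (M k.idx) (Scheme.Opens.ι _) (m ≫ Scheme.Opens.ι _)) :
    glueMap M H h = m := by
  rw [← cancel_mono (Scheme.Opens.ι _)]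
  exact (compat_glueMap M H h).unique hm

lemma glueMap_comp [QuasiCompact f] {j k l : SubOpen V} (h : j.U ≤ k.U) (h' : k.U ≤ l.U) :
    glueMap M H (h.trans h') = glueMap M H h ≫ glueMap M H h' := by
  apply glueMap_unique
  refine (compat_glueMap M H h).trans ?_
  rw [Category.assoc]
  exact (compat_glueMap M H h').comp _

lemma glueMap_id [QuasiCompact f] {j : SubOpen V} : glueMap M H (le_refl j.U) = 𝟙 _ := by
  apply glueMap_unique
  rw [Category.id_comp]
  exact .refl _

lemma glueMap_base {j k : SubOpen V} (h : j.U ≤ k.U) :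
    glueMap M H h ≫ ((M k.idx).base ∣_ k.U) = ((M j.idx).base ∣_ j.U) ≫ X.homOfLE h := by
  rw [← cancel_mono k.U.ι, Category.assoc, Category.assoc, morphismRestrict_ι, Scheme.homOfLE_ι,
    morphismRestrict_ι, (compat_glueMap M H h).base, Category.assoc]

lemma isPullback_glueMap [QuasiCompact f] {j k : SubOpen V} (h : j.U ≤ k.U) :
    IsPullback (glueMap M H h) ((M j.idx).base ∣_ j.U) ((M k.idx).base ∣_ k.U) (X.homOfLE h) := by
  let l : SubOpen V := ⟨k.idx, j.U, h.trans k.le⟩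
  have hl : IsPullback (glueMap M H (j := l) h) ((M k.idx).base ∣_ j.U) ((M k.idx).base ∣_ k.U)
      (X.homOfLE h) := by
    refine IsPullback.of_right (h₁₂ := ((M k.idx).base ⁻¹ᵁ k.U).ι) (h₂₂ := k.U.ι)
      (v₁₃ := (M k.idx).base) ?_
      (glueMap_base M H (j := l) h) (isPullback_morphismRestrict _ _).flip
    have e : glueMap M H (j := l) (k := k) h ≫ Scheme.Opens.ι _ = Scheme.Opens.ι _ :=
      (compat_glueMap M H (j := l) h).unique (.refl _)
    rw [e, Scheme.homOfLE_ι]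
    exact (isPullback_morphismRestrict _ _).flip
  have : IsIso (glueMap M H (j := j) (k := l) le_rfl) :=
    ⟨glueMap M H (j := l) (k := j) le_rfl, by rw [← glueMap_comp, glueMap_id], by
      rw [← glueMap_comp, glueMap_id]⟩
  have hj : IsPullback (glueMap M H (j := j) (k := l) le_rfl) ((M j.idx).base ∣_ j.U)
      ((M k.idx).base ∣_ j.U) (𝟙 _) :=
    .of_horiz_isIso ⟨by rw [glueMap_base M H (j := j) (k := l) le_rfl]; simp [l]⟩
  have h' := hj.paste_horiz hl
  rwa [Category.id_comp, ← glueMap_comp M H (j := j) (k := l) le_rfl h] at h'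

/-- The relative gluing datum over `X` formed by the parts of the given modifications over all
open subsets of the members of the cover. -/
def gluingData [QuasiCompact f] : (subOpenCover hV).RelativeGluingData where
  functor :=
    { obj := fun j ↦ gluePiece M j
      map := fun h ↦ glueMap M H (leOfHom h)
      map_id := fun _ ↦ glueMap_id M H
      map_comp := fun a b ↦ glueMap_comp M H (leOfHom a) (leOfHom b) }
  natTrans :=
    { app := fun j ↦ (M (SubOpen.idx j)).base ∣_ (SubOpen.U j)
      naturality := fun _ _ h ↦ glueMap_base M H (leOfHom h) }
  equifibered := fun _ _ h ↦ isPullback_glueMap M H (leOfHom h)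

variable [QuasiCompact f]

instance : Small.{u} (subOpenCover hV).I₀ := inferInstanceAs (Small.{u} (SubOpen V))

include hV H in
/-- Modifications of the members of an open cover which dominate each other on the overlaps glue
to a modification. -/
lemma exists_glued :
    ∃ (P : Scheme.{u}) (p : P ⟶ X) (y : Y ⟶ P) (e : ∀ i, (M i).obj ⟶ P), IsProper p ∧ y ≫ p = f ∧
      ∀ i, (M i).ι ≫ e i = (f ⁻¹ᵁ V i).ι ≫ y ∧
        ∃ _ : IsOpenImmersion (e i), (e i).opensRange = p ⁻¹ᵁ V i := by
  let d := gluingData hV M H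
  let P := d.glued
  let p : P ⟶ X := d.toBase
  let j (i : I) : SubOpen V := ⟨i, V i, le_rfl⟩
  let e' (k : SubOpen V) : gluePiece M k ⟶ P := colimit.ι d.functor k
  have he' (k l : SubOpen V) (h : k.U ≤ l.U) : glueMap M H h ≫ e' l = e' k :=
    colimit.w d.functor (homOfLE h)
  have he'' (k : SubOpen V) : e' k ≫ p = ((M k.idx).base ∣_ k.U) ≫ k.U.ι := d.ι_toBase k
  have hpb (k : SubOpen V) : IsPullback ((M k.idx).base ∣_ k.U) (e' k) k.U.ι p :=
    d.isPullback_natTrans_ι_toBase k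
  have htop (i : I) : (M i).base ⁻¹ᵁ V i = ⊤ := by
    ext z; simpa using (M i).base_mem z
  have hιiso (i : I) : IsIso ((M i).base ⁻¹ᵁ V i).ι := by
    rw [htop]; exact inferInstanceAs (IsIso (Scheme.topIso _).hom)
  let θ (i : I) : gluePiece M (j i) ≅ (p ⁻¹ᵁ V i).toScheme :=
    (hpb (j i)).flip.isoIsPullback _ _ (isPullback_morphismRestrict p (V i)).flip
  have hθ (i : I) : (θ i).hom ≫ (p ⁻¹ᵁ V i).ι = e' (j i) := IsPullback.isoIsPullback_hom_fst ..
  have hθ' (i : I) : (θ i).hom ≫ (p ∣_ V i) = (M i).base ∣_ V i :=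
    IsPullback.isoIsPullback_hom_snd ..
  let e (i : I) : (M i).obj ⟶ P := inv ((M i).base ⁻¹ᵁ V i).ι ≫ e' (j i)
  have hιe (i : I) : ((M i).base ⁻¹ᵁ V i).ι ≫ e i = e' (j i) := by simp [e]
  have hp : IsProper p := by
    refine IsZariskiLocalAtTarget.of_iSup_eq_top V hV fun i ↦ ?_
    rw [← MorphismProperty.cancel_left_of_respectsIso @IsProper (θ i).hom, hθ']
    have : (M i).base ∣_ V i = ((M i).base ⁻¹ᵁ V i).ι ≫ (M i).π := by
      rw [← cancel_mono (V i).ι, morphismRestrict_ι, Category.assoc]; rfl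
    rw [this]
    infer_instance
  let 𝒰 := Y.openCoverOfIsOpenCover (fun i ↦ f ⁻¹ᵁ V i) (by
    rw [IsOpenCover, ← Scheme.Hom.preimage_iSup, hV]; rfl)
  have hglue (i k : I) : pullback.fst (f ⁻¹ᵁ V i).ι (f ⁻¹ᵁ V k).ι ≫ (M i).ι ≫ e i =
      pullback.snd (f ⁻¹ᵁ V i).ι (f ⁻¹ᵁ V k).ι ≫ (M k).ι ≫ e k := by
    let l : SubOpen V := ⟨i, V i ⊓ V k, inf_le_left⟩
    have hli : l.U ≤ (j i).U := inf_le_left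
    have hlk : l.U ≤ (j k).U := inf_le_right
    have hr : Set.range (pullback.fst (f ⁻¹ᵁ V i).ι (f ⁻¹ᵁ V k).ι ≫ (M i).ι) ⊆
        Set.range ((M i).base ⁻¹ᵁ l.U).ι := by
      rintro _ ⟨z, rfl⟩
      rw [Scheme.Opens.range_ι]
      change (M i).base _ ∈ V i ⊓ V k
      refine ⟨(M i).base_mem _, ?_⟩
      rw [← Scheme.Hom.comp_apply, Category.assoc, (M i).ι_base, pullback.condition_assoc,
        ← (M k).ι_base]
      simp only [Scheme.Hom.comp_apply]
      exact (M k).base_mem _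
    let r := IsOpenImmersion.lift ((M i).base ⁻¹ᵁ l.U).ι _ hr
    have hr' : r ≫ ((M i).base ⁻¹ᵁ l.U).ι = _ := IsOpenImmersion.lift_fac _ _ _
    have h₁ : glueMap M H hli ≫ ((M i).base ⁻¹ᵁ V i).ι = ((M i).base ⁻¹ᵁ l.U).ι :=
      (compat_glueMap M H hli).unique (.refl _)
    have h₂ := (compat_glueMap M H hlk).eq r _ _ hr' pullback.condition
    rw [← reassoc_of% hr', ← h₁, Category.assoc, hιe, he', ← reassoc_of% h₂, hιe, he']
  let y : Y ⟶ P := 𝒰.glueMorphisms _ hglue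
  have hy (i : I) : (f ⁻¹ᵁ V i).ι ≫ y = (M i).ι ≫ e i := 𝒰.ι_glueMorphisms _ hglue i
  refine ⟨P, p, y, e, hp, ?_, fun i ↦ ⟨?_, ?_⟩⟩
  · refine 𝒰.hom_ext _ _ fun (i : I) ↦ ?_
    change (f ⁻¹ᵁ V i).ι ≫ _ = (f ⁻¹ᵁ V i).ι ≫ _
    rw [reassoc_of% hy i]
    have : e i ≫ p = (M i).base := by
      rw [← cancel_epi ((M i).base ⁻¹ᵁ V i).ι, reassoc_of% hιe, he'', morphismRestrict_ι]
    rw [this]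
    exact (M i).ι_base
  · exact (hy i).symm
  · have h₁ : e i = (inv ((M i).base ⁻¹ᵁ V i).ι ≫ (θ i).hom) ≫ (p ⁻¹ᵁ V i).ι := by
      rw [Category.assoc, hθ]
    have h₂ : IsOpenImmersion (e i) := by rw [h₁]; infer_instance
    refine ⟨h₂, ?_⟩
    ext1
    rw [Scheme.Hom.coe_opensRange, h₁, Scheme.Hom.comp_base, TopCat.coe_comp, Set.range_comp,
      Set.range_eq_univ.mpr (Scheme.Hom.surjective _), Set.image_univ, Scheme.Opens.range_ι]

end Gluing

end

/-! ### Extension of submodules of finite type of `f_* 𝒪_Y` -/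

section

section PushStalk

variable {Y X : Scheme.{u}} (f : Y ⟶ X)

/-- The stalk of `f_* 𝒪_Y` at a point of `X`. -/
def PushStalk (p : X) : Type u :=
  ((TopCat.Presheaf.pushforward CommRingCat f.base).obj Y.presheaf).stalk p

instance (p : X) : CommRing (PushStalk f p) :=
  inferInstanceAs (CommRing
    (((TopCat.Presheaf.pushforward CommRingCat f.base).obj Y.presheaf).stalk p))

instance (p : X) : Algebra (X.presheaf.stalk p) (PushStalk f p) :=
  RingHom.toAlgebra ((TopCat.Presheaf.stalkFunctor CommRingCat p).map f.c).hom

/-- Restriction of sections of `f_* 𝒪_Y`. -/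
abbrev pushRes {V W : X.Opens} (h : W ≤ V) : Γ(Y, f ⁻¹ᵁ V) →+* Γ(Y, f ⁻¹ᵁ W) :=
  (Y.presheaf.map (homOfLE (f.preimage_mono h)).op).hom

/-- The germ of a section of `f_* 𝒪_Y`. -/
def pushGerm (V : X.Opens) (p : X) (hp : p ∈ V) : Γ(Y, f ⁻¹ᵁ V) →+* PushStalk f p :=
  (((TopCat.Presheaf.pushforward CommRingCat f.base).obj Y.presheaf).germ V p hp).hom

variable {f}

@[simp]
lemma pushGerm_res {V W : X.Opens} (h : W ≤ V) (p : X) (hp : p ∈ W) (x : Γ(Y, f ⁻¹ᵁ V)) :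
    pushGerm f W p hp (pushRes f h x) = pushGerm f V p (h hp) x :=
  TopCat.Presheaf.germ_res_apply ((TopCat.Presheaf.pushforward CommRingCat f.base).obj Y.presheaf)
    (homOfLE h) p hp x

lemma pushGerm_app {V : X.Opens} (p : X) (hp : p ∈ V) (a : Γ(X, V)) :
    pushGerm f V p hp ((f.app V).hom a) =
      algebraMap (X.presheaf.stalk p) _ ((X.presheaf.germ V p hp).hom a) :=
  (TopCat.Presheaf.stalkFunctor_map_germ_apply V p hp f.c a).symm

lemma exists_of_pushGerm_eq {V : X.Opens} (p : X) (hp : p ∈ V) (x y : Γ(Y, f ⁻¹ᵁ V))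
    (h : pushGerm f V p hp x = pushGerm f V p hp y) :
    ∃ (W : X.Opens) (hW : W ≤ V), p ∈ W ∧ pushRes f hW x = pushRes f hW y := by
  obtain ⟨W, hpW, i, j, e⟩ := TopCat.Presheaf.germ_eq
    ((TopCat.Presheaf.pushforward CommRingCat f.base).obj Y.presheaf) p hp hp x y h
  exact ⟨W, leOfHom i, hpW, e⟩

lemma res_app {V W : X.Opens} (h : W ≤ V) (a : Γ(X, V)) :
    (f.app W).hom ((X.presheaf.map (homOfLE h).op).hom a) = pushRes f h ((f.app V).hom a) :=
  congrArg (fun k ↦ k.hom a) (f.naturality (homOfLE h).op)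

lemma pushRes_pushRes {V W U : X.Opens} (h : W ≤ V) (h' : U ≤ W) (x : Γ(Y, f ⁻¹ᵁ V)) :
    pushRes f h' (pushRes f h x) = pushRes f (h'.trans h) x :=
  (congrArg (fun k ↦ k.hom x) (Y.presheaf.map_comp (homOfLE (f.preimage_mono h)).op
    (homOfLE (f.preimage_mono h')).op)).symm

/-- Finitely many germs at a point extend to a common neighborhood. -/
lemma exists_germ_eq_of_fin {p : X} {n : ℕ} (α : Fin n → X.presheaf.stalk p) :
    ∃ (W : X.Opens) (hp : p ∈ W) (a : Fin n → Γ(X, W)),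
      ∀ m, (X.presheaf.germ W p hp).hom (a m) = α m := by
  choose U hU s hs using fun m ↦ TopCat.Presheaf.exists_germ_eq X.presheaf (α m)
  have hp : p ∈ Finset.univ.inf U := by
    rw [← SetLike.mem_coe, Opens.coe_finset_inf]
    simpa using hU
  refine ⟨_, hp, fun m ↦ X.presheaf.map (homOfLE (Finset.inf_le (Finset.mem_univ m))).op (s m),
    fun m ↦ ?_⟩
  rw [← hs m]
  exact TopCat.Presheaf.germ_res_apply X.presheaf _ p hp (s m)

variable (f) in
/-- The submodule of the stalk of `f_* 𝒪_Y` at `p` generated by finitely many sections. -/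
def spanGerm {V : X.Opens} {n : ℕ} (b : Fin n → Γ(Y, f ⁻¹ᵁ V)) (p : X) (hp : p ∈ V) :
    Submodule (X.presheaf.stalk p) (PushStalk f p) :=
  Submodule.span _ (Set.range fun m ↦ pushGerm f V p hp (b m))

lemma spanGerm_res {V W : X.Opens} {n : ℕ} (h : W ≤ V) (b : Fin n → Γ(Y, f ⁻¹ᵁ V)) (p : X)
    (hp : p ∈ W) :
    spanGerm f (fun m ↦ pushRes f h (b m)) p hp = spanGerm f b p (h hp) := by
  simp [spanGerm]

lemma exists_of_mem_spanGerm {V : X.Opens} {n : ℕ} (b : Fin n → Γ(Y, f ⁻¹ᵁ V)) (β : Γ(Y, f ⁻¹ᵁ V))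
    (p : X) (hp : p ∈ V) (h : pushGerm f V p hp β ∈ spanGerm f b p hp) :
    ∃ (W : X.Opens) (hW : W ≤ V) (a : Fin n → Γ(X, W)), p ∈ W ∧
      pushRes f hW β = ∑ m, (f.app W).hom (a m) * pushRes f hW (b m) := by
  obtain ⟨α, hα⟩ := (Submodule.mem_span_range_iff_exists_fun _).mp h
  obtain ⟨U, hpU, a, ha⟩ := exists_germ_eq_of_fin α
  have hp' : p ∈ U ⊓ V := ⟨hpU, hp⟩
  let a' (m) : Γ(X, U ⊓ V) := (X.presheaf.map (homOfLE (inf_le_left : U ⊓ V ≤ U)).op).hom (a m)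
  have ha' (m) : (X.presheaf.germ (U ⊓ V) p hp').hom (a' m) = α m := by
    rw [← ha m]; exact TopCat.Presheaf.germ_res_apply X.presheaf _ p hp' (a m)
  have e : pushGerm f (U ⊓ V) p hp' (pushRes f inf_le_right β) =
      pushGerm f (U ⊓ V) p hp' (∑ m, (f.app (U ⊓ V)).hom (a' m) * pushRes f inf_le_right
        (b m)) := by
    rw [pushGerm_res, ← hα, map_sum]
    refine Finset.sum_congr rfl fun m _ ↦ ?_
    rw [map_mul, pushGerm_res, pushGerm_app, ha', Algebra.smul_def]
  obtain ⟨W, hW, hpW, e'⟩ := exists_of_pushGerm_eq p hp' _ _ e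
  refine ⟨W, hW.trans inf_le_right, fun m ↦ (X.presheaf.map (homOfLE hW).op).hom (a' m), hpW, ?_⟩
  rw [pushRes_pushRes, map_sum] at e'
  rw [e']
  refine Finset.sum_congr rfl fun m _ ↦ ?_
  rw [map_mul, pushRes_pushRes]
  exact congrArg (· * _) (res_app hW (a' m)).symm

end PushStalk

section Extension

variable {Y X : Scheme.{u}} {f : Y ⟶ X}

/-- If a section is locally on `D(s)` a linear combination of the `b m`, then so is its product with
a power of `s`, everywhere. -/
lemma exists_pow_smul_mem_spanGerm [QuasiCompact f] {V : X.Opens} (hV : IsAffineOpen V) {n : ℕ}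
    (b : Fin n → Γ(Y, f ⁻¹ᵁ V)) (β : Γ(Y, f ⁻¹ᵁ V)) (s : Γ(X, V))
    (h : ∀ p (hp : p ∈ V), p ∈ X.basicOpen s → pushGerm f V p hp β ∈ spanGerm f b p hp) :
    ∃ K : ℕ, ∀ p (hp : p ∈ V),
      (X.presheaf.germ V p hp).hom s ^ K • pushGerm f V p hp β ∈ spanGerm f b p hp := by
  let : Algebra Γ(X, V) Γ(Y, f ⁻¹ᵁ V) := (f.app V).hom.toAlgebra
  let N : Submodule Γ(X, V) Γ(Y, f ⁻¹ᵁ V) := Submodule.span _ (Set.range b)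
  let J : Ideal Γ(X, V) := N.comap (LinearMap.toSpanSingleton _ _ β)
  have hJ (a) : a ∈ J ↔ (f.app V).hom a * β ∈ N := by
    simp [J, Algebra.smul_def, RingHom.algebraMap_toAlgebra]
  have hs : s ∈ J.radical := by
    rw [Ideal.radical_eq_sInf, Submodule.mem_sInf]
    rintro P ⟨hJP, hP⟩
    by_contra hsP
    let p : X := hV.fromSpec ⟨P, hP⟩
    have hpV : p ∈ V := by
      have := Set.mem_range_self (f := hV.fromSpec) ⟨P, hP⟩
      rwa [hV.range_fromSpec] at this
    have hpP (t : Γ(X, V)) : p ∈ X.basicOpen t ↔ t ∉ P := by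
      change (⟨P, hP⟩ : Spec Γ(X, V)) ∈ hV.fromSpec ⁻¹ᵁ X.basicOpen t ↔ _
      rw [hV.fromSpec_preimage_basicOpen]
      rfl
    obtain ⟨W, hW, a, hpW, e⟩ := exists_of_mem_spanGerm b β p hpV (h p hpV ((hpP s).mpr hsP))
    obtain ⟨t, htW, hpt⟩ := hV.exists_basicOpen_le ⟨p, hpW⟩ hpV
    have hle : X.basicOpen t ≤ V := X.basicOpen_le t
    have := hV.isLocalization_basicOpen t
    obtain ⟨⟨_, M, rfl⟩, hM⟩ := IsLocalization.exist_integer_multiples_of_finite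
        (Submonoid.powers t)
      (fun m ↦ (X.presheaf.map (homOfLE htW).op).hom (a m))
    choose a' ha' using hM
    have ha'' (m) : (X.presheaf.map (homOfLE hle).op).hom (a' m) =
        (X.presheaf.map (homOfLE hle).op).hom t ^ M * (X.presheaf.map (homOfLE htW).op).hom
          (a m) := by
      rw [← map_pow]
      exact (ha' m).trans (Algebra.smul_def _ _)
    have hle' : Y.basicOpen ((f.app V).hom t) = f ⁻¹ᵁ X.basicOpen t :=
        (Scheme.preimage_basicOpen f t).symm
    have key : pushRes f hle ((f.app V).hom t ^ M * β - ∑ m, (f.app V).hom (a' m) * b m) = 0 := by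
      have e₂ := congrArg (pushRes f htW) e
      rw [pushRes_pushRes, map_sum] at e₂
      rw [map_sub, map_mul, e₂, map_sum, Finset.mul_sum, sub_eq_zero]
      refine Finset.sum_congr rfl fun m _ ↦ ?_
      rw [map_mul, map_mul, map_pow, ← res_app, ← res_app, ← res_app, ha'', map_mul, map_pow,
        pushRes_pushRes]
      ring
    obtain ⟨L, hL⟩ := exists_pow_mul_eq_zero_of_res_basicOpen_eq_zero_of_isCompact Y
      (f.isCompact_preimage hV.isCompact)
        ((f.app V).hom t ^ M * β - ∑ m, (f.app V).hom (a' m) * b m)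
      ((f.app V).hom t) (by
        have e₃ := congrArg (Y.presheaf.map (eqToHom hle').op).hom key
        rw [map_zero] at e₃
        refine Eq.trans ?_ e₃
        exact congrArg (fun k ↦ k.hom ((f.app V).hom t ^ M * β - ∑ m, (f.app V).hom (a' m) * b m))
          (Y.presheaf.map_comp (homOfLE (f.preimage_mono hle)).op (eqToHom hle').op))
    have : t ^ (L + M) ∈ J := by
      rw [hJ]
      have : (f.app V).hom (t ^ (L + M)) * β = ∑ m, (t ^ L * a' m) • b m := by
        simp only [Algebra.smul_def, RingHom.algebraMap_toAlgebra, map_mul, map_pow]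
        rw [mul_sub, sub_eq_zero, Finset.mul_sum] at hL
        rw [pow_add, mul_assoc]
        refine hL.trans (Finset.sum_congr rfl fun m _ ↦ ?_)
        ring
      rw [this]
      exact Submodule.sum_mem _ fun m _ ↦ Submodule.smul_mem _ _ (Submodule.subset_span ⟨m, rfl⟩)
    exact (hpP t).mp hpt (hP.mem_of_pow_mem _ (hJP this))
  obtain ⟨K, hK⟩ := hs
  refine ⟨K, fun p hp ↦ ?_⟩
  rw [hJ] at hK
  obtain ⟨c, hc⟩ := (Submodule.mem_span_range_iff_exists_fun _).mp hK
  have := congrArg (pushGerm f V p hp) hc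
  rw [map_mul, pushGerm_app, map_pow, ← Algebra.smul_def, map_sum] at this
  rw [← this]
  refine Submodule.sum_mem _ fun m _ ↦ ?_
  rw [Algebra.smul_def, map_mul]
  erw [pushGerm_app]
  rw [← Algebra.smul_def]
  exact Submodule.smul_mem _ _ (Submodule.subset_span ⟨m, rfl⟩)

variable (L : ∀ p : X, Submodule (X.presheaf.stalk p) (PushStalk f p))

/-- A family of submodules of the stalks of `f_* 𝒪_Y` is generated on `V` by finitely many
sections. Such families stand for the submodules of finite type of the sheaf `f_* 𝒪_Y`. -/
def IsGenOn (V : X.Opens) : Prop :=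
  ∃ (n : ℕ) (b : Fin n → Γ(Y, f ⁻¹ᵁ V)), ∀ p (hp : p ∈ V), L p = spanGerm f b p hp

variable {L}

lemma IsGenOn.mono {V W : X.Opens} (h : IsGenOn L V) (hW : W ≤ V) : IsGenOn L W := by
  obtain ⟨n, b, hb⟩ := h
  exact ⟨n, fun m ↦ pushRes f hW (b m), fun p hp ↦ by rw [spanGerm_res, hb]⟩

variable (L) in
/-- A family of submodules of the stalks of `f_* 𝒪_Y` is on `U` locally generated by finitely many
sections. -/
def IsLocGenOn (U : X.Opens) : Prop :=
  ∀ p ∈ U, ∃ V : X.Opens, p ∈ V ∧ IsGenOn L V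

/-- If a section over `W` lies in a locally finitely generated family wherever `s` is invertible,
then its product with a power of `s` does so on all of `U ⊓ W`, if this is quasi-compact. -/
lemma IsLocGenOn.exists_pow_smul_mem [QuasiCompact f] {U W : X.Opens} (hL : IsLocGenOn L U)
    (hc : IsCompact (U ⊓ W : X.Opens).1) (β : Γ(Y, f ⁻¹ᵁ W)) (s : Γ(X, W))
    (h : ∀ p (hp : p ∈ W), p ∈ U → p ∈ X.basicOpen s → pushGerm f W p hp β ∈ L p) :
    ∃ K : ℕ, ∀ p (hp : p ∈ W), p ∈ U →
      (X.presheaf.germ W p hp).hom s ^ K • pushGerm f W p hp β ∈ L p := by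
  suffices H : ∃ K : ℕ, ∀ p (hp : p ∈ W), p ∈ (U ⊓ W : X.Opens).1 →
      (X.presheaf.germ W p hp).hom s ^ K • pushGerm f W p hp β ∈ L p by
    obtain ⟨K, hK⟩ := H
    exact ⟨K, fun p hp hpU ↦ hK p hp ⟨hpU, hp⟩⟩
  refine hc.induction_on (p := fun S ↦ ∃ K : ℕ, ∀ p (hp : p ∈ W), p ∈ S →
      (X.presheaf.germ W p hp).hom s ^ K • pushGerm f W p hp β ∈ L p) ⟨0, by simp⟩ ?_ ?_ ?_
  · rintro S T hST ⟨K, hK⟩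
    exact ⟨K, fun p hp hpS ↦ hK p hp (hST hpS)⟩
  · rintro S T ⟨K, hK⟩ ⟨K', hK'⟩
    refine ⟨K + K', fun p hp hpS ↦ ?_⟩
    rcases hpS with hpS | hpS
    · rw [add_comm, pow_add, mul_smul]; exact Submodule.smul_mem _ _ (hK p hp hpS)
    · rw [pow_add, mul_smul]; exact Submodule.smul_mem _ _ (hK' p hp hpS)
  · rintro p ⟨hpU, hpW⟩
    obtain ⟨V, hpV, hV⟩ := hL p hpU
    obtain ⟨V', hV', hpV', hle⟩ := Opens.isBasis_iff_nbhd.mp X.isBasis_affineOpens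
      (show p ∈ V ⊓ (U ⊓ W) from ⟨hpV, hpU, hpW⟩)
    obtain ⟨n, b, hb⟩ := hV.mono (hle.trans inf_le_left)
    have hVW : V' ≤ W := hle.trans (inf_le_right.trans inf_le_right)
    have hVU : V' ≤ U := hle.trans (inf_le_right.trans inf_le_left)
    have hg (q) (hq : q ∈ V') : (X.presheaf.germ V' q hq).hom
        ((X.presheaf.map (homOfLE hVW).op).hom s) =
        (X.presheaf.germ W q (hVW hq)).hom s := TopCat.Presheaf.germ_res_apply X.presheaf _ q hq s
    obtain ⟨K, hK⟩ := exists_pow_smul_mem_spanGerm hV' b (pushRes f hVW β)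
      ((X.presheaf.map (homOfLE hVW).op).hom s) (fun q hq hqs ↦ by
        rw [← hb, pushGerm_res]
        refine h q _ (hVU hq) ?_
        rw [Scheme.basicOpen_res] at hqs
        exact hqs.2)
    refine ⟨V', mem_nhdsWithin_of_mem_nhds (V'.2.mem_nhds hpV'), K, fun q hq hqV ↦ ?_⟩
    have := hK q hqV
    rwa [← hb, pushGerm_res, hg] at this

/-- The submodule of the stalk of `f_* 𝒪_Y` at `p` generated by a set of sections. -/
def spanGermSet {V : X.Opens} (T : Set Γ(Y, f ⁻¹ᵁ V)) (p : X) (hp : p ∈ V) :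
    Submodule (X.presheaf.stalk p) (PushStalk f p) :=
  Submodule.span _ (pushGerm f V p hp '' T)

/-- On the intersection with an affine open subset `W`, a locally finitely generated family is
generated by finitely many sections over `W`. -/
lemma IsLocGenOn.exists_finite [IsAffineHom f] {U W : X.Opens} (hL : IsLocGenOn L U)
    (hW : IsAffineOpen W) (hc : IsCompact (U ⊓ W : X.Opens).1) :
    ∃ T : Set Γ(Y, f ⁻¹ᵁ W), T.Finite ∧ ∀ p (hp : p ∈ W), p ∈ U → spanGermSet T p hp = L p := by
  suffices H : ∃ T : Set Γ(Y, f ⁻¹ᵁ W), T.Finite ∧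
      (∀ p (hp : p ∈ W), p ∈ U → spanGermSet T p hp ≤ L p) ∧
      ∀ p (hp : p ∈ W), p ∈ (U ⊓ W : X.Opens).1 → L p ≤ spanGermSet T p hp by
    obtain ⟨T, hT, h₁, h₂⟩ := H
    exact ⟨T, hT, fun p hp hpU ↦ (h₁ p hp hpU).antisymm (h₂ p hp ⟨hpU, hp⟩)⟩
  refine hc.induction_on (p := fun S ↦ ∃ T : Set Γ(Y, f ⁻¹ᵁ W), T.Finite ∧
    (∀ p (hp : p ∈ W), p ∈ U → spanGermSet T p hp ≤ L p) ∧
      ∀ p (hp : p ∈ W), p ∈ S → L p ≤ spanGermSet T p hp)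
    ⟨∅, Set.finite_empty, ?_, by simp⟩ ?_ ?_ ?_
  · intro p hp _
    simp [spanGermSet]
  · rintro S S' hS ⟨T, hT, h₁, h₂⟩
    exact ⟨T, hT, h₁, fun p hp hpS ↦ h₂ p hp (hS hpS)⟩
  · rintro S S' ⟨T, hT, h₁, h₂⟩ ⟨T', hT', h₁', h₂'⟩
    refine ⟨T ∪ T', hT.union hT', fun p hp hpU ↦ ?_, fun p hp hpS ↦ ?_⟩
    · rw [spanGermSet, Set.image_union, Submodule.span_union]
      exact sup_le (h₁ p hp hpU) (h₁' p hp hpU)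
    · rw [spanGermSet, Set.image_union, Submodule.span_union]
      rcases hpS with hpS | hpS
      · exact (h₂ p hp hpS).trans le_sup_left
      · exact (h₂' p hp hpS).trans le_sup_right
  · rintro p ⟨hpU, hpW⟩
    obtain ⟨V, hpV, hV⟩ := hL p hpU
    obtain ⟨s, hsV, hps⟩ := hW.exists_basicOpen_le (V := V ⊓ U) ⟨p, hpV, hpU⟩ hpW
    obtain ⟨n, b, hb⟩ := hV.mono (hsV.trans inf_le_left)
    have hle : X.basicOpen s ≤ W := X.basicOpen_le s
    have hle' : Y.basicOpen ((f.app W).hom s) = f ⁻¹ᵁ X.basicOpen s :=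
        (Scheme.preimage_basicOpen f s).symm
    -- the generators on `D(s)` become sections over `W` after multiplication with a power of `s`
    have hN (m) : ∃ (N : ℕ) (β : Γ(Y, f ⁻¹ᵁ W)), ∀ q (hq : q ∈ X.basicOpen s),
        pushGerm f W q (hle hq) β =
          (X.presheaf.germ W q (hle hq)).hom s ^ N • pushGerm f _ q hq (b m) := by
      obtain ⟨N, β, hβ⟩ := exists_eq_pow_mul_of_isAffineOpen Y (f ⁻¹ᵁ W) (hW.preimage f)
        ((f.app W).hom s) ((Y.presheaf.map (eqToHom hle').op).hom (b m))
      refine ⟨N, β, fun q hq ↦ ?_⟩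
      have e := congrArg (Y.presheaf.map (eqToHom hle'.symm).op).hom hβ
      have e₁ (x) : (Y.presheaf.map (eqToHom hle'.symm).op).hom
          (x |_ Y.basicOpen ((f.app W).hom s)) =
          pushRes f hle x :=
        congrArg (fun k ↦ k.hom x) (Y.presheaf.map_comp
          (homOfLE (Y.basicOpen_le ((f.app W).hom s))).op (eqToHom hle'.symm).op).symm
      have e₂ : (Y.presheaf.map (eqToHom hle'.symm).op).hom
          ((Y.presheaf.map (eqToHom hle').op).hom (b m)) =
          b m := by
        refine (congrArg (fun k ↦ k.hom (b m)) (Y.presheaf.map_comp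
          (eqToHom hle').op (eqToHom hle'.symm).op).symm).trans ?_
        exact congrArg (fun k ↦ k.hom (b m)) (Y.presheaf.map_id _)
      rw [map_mul, map_pow, e₁, e₁, e₂] at e
      have e₃ := congrArg (pushGerm f _ q hq) e
      rw [map_mul, map_pow, pushGerm_res, pushGerm_res, pushGerm_app, ← map_pow,
        ← Algebra.smul_def] at e₃
      exact e₃
    choose N β hβ using hN
    have hK (m) := hL.exists_pow_smul_mem hc (β m) s (fun q hq hqU hqs ↦ by
      rw [hβ m q hqs, hb q hqs]
      exact Submodule.smul_mem _ _ (Submodule.subset_span ⟨m, rfl⟩))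
    choose K hK using hK
    have hT (m q) (hq : q ∈ W) : pushGerm f W q hq ((f.app W).hom s ^ K m * β m) =
        (X.presheaf.germ W q hq).hom s ^ K m • pushGerm f W q hq (β m) := by
      rw [map_mul, map_pow, pushGerm_app, ← map_pow, Algebra.smul_def]
    refine ⟨X.basicOpen s, mem_nhdsWithin_of_mem_nhds ((X.basicOpen s).2.mem_nhds hps),
      Set.range fun m ↦ (f.app W).hom s ^ K m * β m, Set.finite_range _, fun q hq hqU ↦
        ?_, fun q hq hqs ↦ ?_⟩
    · rw [spanGermSet, Submodule.span_le]
      rintro _ ⟨_, ⟨m, rfl⟩, rfl⟩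
      rw [hT]
      exact hK m q hq hqU
    · rw [hb q hqs, spanGerm, Submodule.span_le]
      rintro _ ⟨m, rfl⟩
      have hu : IsUnit ((X.presheaf.germ W q hq).hom s) := (X.mem_basicOpen s q hq).mp hqs
      obtain ⟨v, hv⟩ := hu.pow (K m + N m)
      have : pushGerm f _ q hqs (b m) = (↑v⁻¹ : X.presheaf.stalk q) •
          pushGerm f W q hq ((f.app W).hom s ^ K m * β m) := by
        rw [hT, hβ m q hqs, ← mul_smul, ← mul_smul, mul_assoc]
        erw [← pow_add]
        rw [← hv, Units.inv_mul, one_smul]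
      change pushGerm f _ q hqs (b m) ∈ spanGermSet _ q hq
      rw [this]
      exact Submodule.smul_mem _ _ (Submodule.subset_span ⟨_, ⟨m, rfl⟩, rfl⟩)

/-- Extension of a locally finitely generated family containing `1` to a bigger open subset. -/
lemma IsLocGenOn.exists_extend [IsAffineHom f] [QuasiSeparatedSpace X] {U W : X.Opens}
    (hL : IsLocGenOn L U)
    (hU : IsCompact U.1) (hW : IsAffineOpen W) (h1 : ∀ p ∈ U, 1 ∈ L p) :
    ∃ L' : ∀ p : X, Submodule (X.presheaf.stalk p) (PushStalk f p), (∀ p ∈ U, L' p = L p) ∧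
      (∀ p ∈ U ⊔ W, 1 ∈ L' p) ∧ IsLocGenOn L' (U ⊔ W) := by
  obtain ⟨T, hT, hTL⟩ := hL.exists_finite hW
    (QuasiSeparatedSpace.inter_isCompact U.1 W.1 U.2 hU W.2 hW.isCompact)
  obtain ⟨n, b, -, hb⟩ := (hT.insert 1).fin_param
  have hb' (p) (hp : p ∈ W) : spanGerm f b p hp = spanGermSet (insert 1 T) p hp := by
    rw [spanGerm, spanGermSet, ← hb, ← Set.range_comp]; rfl
  have h1' (p) (hp : p ∈ W) : 1 ∈ spanGermSet (insert 1 T) p hp :=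
    Submodule.subset_span ⟨1, Set.mem_insert _ _, map_one _⟩
  have hins (p) (hp : p ∈ W) (hpU : p ∈ U) : spanGermSet (insert 1 T) p hp = L p := by
    rw [← hTL p hp hpU, spanGermSet, Set.image_insert_eq, map_one, Submodule.span_insert]
    refine sup_eq_right.mpr ?_
    rw [Submodule.span_singleton_le_iff_mem]
    exact (hTL p hp hpU).ge (h1 p hpU)
  classical
  let L' (p : X) : Submodule (X.presheaf.stalk p) (PushStalk f p) :=
    if hp : p ∈ W then spanGermSet (insert 1 T) p hp else L p
  have hLU (p) (hpU : p ∈ U) : L' p = L p := by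
    by_cases hp : p ∈ W
    · exact (dif_pos hp).trans (hins p hp hpU)
    · exact dif_neg hp
  have hLW (p) (hp : p ∈ W) : L' p = spanGermSet (insert 1 T) p hp := dif_pos hp
  refine ⟨L', hLU, ?_, ?_⟩
  · rintro p (hp | hp)
    · rw [hLU p hp]; exact h1 p hp
    · rw [hLW p hp]; exact h1' p hp
  · rintro p (hp | hp)
    · obtain ⟨V, hpV, hV⟩ := hL p hp
      obtain ⟨m, c, hc⟩ := hV.mono (inf_le_left : V ⊓ U ≤ V)
      exact ⟨V ⊓ U, ⟨hpV, hp⟩, m, c, fun q hq ↦ by rw [hLU q hq.2, hc q hq]⟩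
    · exact ⟨W, hp, n, b, fun q hq ↦ by rw [hLW q hq, hb']⟩

/-- Finitely many sections of `f_* 𝒪_Y` over a quasi-compact open subset, one of them `1`, generate
a submodule which is the restriction of a submodule of finite type of `f_* 𝒪_Y`. -/
lemma exists_isLocGenOn_top [IsAffineHom f] [CompactSpace X] [QuasiSeparatedSpace X] {V : X.Opens}
    (hV : IsCompact V.1) {n : ℕ} (b : Fin n → Γ(Y, f ⁻¹ᵁ V)) (hb : ∃ m, b m = 1) :
    ∃ L : ∀ p : X, Submodule (X.presheaf.stalk p) (PushStalk f p),
      (∀ p (hp : p ∈ V), L p = spanGerm f b p hp) ∧ (∀ p, 1 ∈ L p) ∧ IsLocGenOn L ⊤ := by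
  suffices H : ∃ L : ∀ p : X, Submodule (X.presheaf.stalk p) (PushStalk f p),
      (∀ p (hp : p ∈ V), L p = spanGerm f b p hp) ∧ (∀ p ∈ V ⊔ (⊤ : X.Opens), 1 ∈ L p) ∧
        IsLocGenOn L (V ⊔ ⊤) by
    obtain ⟨L, h₁, h₂, h₃⟩ := H
    exact ⟨L, h₁, fun p ↦ h₂ p (Or.inr trivial), by rwa [sup_top_eq] at h₃⟩
  refine compact_open_induction_on (P := fun S ↦ ∃ L : ∀ p : X, Submodule (X.presheaf.stalk p)
    (PushStalk f p),
      (∀ p (hp : p ∈ V), L p = spanGerm f b p hp) ∧ (∀ p ∈ V ⊔ S, 1 ∈ L p) ∧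
        IsLocGenOn L (V ⊔ S)) ⊤ isCompact_univ ?_ ?_
  · classical
    let L (p : X) : Submodule (X.presheaf.stalk p) (PushStalk f p) :=
      if hp : p ∈ V then spanGerm f b p hp else ⊥
    have hL (p) (hp : p ∈ V) : L p = spanGerm f b p hp := dif_pos hp
    rw [sup_bot_eq]
    refine ⟨L, hL, fun p hp ↦ ?_, fun p hp ↦ ⟨V, hp, n, b, hL⟩⟩
    obtain ⟨m, hm⟩ := hb
    rw [hL p hp]
    exact Submodule.subset_span ⟨m, (congrArg _ hm).trans (map_one _)⟩
  · rintro S hS U ⟨L, h₁, h₂, h₃⟩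
    obtain ⟨L', h₁', h₂', h₃'⟩ := h₃.exists_extend (W := U.1) (hV.union hS) U.2 h₂
    rw [sup_assoc] at h₂' h₃'
    exact ⟨L', fun p hp ↦ (h₁' p (Or.inl hp)).trans (h₁ p hp), h₂', h₃'⟩

end Extension

end

/-! ### Modifications on which finitely many sections become principal -/

section

section Pull

variable {Z T Y : Scheme.{u}}

/-- The pullback of sections over an open subset along a morphism which factors through it. -/
def pull (w : Z ⟶ Y) (U : Y.Opens) (h : ⊤ ≤ w ⁻¹ᵁ U) : Γ(Y, U) →+* Γ(Z, ⊤) :=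
  (w.appLE U ⊤ h).hom

lemma pull_comp (t : Z ⟶ T) (w : T ⟶ Y) (U : Y.Opens) (h : ⊤ ≤ w ⁻¹ᵁ U) (h' : ⊤ ≤ (t ≫ w) ⁻¹ᵁ U)
    (x : Γ(Y, U)) : pull (t ≫ w) U h' x = t.appTop.hom (pull w U h x) := by
  have e := Scheme.Hom.appLE_comp_appLE t w U ⊤ ⊤ h le_top
  rw [show t.appLE ⊤ ⊤ le_top = t.appTop from Scheme.Hom.appLE_eq_app _] at e
  exact (congrArg (fun k ↦ k.hom x) e).symm

lemma pull_res (w : Z ⟶ Y) {U V : Y.Opens} (hVU : V ≤ U) (h : ⊤ ≤ w ⁻¹ᵁ V) (h' : ⊤ ≤ w ⁻¹ᵁ U)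
    (x : Γ(Y, U)) :
    pull w V h ((Y.presheaf.map (homOfLE hVU).op).hom x) = pull w U h' x :=
  congrArg (fun k ↦ k.hom x) (Scheme.Hom.map_appLE w h (homOfLE hVU).op)

lemma pull_app (w : Z ⟶ T) (f : T ⟶ Y) (U : Y.Opens) (h : ⊤ ≤ w ⁻¹ᵁ (f ⁻¹ᵁ U))
    (h' : ⊤ ≤ (w ≫ f) ⁻¹ᵁ U)
    (x : Γ(Y, U)) : pull w (f ⁻¹ᵁ U) h ((f.app U).hom x) = pull (w ≫ f) U h' x := by
  have e := Scheme.Hom.appLE_comp_appLE w f U (f ⁻¹ᵁ U) ⊤ le_rfl h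
  rw [f.appLE_eq_app] at e
  exact congrArg (fun k ↦ k.hom x) e

lemma pull_congr {w w' : Z ⟶ Y} (e : w = w') (U : Y.Opens) (h : ⊤ ≤ w ⁻¹ᵁ U) (h' : ⊤ ≤ w' ⁻¹ᵁ U)
    (x : Γ(Y, U)) :
    pull w U h x = pull w' U h' x := by
  subst e; rfl

lemma pull_top (w : Z ⟶ Y) (h : ⊤ ≤ w ⁻¹ᵁ ⊤) (x : Γ(Y, ⊤)) : pull w ⊤ h x = w.appTop.hom x := by
  exact congrArg (fun k ↦ k.hom x) (Scheme.Hom.appLE_eq_app (U := ⊤) w)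

lemma pull_resTop (w : Z ⟶ Y) (V : Y.Opens) (h : ⊤ ≤ w ⁻¹ᵁ V) (x : Γ(Y, ⊤)) :
    pull w V h (resTop V x) = w.appTop.hom x :=
  (pull_res w le_top h le_top x).trans (pull_top w _ x)

lemma pull_appLE (t : Z ⟶ T) (w : T ⟶ Y) {U : Y.Opens} {V : T.Opens} (e : V ≤ w ⁻¹ᵁ U)
    (h : ⊤ ≤ t ⁻¹ᵁ V)
    (h' : ⊤ ≤ (t ≫ w) ⁻¹ᵁ U) (x : Γ(Y, U)) :
    pull t V h ((w.appLE U V e).hom x) = pull (t ≫ w) U h' x :=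
  congrArg (fun k ↦ k.hom x) (Scheme.Hom.appLE_comp_appLE t w U V ⊤ e h)

lemma pull_topIso_inv {V : Y.Opens} (s : Z ⟶ V.toScheme) (x : Γ(Y, V)) (h : ⊤ ≤ (s ≫ V.ι) ⁻¹ᵁ V) :
    s.appTop.hom (V.topIso.inv.hom x) = pull (s ≫ V.ι) V h x := by
  rw [pull_comp _ _ _ (by simp), pull, ι_appLE_top]

end Pull

variable {Y X : Scheme.{u}} {f : Y ⟶ X}

namespace BlowUp

variable {n : ℕ} {c : Fin n → Γ(Y, ⊤)} (B : BlowUp f c)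

lemma pull_ratio {Z T : Scheme.{u}} (t : Z ⟶ T) (w : Z ⟶ Y) (r : T ⟶ B.obj) (e : t ≫ r = w ≫ B.ι)
    (l m : Fin n) (hr : ⊤ ≤ r ⁻¹ᵁ B.chart l) :
    t.appTop.hom (pull r _ hr (B.ratio l m)) * w.appTop.hom (c l) = w.appTop.hom (c m) := by
  have hr' : ⊤ ≤ (t ≫ r) ⁻¹ᵁ B.chart l := fun z _ ↦ hr (x := t z) trivial
  have hw : ⊤ ≤ w ⁻¹ᵁ Y.basicOpen (c l) := by
    rw [← B.preimage_chart, ← Scheme.Hom.comp_preimage, ← e]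
    exact hr'
  rw [← pull_comp t r _ hr hr', pull_congr e _ _ (by rwa [← e]),
    ← pull_appLE w B.ι (B.preimage_chart l).ge hw]
  have := congrArg (pull w _ hw) (B.ratio_mul l m)
  rwa [map_mul, pull_resTop, pull_resTop] at this

lemma isUnit_appTop {Z T : Scheme.{u}} (t : Z ⟶ T) (w : Z ⟶ Y) (r : T ⟶ B.obj) (e : t ≫ r = w ≫ B.ι)
    (l : Fin n) (hr : ⊤ ≤ r ⁻¹ᵁ B.chart l) : IsUnit (w.appTop.hom (c l)) := by
  have hr' : ⊤ ≤ (t ≫ r) ⁻¹ᵁ B.chart l := fun z _ ↦ hr (x := t z) trivial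
  have hw : ⊤ ≤ w ⁻¹ᵁ Y.basicOpen (c l) := by
    rw [← B.preimage_chart, ← Scheme.Hom.comp_preimage, ← e]
    exact hr'
  have := (isUnit_resTop_of_le_basicOpen (le_refl (Y.basicOpen (c l)))).map (pull w _ hw)
  rwa [pull_resTop] at this

/-- A blow-up over an open subset is a modification of it. -/
@[simps]
def modification : Modification f where
  obj := B.obj
  ι := B.ι
  π := B.π
  fac := B.fac
  dominant := B.dominant
  proper := B.proper

end BlowUp

variable (L : ∀ p : X, Submodule (X.presheaf.stalk p) (PushStalk f p))

/-- An affine open subset of `X` with a finite set of sections of `f_* 𝒪_Y` which generate a given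
family of submodules of the stalks and which have no common zero. -/
structure LocalGens : Type u where
  V : X.Opens
  affine : IsAffineOpen V
  n : ℕ
  b : Fin n → Γ(Y, f ⁻¹ᵁ V)
  span : Ideal.span (Set.range b) = ⊤
  gen : ∀ p (hp : p ∈ V), L p = spanGerm f b p hp

namespace LocalGens

variable {L} [QuasiCompact f] (i k : LocalGens L)

/-- The sections as global sections of the open subscheme. -/
def c (m : Fin i.n) : Γ((f ⁻¹ᵁ i.V).toScheme, ⊤) := (f ⁻¹ᵁ i.V).topIso.inv.hom (i.b m)

omit [QuasiCompact f] in
lemma span_c : Ideal.span (Set.range i.c) = ⊤ := by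
  have : Set.range i.c = (f ⁻¹ᵁ i.V).topIso.inv.hom '' Set.range i.b := by
    rw [← Set.range_comp]; rfl
  rw [this, ← Ideal.map_span, i.span, Ideal.map_top]

/-- The blow-up along the sections. -/
def blowUp : BlowUp (f ∣_ i.V) i.c :=
  have : IsAffine i.V.toScheme := i.affine
  (nonempty_blowUp (f ∣_ i.V) i.c i.span_c).some

/-- The blow-up along the sections, as a modification. -/
def modification : Modification (f ∣_ i.V) := i.blowUp.modification

/-- Let `b` and `b'` be generators of the same submodule. Locally on the blow-up along `b` the
functions `b' m / b l` come from the blow-up, being linear combinations of the `b m / b l`, and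
they have no common zero since `1 = b l / b l` is a linear combination of them. So the blow-up
along `b` maps to the one along `b'`. -/
lemma exists_compat (z : i.modification.obj) (hz : i.modification.base z ∈ k.V) :
    ∃ (T : i.modification.obj.Opens) (m : T.toScheme ⟶ k.modification.obj),
      z ∈ T ∧ i.modification.Compat k.modification T.ι m := by
  let M := i.modification
  let N := k.modification
  have hqc : QuasiCompact M.ι := i.blowUp.quasiCompact
  have hx : M.base z ∈ i.V ⊓ k.V := ⟨M.base_mem z, hz⟩
  let b₁ (m) := pushRes f (inf_le_left : i.V ⊓ k.V ≤ i.V) (i.b m)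
  let b₂ (m) := pushRes f (inf_le_right : i.V ⊓ k.V ≤ k.V) (k.b m)
  have hL : spanGerm f b₁ _ hx = spanGerm f b₂ _ hx := by
    rw [spanGerm_res, spanGerm_res, ← i.gen, ← k.gen]
  obtain ⟨l, hl⟩ := Opens.mem_iSup.mp
      (show z ∈ ⨆ l, i.blowUp.chart l by rw [i.blowUp.iSup_chart]; trivial)
  have h₂ (m) := exists_of_mem_spanGerm b₁ (b₂ m)
      _ hx (by rw [hL]; exact Submodule.subset_span ⟨m, rfl⟩)
  obtain ⟨O', hO', a', hxO', ha'⟩ := exists_of_mem_spanGerm b₂ (b₁ l) _ hx (by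
    rw [← hL]; exact Submodule.subset_span ⟨l, rfl⟩)
  choose O hO a hxO ha using h₂
  -- a neighborhood of `z` over which all the coefficients are defined
  let Q : X.Opens := O' ⊓ (Finset.univ.inf O ⊓ (i.V ⊓ k.V))
  have hxQ : M.base z ∈ Q := by
    refine ⟨hxO', ?_, hx⟩
    rw [Opens.coe_finset_inf]
    simpa using hxO
  have hQO' : Q ≤ O' := inf_le_left
  have hQO (m) : Q ≤ O m :=
      inf_le_right.trans (inf_le_left.trans (Finset.inf_le (Finset.mem_univ m)))
  have hQi : Q ≤ i.V := inf_le_right.trans (inf_le_right.trans inf_le_left)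
  have hQk : Q ≤ k.V := inf_le_right.trans (inf_le_right.trans inf_le_right)
  let T : M.obj.Opens := M.base ⁻¹ᵁ Q ⊓ i.blowUp.chart l
  let Z := M.ι ⁻¹ᵁ T
  let t : Z.toScheme ⟶ T.toScheme := M.ι ∣_ T
  have ht : t ≫ T.ι = Z.ι ≫ M.ι := morphismRestrict_ι _ _
  have hdom : IsSchemeTheoreticallyDominant t :=
      .of_isPullback (isPullback_morphismRestrict M.ι T).flip
  let w : Z.toScheme ⟶ Y := Z.ι ≫ (f ⁻¹ᵁ i.V).ι
  have hwf : w ≫ f = t ≫ T.ι ≫ M.base := by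
    rw [reassoc_of% ht, M.ι_base, Category.assoc]
  have hTQ : ⊤ ≤ (T.ι ≫ M.base) ⁻¹ᵁ Q := fun y _ ↦ y.2.1
  have hTl : ⊤ ≤ T.ι ⁻¹ᵁ i.blowUp.chart l := fun y _ ↦ y.2.2
  have hwQ : ⊤ ≤ (w ≫ f) ⁻¹ᵁ Q := by rw [hwf]; exact fun y _ ↦ hTQ (x := t y) trivial
  have hwQ' : ⊤ ≤ w ⁻¹ᵁ (f ⁻¹ᵁ Q) := hwQ
  have hwi : ⊤ ≤ w ⁻¹ᵁ (f ⁻¹ᵁ i.V) := hwQ'.trans (w.preimage_mono (f.preimage_mono hQi))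
  have hwk : ⊤ ≤ w ⁻¹ᵁ (f ⁻¹ᵁ k.V) := hwQ'.trans (w.preimage_mono (f.preimage_mono hQk))
  -- `T` maps to `k.V` and `Z` to its preimage in `Y`
  let v : T.toScheme ⟶ k.V.toScheme := IsOpenImmersion.lift k.V.ι (T.ι ≫ M.base) (by
    rintro _ ⟨y, rfl⟩
    rw [Scheme.Opens.range_ι]
    exact hQk y.2.1)
  have hv : v ≫ k.V.ι = T.ι ≫ M.base := IsOpenImmersion.lift_fac _ _ _
  let s : Z.toScheme ⟶ (f ⁻¹ᵁ k.V).toScheme := IsOpenImmersion.lift (f ⁻¹ᵁ k.V).ι w (by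
    rintro _ ⟨y, rfl⟩
    rw [Scheme.Opens.range_ι]
    exact hwk (x := y) trivial)
  have hs : s ≫ (f ⁻¹ᵁ k.V).ι = w := IsOpenImmersion.lift_fac _ _ _
  have hts : t ≫ v = s ≫ (f ∣_ k.V) := by
    rw [← cancel_mono k.V.ι, Category.assoc, hv, Category.assoc, morphismRestrict_ι,
      reassoc_of% hs, hwf]
  let ρ (m) : Γ(T.toScheme, ⊤) := pull T.ι _ hTl (i.blowUp.ratio l m)
  let A {O : X.Opens} (h : Q ≤ O) : Γ(X, O) →+* Γ(T.toScheme, ⊤) :=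
    pull (T.ι ≫ M.base) O (hTQ.trans (Scheme.Hom.preimage_mono _ h))
  let β (m) : Γ(Z.toScheme, ⊤) := pull w _ hwi (i.b m)
  let γ (m) : Γ(Z.toScheme, ⊤) := pull w _ hwk (k.b m)
  have hsc (m) : s.appTop.hom (k.c m) = γ m := by
    rw [c, pull_topIso_inv _ _ (by rw [hs]; exact hwk)]
    exact pull_congr hs _ _ _ _
  have hιc (m) : Z.ι.appTop.hom (i.c m) = β m := pull_topIso_inv _ _ _
  have hρ (m) : t.appTop.hom (ρ m) * β l = β m := by
    rw [← hιc, ← hιc]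
    exact i.blowUp.pull_ratio t Z.ι T.ι ht l m hTl
  have hβ : IsUnit (β l) := by
    rw [← hιc]
    exact i.blowUp.isUnit_appTop t Z.ι T.ι ht l hTl
  have hpull {O : X.Opens} (hO : O ≤ i.V ⊓ k.V) (h : Q ≤ O) : ⊤ ≤ w ⁻¹ᵁ (f ⁻¹ᵁ O) :=
    hwQ'.trans (w.preimage_mono (f.preimage_mono h))
  have hA {O : X.Opens} (hO : O ≤ i.V ⊓ k.V) (h : Q ≤ O) (x : Γ(X, O)) :
      pull w (f ⁻¹ᵁ O) (hpull hO h) ((f.app O).hom x) = t.appTop.hom (A h x) := by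
    have h' : ⊤ ≤ (t ≫ T.ι ≫ M.base) ⁻¹ᵁ O := by rw [← hwf]; exact hpull hO h
    exact (pull_app w f O (hpull hO h) (hpull hO h) x).trans
      ((pull_congr hwf O (hpull hO h) h' x).trans (pull_comp t (T.ι ≫ M.base) O _ h' x))
  have hγ (m) : γ m = ∑ m', t.appTop.hom (A (hQO m) (a m m')) * β m' := by
    have e := congrArg (pull w _ (hpull (hO m) (hQO m))) (ha m)
    rw [map_sum, pushRes_pushRes, pull_res _ _ _ hwk] at e
    refine e.trans (Finset.sum_congr rfl fun m' _ ↦ ?_)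
    rw [map_mul, hA (hO m) (hQO m), pushRes_pushRes, pull_res _ _ _ hwi]
  have hβ' : β l = ∑ m, t.appTop.hom (A hQO' (a' m)) * γ m := by
    have e := congrArg (pull w _ (hpull hO' hQO')) ha'
    rw [map_sum, pushRes_pushRes, pull_res _ _ _ hwi] at e
    refine e.trans (Finset.sum_congr rfl fun m' _ ↦ ?_)
    rw [map_mul, hA hO' hQO', pushRes_pushRes, pull_res _ _ _ hwk]
  let d (m) : Γ(T.toScheme, ⊤) := ∑ m', A (hQO m) (a m m') * ρ m'
  have hd (m) : t.appTop.hom (d m) * β l = γ m := by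
    rw [map_sum, Finset.sum_mul, hγ]
    refine Finset.sum_congr rfl fun m' _ ↦ ?_
    rw [map_mul, mul_assoc, hρ]
  have hd1 : ∑ m, A hQO' (a' m) * d m = 1 := by
    have ht1 : Function.Injective t.appTop.hom := t.app_injective ⊤
    apply ht1
    apply hβ.mul_right_cancel
    rw [map_sum, map_one, one_mul, Finset.sum_mul]
    refine Eq.trans (Finset.sum_congr rfl fun m _ ↦ ?_) hβ'.symm
    rw [map_mul, mul_assoc, hd]
  obtain ⟨r, hr, hr'⟩ := k.blowUp.exists_lift t v s hts d (by
    rw [Ideal.eq_top_iff_one, ← hd1]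
    exact Ideal.sum_mem _ fun m _ ↦ Ideal.mul_mem_left _ _ (Ideal.subset_span ⟨m, rfl⟩)) (β l) hβ
    (fun m ↦ by rw [hd, hsc])
  refine ⟨T, r, ⟨hxQ, hl⟩, ?_, ?_⟩
  · rw [← hv, ← hr', Category.assoc]; rfl
  · intro Z' z' a₁ b₁' h₁ h₂
    have hza : Set.range a₁ ⊆ Set.range Z.ι := by
      rintro _ ⟨y, rfl⟩
      rw [Scheme.Opens.range_ι]
      change M.ι (a₁ y) ∈ T
      rw [← Scheme.Hom.comp_apply, ← h₁, Scheme.Hom.comp_apply]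
      exact (z' y).2
    let y := IsOpenImmersion.lift Z.ι a₁ hza
    have hy : y ≫ Z.ι = a₁ := IsOpenImmersion.lift_fac _ _ _
    have hyt : y ≫ t = z' := by
      rw [← cancel_mono T.ι, Category.assoc, ht, reassoc_of% hy, h₁]
    have hys : y ≫ s = b₁' := by
      rw [← cancel_mono (f ⁻¹ᵁ k.V).ι, Category.assoc, hs, ← h₂, ← hy, Category.assoc]
    refine (congrArg (· ≫ r) hyt.symm).trans ((Category.assoc _ _ _).trans ?_)
    exact (congrArg (y ≫ ·) hr).trans
      ((Category.assoc _ _ _).symm.trans (congrArg (· ≫ k.blowUp.ι) hys))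

end LocalGens

/-- A locally finitely generated family of submodules containing `1` has generators without common
zero near each point, as `1` can be added to given generators. -/
lemma exists_localGens {L : ∀ p : X, Submodule (X.presheaf.stalk p) (PushStalk f p)}
    (hL : IsLocGenOn L ⊤)
    (h1 : ∀ p, 1 ∈ L p) (p : X) : ∃ i : LocalGens L, p ∈ i.V := by
  obtain ⟨V, hpV, hV⟩ := hL p trivial
  obtain ⟨V', hV', hpV', hle⟩ := Opens.isBasis_iff_nbhd.mp X.isBasis_affineOpens hpV
  obtain ⟨n, b, hb⟩ := hV.mono hle
  refine ⟨⟨V', hV', n + 1, Fin.cons 1 b, ?_, fun q hq ↦ ?_⟩, hpV'⟩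
  · rw [Ideal.eq_top_iff_one]
    exact Ideal.subset_span ⟨0, rfl⟩
  · rw [hb q hq]
    apply le_antisymm
    · rw [spanGerm, Submodule.span_le]
      rintro _ ⟨m, rfl⟩
      exact Submodule.subset_span ⟨m.succ, rfl⟩
    · rw [spanGerm, Submodule.span_le]
      rintro _ ⟨m, rfl⟩
      refine Fin.cases ?_ (fun m ↦ ?_) m
      · exact (congrArg (· ∈ spanGerm f b q hq) (map_one (pushGerm f V' q hq))).mpr (hb q hq ▸ h1 q)
      · exact Submodule.subset_span ⟨m, rfl⟩

/-- Finitely many sections of `f_* 𝒪_Y` over an affine open subset, one of them `1`, become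
multiples of one of them, locally on a modification: on the glued blow-up along an extension to
`X` of the submodule which they generate. -/
lemma exists_modification_principal [IsAffineHom f] [CompactSpace X] [QuasiSeparatedSpace X]
    {V : X.Opens}
    (hV : IsAffineOpen V) {n : ℕ} (b : Fin n → Γ(Y, f ⁻¹ᵁ V)) (hb : ∃ m, b m = 1) :
    ∃ N : Modification f, ∀ z : N.obj, N.π z ∈ V → ∃ (W : N.obj.Opens) (hW : N.ι ⁻¹ᵁ W ≤ f ⁻¹ᵁ V)
      (l : Fin n),
      z ∈ W ∧ ∀ m, ∃ a : Γ(N.obj, W), (N.ι.app W).hom a * (Y.presheaf.map (homOfLE hW).op).hom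
        (b l) =
        (Y.presheaf.map (homOfLE hW).op).hom (b m) := by
  obtain ⟨L, hLV, h1, hL⟩ := exists_isLocGenOn_top hV.isCompact b hb
  let i : LocalGens L := ⟨V, hV, n, b, by
    obtain ⟨m, hm⟩ := hb
    rw [Ideal.eq_top_iff_one, ← hm]
    exact Ideal.subset_span ⟨m, rfl⟩, hLV⟩
  obtain ⟨P, p, y, e, hp, hyp, he⟩ := exists_glued (V := fun j : LocalGens L ↦ j.V)
    (.mk (by
      ext q
      simp only [Opens.coe_iSup, Set.mem_iUnion, Opens.coe_top, Set.mem_univ, iff_true]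
      exact exists_localGens hL h1 q))
    (fun j ↦ j.modification)
    (fun j k ↦ Modification.Compat.exists_of_forall_exists _ _ _ _ (j.exists_compat k))
  have hqy : QuasiCompact y := by
    have : QuasiCompact (y ≫ p) := by rw [hyp]; infer_instance
    exact .of_comp y p
  obtain ⟨hye, heo, her⟩ := he i
  refine ⟨.ofProper y p hyp, fun (z : y.image) hz ↦ ?_⟩
  have hz' : y.imageι z ∈ (e i).opensRange := by rw [her]; exact hz
  obtain ⟨ζ, hζ⟩ := hz'
  obtain ⟨l, hl⟩ := Opens.mem_iSup.mp
      (show ζ ∈ ⨆ l, i.blowUp.chart l by rw [i.blowUp.iSup_chart]; trivial)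
  let W' : P.Opens := (e i) ''ᵁ i.blowUp.chart l
  have hW' : W' ≤ p ⁻¹ᵁ V := by
    rw [← her]; exact (e i).image_le_opensRange _
  have hD : y.toImage ⁻¹ᵁ y.imageι ⁻¹ᵁ W' ≤ f ⁻¹ᵁ V := by
    rw [← Scheme.Hom.comp_preimage, y.toImage_imageι, ← hyp]
    exact y.preimage_mono hW'
  refine ⟨y.imageι ⁻¹ᵁ W', hD, l, ⟨ζ, hl, hζ⟩, fun m ↦ ?_⟩
  let a' : Γ(P, W') := ((e i).appIso (i.blowUp.chart l)).inv.hom (i.blowUp.ratio l m)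
  refine ⟨(y.imageι.app W').hom a', ?_⟩
  -- compare both sides after pullback to the open subscheme `D` of `Y`
  let D : Y.Opens := y.toImage ⁻¹ᵁ y.imageι ⁻¹ᵁ W'
  have hinj : Function.Injective (pull D.ι D (by simp)) := by
    rw [pull, ι_appLE_top]
    exact (ConcreteCategory.bijective_of_isIso D.topIso.inv).1
  let k : D.toScheme ⟶ (f ⁻¹ᵁ V).toScheme := Y.homOfLE hD
  have hk : k ≫ (f ⁻¹ᵁ V).ι = D.ι := Y.homOfLE_ι hD
  have hkc (m) : k.appTop.hom (i.c m) = pull D.ι D (by simp)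
      ((Y.presheaf.map (homOfLE hD).op).hom (b m)) := by
    have h₁ : ⊤ ≤ D.ι ⁻¹ᵁ (f ⁻¹ᵁ V) := fun q _ ↦ hD q.2
    rw [pull_res _ _ _ h₁]
    exact (pull_topIso_inv k (b m) (by rw [hk]; exact h₁)).trans (pull_congr hk _ _ _ _)
  have hky : (k ≫ i.modification.ι) ≫ e i = D.ι ≫ y.toImage ≫ y.imageι := by
    rw [Category.assoc, hye, reassoc_of% hk, y.toImage_imageι]
  have h₁ : ⊤ ≤ D.ι ⁻¹ᵁ D := by simp
  have h₂ : ⊤ ≤ (D.ι ≫ y.toImage ≫ y.imageι) ⁻¹ᵁ W' := h₁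
  have h₃ : ⊤ ≤ ((k ≫ i.modification.ι) ≫ e i) ⁻¹ᵁ W' := by rw [hky]; exact h₁
  have h₄ : ⊤ ≤ (k ≫ i.modification.ι) ⁻¹ᵁ i.blowUp.chart l := by
    rw [← (e i).preimage_image_eq (i.blowUp.chart l)]; exact h₃
  have hea : ((e i).appLE W' (i.blowUp.chart l) ((e i).preimage_image_eq _).ge).hom a' =
      i.blowUp.ratio l m := by
    refine (congrArg (fun k ↦ k.hom a') ((e i).appIso_hom' (i.blowUp.chart l)).symm).trans ?_
    exact congrArg (fun k ↦ k.hom (i.blowUp.ratio l m)) ((e i).appIso (i.blowUp.chart l)).inv_hom_id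
  have ha : pull D.ι D h₁ ((y.toImage.app (y.imageι ⁻¹ᵁ W')).hom ((y.imageι.app W').hom a')) =
      pull (k ≫ i.blowUp.ι) (i.blowUp.chart l) h₄ (i.blowUp.ratio l m) := by
    refine (pull_app D.ι y.toImage (y.imageι ⁻¹ᵁ W') h₁ h₁ _).trans ?_
    refine (pull_app (D.ι ≫ y.toImage) y.imageι W' h₁ h₁ _).trans ?_
    refine (pull_congr ((Category.assoc _ _ _).trans hky.symm) W' _ h₃ _).trans ?_
    refine (pull_appLE (k ≫ i.modification.ι) (e i)
      ((e i).preimage_image_eq _).ge h₄ h₃ a').symm.trans ?_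
    exact congrArg (pull (k ≫ i.blowUp.ι) (i.blowUp.chart l) h₄) hea
  have hr := i.blowUp.pull_ratio (𝟙 _) k (k ≫ i.blowUp.ι) (Category.id_comp _) l m h₄
  rw [Scheme.Hom.id_appTop] at hr
  apply hinj
  refine (map_mul (pull D.ι D h₁) _ _).trans ((congrArg₂ (· * ·) ha (hkc l).symm).trans ?_)
  exact Eq.trans hr (hkc m)

end

/-! ### The center on `Y` of a point of `RZ_Y(X)` -/

section

variable {Y X : Scheme.{u}} {f : Y ⟶ X}

lemma IsDecomposable.quasiCompact (hf : IsDecomposable f) : QuasiCompact f := by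
  obtain ⟨Z, g, h, hg, hh, rfl⟩ := hf
  infer_instance

namespace Modification

/-- A modification of a modification. -/
def trans (M : Modification f) (N : Modification M.ι) : Modification f where
  obj := N.obj
  ι := N.ι
  π := N.π ≫ M.π
  fac := by rw [← Category.assoc, N.fac, M.fac]
  dominant := N.dominant
  proper := inferInstance

/-- A modification of a modification dominates it. -/
def transDom (M : Modification f) (N : Modification M.ι) : (M.trans N).Dom M := ⟨N.π, N.fac, rfl⟩

/-- The modifications to which `Y` is affine are cofinal. -/
lemma exists_dom_isAffineHom (hf : IsDecomposable f) (M : Modification f) :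
    ∃ N : Modification f, IsAffineHom N.ι ∧ Nonempty (N.Dom M) := by
  have := hf.quasiCompact
  obtain ⟨M₀, h₀⟩ := exists_isAffineHom hf
  exact ⟨M.join M₀, (M.joinRight M₀).isAffineHom, ⟨M.joinLeft M₀⟩⟩

lemma Dom.preimage_le {N M : Modification f} (a : N.Dom M) {V : M.obj.Opens} {W : N.obj.Opens}
    (h : W ≤ a.hom ⁻¹ᵁ V) : N.ι ⁻¹ᵁ W ≤ M.ι ⁻¹ᵁ V := by
  rw [← a.ι_hom]
  exact N.ι.preimage_mono h

end Modification

namespace RZ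

/-- Functions on the preimage in `Y` of a neighborhood of the projection of `x`, one of them `1`,
become multiples of one of them near the projection of `x` to a bigger modification. No affineness
is assumed, since `x` is centered in an affine open subset of a modification to which `Y` is
affine. -/
lemma exists_principal (hf : IsDecomposable f) [CompactSpace X] [QuasiSeparatedSpace X] (x : RZ f)
    {M : Modification f} {V : M.obj.Opens} (hx : x.1 M ∈ V) {n : ℕ} (b : Fin n → Γ(Y, M.ι ⁻¹ᵁ V))
    (hb : ∃ m, b m = 1) :
    ∃ (N : Modification f) (W : N.obj.Opens) (hW : N.ι ⁻¹ᵁ W ≤ M.ι ⁻¹ᵁ V) (l : Fin n),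
      Nonempty (N.Dom M) ∧ x.1 N ∈ W ∧ ∀ m, ∃ a : Γ(N.obj, W),
        (N.ι.app W).hom a * (Y.presheaf.map (homOfLE hW).op).hom (b l) =
          (Y.presheaf.map (homOfLE hW).op).hom (b m) := by
  obtain ⟨M₁, h₁, ⟨a₁⟩⟩ := M.exists_dom_isAffineHom hf
  have : CompactSpace M₁.obj := QuasiCompact.compactSpace_of_compactSpace M₁.π
  have : QuasiSeparatedSpace M₁.obj := quasiSeparatedSpace_of_quasiSeparated M₁.π
  obtain ⟨V₁, hV₁, hxV₁, hle⟩ := Opens.isBasis_iff_nbhd.mp M₁.obj.isBasis_affineOpens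
    (show x.1 M₁ ∈ a₁.hom ⁻¹ᵁ V by change a₁.hom _ ∈ V; rwa [x.2])
  have hle' := a₁.preimage_le hle
  obtain ⟨N, hN⟩ := exists_modification_principal (f := M₁.ι) hV₁
    (fun m ↦ (Y.presheaf.map (homOfLE hle').op).hom (b m)) (by
      obtain ⟨m, hm⟩ := hb
      exact ⟨m, by rw [hm, map_one]⟩)
  obtain ⟨W, hW, l, hxW, hl⟩ := hN (x.1 (M₁.trans N)) (by
    have := x.2 _ _ (M₁.transDom N)
    change (M₁.transDom N).hom _ ∈ V₁
    rwa [this])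
  refine ⟨M₁.trans N, W, hW.trans hle', l, ⟨(M₁.transDom N).comp a₁⟩, hxW, fun m ↦ ?_⟩
  obtain ⟨a, ha⟩ := hl m
  refine ⟨a, ?_⟩
  have e (s : Γ(Y, M.ι ⁻¹ᵁ V)) : (Y.presheaf.map (homOfLE hW).op).hom
      ((Y.presheaf.map (homOfLE hle').op).hom s) =
      (Y.presheaf.map (homOfLE (hW.trans hle')).op).hom s :=
    congrArg (fun k ↦ k.hom s) (Y.presheaf.map_comp (homOfLE hle').op (homOfLE hW).op).symm
  rw [e, e] at ha
  exact ha

/-- An open subset of `Y` is big at a point `x` of `RZ_Y(X)` if it contains the preimage of a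
neighborhood of the projection of `x` to some modification. -/
def IsBig (x : RZ f) (O : Y.Opens) : Prop :=
  ∃ (M : Modification f) (V : M.obj.Opens), x.1 M ∈ V ∧ M.ι ⁻¹ᵁ V ≤ O

variable {x : RZ f}

lemma IsBig.mono {O O' : Y.Opens} (h : x.IsBig O) (hO : O ≤ O') : x.IsBig O' := by
  obtain ⟨M, V, hx, hV⟩ := h
  exact ⟨M, V, hx, hV.trans hO⟩

lemma exists_common [QuasiCompact f] {M M' : Modification f} {V : M.obj.Opens} {V' : M'.obj.Opens}
    (h : x.1 M ∈ V) (h' : x.1 M' ∈ V') :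
    ∃ (N : Modification f) (a : N.Dom M) (a' : N.Dom M') (W : N.obj.Opens), x.1 N ∈ W ∧
      W ≤ a.hom ⁻¹ᵁ V ∧ W ≤ a'.hom ⁻¹ᵁ V' := by
  refine ⟨M.join M', M.joinLeft M', M.joinRight M',
    (M.joinLeft M').hom ⁻¹ᵁ V ⊓ (M.joinRight M').hom ⁻¹ᵁ V',
    ⟨?_, ?_⟩, inf_le_left, inf_le_right⟩
  · change (M.joinLeft M').hom _ ∈ V
    rwa [x.2]
  · change (M.joinRight M').hom _ ∈ V'
    rwa [x.2]

lemma IsBig.inf [QuasiCompact f] {O O' : Y.Opens} (h : x.IsBig O) (h' : x.IsBig O') :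
    x.IsBig (O ⊓ O') := by
  obtain ⟨M, V, hx, hV⟩ := h
  obtain ⟨M', V', hx', hV'⟩ := h'
  obtain ⟨N, a, a', W, hW, h₁, h₂⟩ := exists_common hx hx'
  exact ⟨N, W, hW, le_inf ((a.preimage_le h₁).trans hV) ((a'.preimage_le h₂).trans hV')⟩

lemma isBig_preimage {M : Modification f} {V : M.obj.Opens} (h : x.1 M ∈ V) : x.IsBig (M.ι ⁻¹ᵁ V) :=
  ⟨M, V, h, le_rfl⟩

/-- Big affine open subsets are cofinal. -/
lemma IsBig.exists_isAffineOpen (hf : IsDecomposable f) {O : Y.Opens} (h : x.IsBig O) :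
    ∃ O' ≤ O, IsAffineOpen O' ∧ x.IsBig O' := by
  obtain ⟨M, V, hx, hV⟩ := h
  obtain ⟨M₁, h₁, ⟨a₁⟩⟩ := M.exists_dom_isAffineHom hf
  obtain ⟨V₁, hV₁, hxV₁, hle⟩ := Opens.isBasis_iff_nbhd.mp M₁.obj.isBasis_affineOpens
    (show x.1 M₁ ∈ a₁.hom ⁻¹ᵁ V by change a₁.hom _ ∈ V; rwa [x.2])
  exact ⟨M₁.ι ⁻¹ᵁ V₁, (a₁.preimage_le hle).trans hV, hV₁.preimage _, isBig_preimage hxV₁⟩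

lemma isBig_top (hf : IsDecomposable f) (x : RZ f) : x.IsBig ⊤ :=
  ⟨(Modification.exists_isAffineHom hf).choose, ⊤, trivial, le_top⟩

lemma IsBig.not_bot {O : Y.Opens} [QuasiCompact f] (h : x.IsBig O) : O ≠ ⊥ := by
  rintro rfl
  obtain ⟨M, V, hx, hV⟩ := h
  have := M.quasiCompact_ι
  obtain ⟨q, hq⟩ := (Scheme.Hom.denseRange M.ι).exists_mem_open V.2 ⟨_, hx⟩
  exact hV (show q ∈ M.ι ⁻¹ᵁ V from hq)

/-- If `g + h` is invertible on a big open subset then so is `g` or `h`: the function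
`s = g / (g + h)` is invertible there or comes from a modification, and in the local ring of the
latter `s` or `1 - s` is invertible. -/
lemma IsBig.of_add (hf : IsDecomposable f) [CompactSpace X] [QuasiSeparatedSpace X] {U : Y.Opens}
    (g h : Γ(Y, U))
    (H : x.IsBig (Y.basicOpen (g + h))) : x.IsBig (Y.basicOpen g) ∨ x.IsBig (Y.basicOpen h) := by
  obtain ⟨M, V, hx, hV⟩ := H
  have hVU : M.ι ⁻¹ᵁ V ≤ U := hV.trans (Y.basicOpen_le _)
  let r : Γ(Y, U) →+* Γ(Y, M.ι ⁻¹ᵁ V) := (Y.presheaf.map (homOfLE hVU).op).hom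
  have hu : IsUnit (r (g + h)) := by
    have h₁ : IsUnit ((Y.presheaf.map (homOfLE (Y.basicOpen_le (g + h))).op).hom (g + h)) :=
      RingedSpace.isUnit_res_basicOpen Y.toRingedSpace (g + h)
    have h₂ := h₁.map (Y.presheaf.map (homOfLE hV).op).hom
    have h₃ := Y.presheaf.map_comp (homOfLE (Y.basicOpen_le (g + h))).op (homOfLE hV).op
    exact (congrArg (fun k ↦ IsUnit (k.hom (g + h))) h₃).mpr h₂
  obtain ⟨v, hv⟩ := hu
  let s : Γ(Y, M.ι ⁻¹ᵁ V) := r g * ↑v⁻¹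
  have hs : 1 - s = r h * ↑v⁻¹ := by
    rw [sub_eq_iff_eq_add, ← add_mul, ← map_add, add_comm, ← hv, Units.mul_inv]
  have hsg : Y.basicOpen s ≤ Y.basicOpen g := by
    rw [Scheme.basicOpen_mul]
    refine inf_le_left.trans ?_
    exact (Y.basicOpen_res g (homOfLE hVU).op).le.trans inf_le_right
  have hsh : Y.basicOpen (1 - s) ≤ Y.basicOpen h := by
    rw [hs, Scheme.basicOpen_mul]
    refine inf_le_left.trans ?_
    exact (Y.basicOpen_res h (homOfLE hVU).op).le.trans inf_le_right
  obtain ⟨N, W, hW, l, -, hxW, hl⟩ := exists_principal hf x hx ![1, s] ⟨0, rfl⟩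
  let r' : Γ(Y, M.ι ⁻¹ᵁ V) →+* Γ(Y, N.ι ⁻¹ᵁ W) := (Y.presheaf.map (homOfLE hW).op).hom
  have hr' (t) : Y.basicOpen (r' t) ≤ Y.basicOpen t :=
      (Y.basicOpen_res t (homOfLE hW).op).le.trans inf_le_right
  have hl' : (∃ a : Γ(N.obj, W), (N.ι.app W).hom a = r' s) ∨ IsUnit (r' s) := by
    fin_cases l
    · obtain ⟨a, ha⟩ := hl 1
      refine Or.inl ⟨a, ?_⟩
      have ha : (N.ι.app W).hom a * r' 1 = r' s := ha
      rwa [map_one, mul_one] at ha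
    · obtain ⟨a, ha⟩ := hl 0
      refine Or.inr ?_
      have ha : (N.ι.app W).hom a * r' s = r' 1 := ha
      rw [map_one] at ha
      exact .of_mul_eq_one_right _ ha
  rcases hl' with ⟨a, ha⟩ | hu
  · rcases IsLocalRing.isUnit_or_isUnit_one_sub_self
      ((N.obj.presheaf.germ W (x.1 N) hxW).hom a) with hu | hu
    · left
      refine ⟨N, N.obj.basicOpen a, (N.obj.mem_basicOpen _ _ hxW).mpr hu, ?_⟩
      rw [Scheme.preimage_basicOpen]
      exact (congrArg (Y.basicOpen ·) ha).le.trans ((hr' s).trans hsg)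
    · right
      rw [← map_one (N.obj.presheaf.germ W (x.1 N) hxW).hom, ← map_sub] at hu
      refine ⟨N, N.obj.basicOpen (1 - a), (N.obj.mem_basicOpen _ _ hxW).mpr hu, ?_⟩
      rw [Scheme.preimage_basicOpen]
      have ha' : (N.ι.app W).hom (1 - a) = r' (1 - s) := by
        rw [map_sub, map_sub, map_one, map_one, ha]
      exact (congrArg (Y.basicOpen ·) ha').le.trans ((hr' _).trans hsh)
  · left
    refine ⟨N, W, hxW, ?_⟩
    rw [← Scheme.basicOpen_of_isUnit _ hu]
    exact (hr' s).trans hsg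

variable (x) in
/-- The functions on a big open subset which are not invertible on any smaller big open subset. -/
def centerIdeal (hf : IsDecomposable f) [CompactSpace X] [QuasiSeparatedSpace X] (U : Y.Opens) :
    Ideal Γ(Y, U) where
  carrier := {g | ¬ x.IsBig (Y.basicOpen g)}
  zero_mem' h := by
    have := hf.quasiCompact
    exact h.not_bot (Y.basicOpen_zero U)
  add_mem' hg hh H := (IsBig.of_add hf _ _ H).elim hg hh
  smul_mem' c g hg H := hg (H.mono (by rw [smul_eq_mul, Scheme.basicOpen_mul]; exact inf_le_right))

lemma mem_centerIdeal (hf : IsDecomposable f) [CompactSpace X] [QuasiSeparatedSpace X] {U : Y.Opens}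
    (g : Γ(Y, U)) :
    g ∈ x.centerIdeal hf U ↔ ¬ x.IsBig (Y.basicOpen g) := Iff.rfl

lemma isPrime_centerIdeal (hf : IsDecomposable f) [CompactSpace X] [QuasiSeparatedSpace X]
    {U : Y.Opens}
    (hU : x.IsBig U) : (x.centerIdeal hf U).IsPrime := by
  have := hf.quasiCompact
  refine ⟨fun h ↦ ?_, fun {g h} hgh ↦ ?_⟩
  · rw [Ideal.eq_top_iff_one, mem_centerIdeal, Scheme.basicOpen_of_isUnit _ isUnit_one] at h
    exact h hU
  · by_contra! H
    rw [mem_centerIdeal, mem_centerIdeal, not_not, not_not] at H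
    rw [mem_centerIdeal, Scheme.basicOpen_mul] at hgh
    exact hgh (H.1.inf H.2)

/-- A point of `RZ_Y(X)` has a center on `Y`: a point whose open neighborhoods are precisely the
big open subsets. -/
lemma exists_center (hf : IsDecomposable f) [CompactSpace X] [QuasiSeparatedSpace X] (x : RZ f) :
    ∃ y : Y, ∀ O : Y.Opens, y ∈ O ↔ x.IsBig O := by
  have := hf.quasiCompact
  -- the point given by the prime ideal of an affine big open subset
  let pt {U : Y.Opens} (hU : IsAffineOpen U) (hb : x.IsBig U) : Y :=
    hU.fromSpec ⟨x.centerIdeal hf U, isPrime_centerIdeal hf hb⟩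
  have hpt {U : Y.Opens} (hU : IsAffineOpen U) (hb : x.IsBig U) : pt hU hb ∈ U := by
    have := Set.mem_range_self (f := hU.fromSpec) ⟨x.centerIdeal hf U, isPrime_centerIdeal hf hb⟩
    rwa [hU.range_fromSpec] at this
  have hpt' {U : Y.Opens} (hU : IsAffineOpen U) (hb : x.IsBig U) (t : Γ(Y, U)) :
      pt hU hb ∈ Y.basicOpen t ↔ x.IsBig (Y.basicOpen t) := by
    change (⟨_, isPrime_centerIdeal hf hb⟩ : Spec Γ(Y, U)) ∈ hU.fromSpec ⁻¹ᵁ Y.basicOpen t ↔ _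
    rw [hU.fromSpec_preimage_basicOpen]
    exact not_not
  have hcon {U U' : Y.Opens} (hU : IsAffineOpen U) (hb : x.IsBig U) (hU' : IsAffineOpen U')
      (hb' : x.IsBig U')
      (h : U' ≤ U) : pt hU' hb' = pt hU hb := by
    have e := IsAffineOpen.map_fromSpec hU hU' (homOfLE h).op
    have e' := congrArg (fun k ↦ k ⟨x.centerIdeal hf U', isPrime_centerIdeal hf hb'⟩) e
    refine e'.symm.trans ((Scheme.Hom.comp_apply _ _ _).trans (congrArg hU.fromSpec ?_))
    refine PrimeSpectrum.ext (Ideal.ext fun g ↦ ?_)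
    change (Y.presheaf.map (homOfLE h).op).hom g ∈ x.centerIdeal hf U' ↔ g ∈ x.centerIdeal hf U
    rw [mem_centerIdeal, mem_centerIdeal, not_iff_not, Scheme.basicOpen_res]
    exact ⟨fun H ↦ H.mono inf_le_right, fun H ↦ hb'.inf H⟩
  obtain ⟨U₀, -, hU₀, hb₀⟩ := (x.isBig_top hf).exists_isAffineOpen hf
  refine ⟨pt hU₀ hb₀, fun O ↦ ⟨fun hO ↦ ?_, fun hO ↦ ?_⟩⟩
  · obtain ⟨g, hg, hg'⟩ := hU₀.exists_basicOpen_le (V := O) ⟨_, hO⟩ (hpt hU₀ hb₀)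
    exact ((hpt' hU₀ hb₀ g).mp hg').mono hg
  · obtain ⟨U', hle, hU', hb'⟩ := (hO.inf hb₀).exists_isAffineOpen hf
    rw [← hcon hU₀ hb₀ hU' hb' (hle.trans inf_le_right)]
    exact hle.trans inf_le_left (hpt hU' hb')

end RZ

end

/-! ### The valuation ring of a point of `RZ_Y(X)` -/

section

variable {Y X : Scheme.{u}} {f : Y ⟶ X}

/-- Functoriality of specialization followed by the stalk map, with a prescribed name `m` for the
point `a n`. -/
lemma stalkCongr_comp_stalkMap {Z N M : Scheme.{u}} {g : Z ⟶ N} {a : N ⟶ M} {g' : Z ⟶ M}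
    (e : g ≫ a = g')
    {y : Z} {n : N} {m : M} (h : a n = m) (h₁ : g y ⤳ n) (h₂ : g' y ⤳ m) :
    ((M.presheaf.stalkCongr (.of_eq h.symm)).hom ≫ a.stalkMap n) ≫ N.presheaf.stalkSpecializes h₁ ≫
      g.stalkMap y =
      M.presheaf.stalkSpecializes h₂ ≫ g'.stalkMap y := by
  subst e h
  have e₀ : (M.presheaf.stalkCongr (.of_eq (Eq.refl (a n)))).hom = 𝟙 _ :=
    TopCat.Presheaf.stalkSpecializes_refl _ _
  rw [e₀, Category.id_comp, Scheme.Hom.stalkMap_comp, ← Scheme.Hom.stalkSpecializes_stalkMap_assoc]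
  rfl

namespace RZ

variable {x : RZ f}

/-- The transition homomorphism of the local rings at the projections of `x`. -/
def transition (x : RZ f) {N M : Modification f} (a : N.Dom M) :
    M.obj.presheaf.stalk (x.1 M) ⟶ N.obj.presheaf.stalk (x.1 N) :=
  (M.obj.presheaf.stalkCongr (.of_eq (x.2 N M a).symm)).hom ≫ a.hom.stalkMap (x.1 N)

lemma germ_transition {N M : Modification f} (a : N.Dom M) (V : M.obj.Opens) (h : x.1 M ∈ V)
    (h' : x.1 N ∈ a.hom ⁻¹ᵁ V) :
    M.obj.presheaf.germ V (x.1 M) h ≫ x.transition a =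
      a.hom.app V ≫ N.obj.presheaf.germ (a.hom ⁻¹ᵁ V) (x.1 N) h' := by
  rw [transition, TopCat.Presheaf.stalkCongr_hom]
  exact (TopCat.Presheaf.germ_stalkSpecializes_assoc _ _ _ _).trans
    (Scheme.Hom.germ_stalkMap _ _ _ _)

lemma isLocalHom_transition {N M : Modification f} (a : N.Dom M) :
    IsLocalHom (x.transition a).hom := by
  have h₁ : IsLocalHom (M.obj.presheaf.stalkCongr (.of_eq (x.2 N M a).symm)).hom.hom :=
    isLocalHom_of_isIso _
  have h₂ : IsLocalHom (a.hom.stalkMap (x.1 N)).hom := inferInstance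
  exact RingHom.isLocalHom_comp _ _

/-- The homomorphism from the local ring of a modification at the projection of `x` to the local
ring of `Y` at a generization. -/
def toStalk {y : Y} {M : Modification f} (h : M.ι y ⤳ x.1 M) :
    M.obj.presheaf.stalk (x.1 M) ⟶ Y.presheaf.stalk y :=
  M.obj.presheaf.stalkSpecializes h ≫ M.ι.stalkMap y

lemma germ_toStalk {y : Y} {M : Modification f} (h : M.ι y ⤳ x.1 M) (V : M.obj.Opens)
    (hV : x.1 M ∈ V)
    (hV' : y ∈ M.ι ⁻¹ᵁ V) :
    M.obj.presheaf.germ V (x.1 M) hV ≫ toStalk h =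
      M.ι.app V ≫ Y.presheaf.germ (M.ι ⁻¹ᵁ V) y hV' := by
  rw [toStalk, TopCat.Presheaf.germ_stalkSpecializes_assoc, Scheme.Hom.germ_stalkMap]

lemma transition_toStalk {y : Y} {N M : Modification f} (a : N.Dom M) (h : M.ι y ⤳ x.1 M)
    (h' : N.ι y ⤳ x.1 N) :
    x.transition a ≫ toStalk h' = toStalk h :=
  stalkCongr_comp_stalkMap a.ι_hom (x.2 N M a) h' h

section Center

variable {y : Y} (hy : ∀ O : Y.Opens, y ∈ O ↔ x.IsBig O)

include hy in
lemma specializes_of_center (M : Modification f) : M.ι y ⤳ x.1 M := by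
  rw [specializes_iff_forall_open]
  intro V hV hx
  exact (hy (M.ι ⁻¹ᵁ ⟨V, hV⟩)).mpr (isBig_preimage hx)

/-- The homomorphism from the local ring of a modification at the projection of `x` to the local
ring of `Y` at the center of `x`. -/
def toCenter (M : Modification f) : M.obj.presheaf.stalk (x.1 M) ⟶ Y.presheaf.stalk y :=
  toStalk (specializes_of_center hy M)

lemma toCenter_transition {N M : Modification f} (a : N.Dom M) (α : M.obj.presheaf.stalk (x.1 M)) :
    (toCenter hy N).hom ((x.transition a).hom α) = (toCenter hy M).hom α :=
  congrArg (fun k ↦ k.hom α)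
    (transition_toStalk a (specializes_of_center hy M) (specializes_of_center hy N))

variable [QuasiCompact f]

/-- An element of a local ring that vanishes on `Y` vanishes on a bigger modification. -/
lemma exists_transition_eq_zero {M : Modification f} (α : M.obj.presheaf.stalk (x.1 M))
    (h : (toCenter hy M).hom α = 0) : ∃ (N : Modification f) (a : N.Dom M),
      (x.transition a).hom α = 0 := by
  obtain ⟨V, hV, s, rfl⟩ := TopCat.Presheaf.exists_germ_eq _ α
  have hyV : y ∈ M.ι ⁻¹ᵁ V := (hy _).mpr (isBig_preimage hV)
  have h₀ : (Y.presheaf.germ (M.ι ⁻¹ᵁ V) y hyV).hom ((M.ι.app V).hom s) =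
      (Y.presheaf.germ (M.ι ⁻¹ᵁ V) y hyV).hom 0 := by
    rw [map_zero, ← h]
    exact (congrArg (fun k ↦ k.hom s) (germ_toStalk (specializes_of_center hy M) V hV hyV)).symm
  obtain ⟨O, hyO, i, j, e⟩ := TopCat.Presheaf.germ_eq Y.presheaf y hyV hyV _ _ h₀
  obtain ⟨M', V', hx', hV'⟩ := (hy O).mp hyO
  obtain ⟨N, a, a', W, hxW, h₁, h₂⟩ := exists_common hV hx'
  refine ⟨N, a, ?_⟩
  have := N.quasiCompact_ι
  have hWO : N.ι ⁻¹ᵁ W ≤ O := (a'.preimage_le h₂).trans hV'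
  have hs : (a.hom.appLE V W h₁).hom s = 0 := by
    have hinj : Function.Injective (N.ι.app W).hom := N.ι.app_injective W
    apply hinj
    rw [map_zero]
    have e₁ : N.ι.app W = N.ι.appLE W (N.ι ⁻¹ᵁ W) le_rfl := (Scheme.Hom.appLE_eq_app _).symm
    have e₂ : a.hom.appLE V W h₁ ≫ N.ι.app W = M.ι.appLE V (N.ι ⁻¹ᵁ W) (a.preimage_le h₁) := by
      rw [e₁, Scheme.Hom.appLE_comp_appLE]
      simp only [a.ι_hom]
    have e₃ : M.ι.appLE V (N.ι ⁻¹ᵁ W) (a.preimage_le h₁) = M.ι.app V ≫ Y.presheaf.map i.op ≫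
        Y.presheaf.map (homOfLE hWO).op := by
      rw [← Y.presheaf.map_comp]; rfl
    refine (congrArg (fun k ↦ k.hom s) (e₂.trans e₃)).trans ?_
    change (Y.presheaf.map (homOfLE hWO).op).hom ((Y.presheaf.map i.op).hom ((M.ι.app V).hom s)) = 0
    refine (congrArg _ e).trans ?_
    simp
  have hxV : x.1 N ∈ a.hom ⁻¹ᵁ V := h₁ hxW
  refine (congrArg (fun k ↦ k.hom s) (germ_transition a V hV hxV)).trans ?_
  rw [← N.obj.presheaf.germ_res (homOfLE h₁) (x.1 N) hxW, ← Category.assoc]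
  exact (congrArg (N.obj.presheaf.germ W (x.1 N) hxW).hom hs).trans
    (map_zero (N.obj.presheaf.germ W (x.1 N) hxW).hom)

/-- The elements of the local ring of `Y` at the center of `x` that come from local rings of
modifications. -/
def regular : Subring (Y.presheaf.stalk y) where
  carrier := {b | ∃ (M : Modification f) (α : M.obj.presheaf.stalk (x.1 M)),
    (toCenter hy M).hom α = b}
  mul_mem' := by
    rintro _ _ ⟨M, α, rfl⟩ ⟨N, β, rfl⟩
    refine ⟨M.join N,
      (x.transition (M.joinLeft N)).hom α * (x.transition (M.joinRight N)).hom β, ?_⟩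
    rw [map_mul, toCenter_transition, toCenter_transition]
  add_mem' := by
    rintro _ _ ⟨M, α, rfl⟩ ⟨N, β, rfl⟩
    refine ⟨M.join N,
      (x.transition (M.joinLeft N)).hom α + (x.transition (M.joinRight N)).hom β, ?_⟩
    rw [map_add, toCenter_transition, toCenter_transition]
  one_mem' := by
    obtain ⟨M, -⟩ := (hy ⊤).mp trivial
    exact ⟨M, 1, map_one _⟩
  zero_mem' := by
    obtain ⟨M, -⟩ := (hy ⊤).mp trivial
    exact ⟨M, 0, map_zero _⟩
  neg_mem' := by
    rintro _ ⟨M, α, rfl⟩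
    exact ⟨M, -α, map_neg _ _⟩

omit [QuasiCompact f] in
lemma germ_app_eq_toCenter (M : Modification f) (V : M.obj.Opens) (hV : x.1 M ∈ V)
    (hV' : y ∈ M.ι ⁻¹ᵁ V) (s : Γ(M.obj, V)) :
    (toCenter hy M).hom ((M.obj.presheaf.germ V (x.1 M) hV).hom s) =
      (Y.presheaf.germ (M.ι ⁻¹ᵁ V) y hV').hom ((M.ι.app V).hom s) :=
  congrArg (fun k ↦ k.hom s) (germ_toStalk (specializes_of_center hy M) V hV hV')

/-- Every element of the local ring at the center, or its inverse, comes from a modification: near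
the projection of `x` to some modification `1` and `b` are both multiples of `b` or both multiples
of `1`. -/
lemma regular_dichotomy (hf : IsDecomposable f) [CompactSpace X] [QuasiSeparatedSpace X]
    (b : Y.presheaf.stalk y) :
    b ∈ regular hy ∨ ∃ a ∈ regular hy, a * b = 1 := by
  obtain ⟨O, hyO, g, rfl⟩ := TopCat.Presheaf.exists_germ_eq _ b
  obtain ⟨M, V, hx, hV⟩ := (hy O).mp hyO
  let g' : Γ(Y, M.ι ⁻¹ᵁ V) := (Y.presheaf.map (homOfLE hV).op).hom g
  obtain ⟨N, W, hW, l, -, hxW, hl⟩ := exists_principal hf x hx ![1, g'] ⟨0, rfl⟩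
  have hyW : y ∈ N.ι ⁻¹ᵁ W := (hy _).mpr (isBig_preimage hxW)
  let r' : Γ(Y, M.ι ⁻¹ᵁ V) →+* Γ(Y, N.ι ⁻¹ᵁ W) := (Y.presheaf.map (homOfLE hW).op).hom
  have hg : (Y.presheaf.germ (N.ι ⁻¹ᵁ W) y hyW).hom (r' g') = (Y.presheaf.germ O y hyO).hom g :=
    (TopCat.Presheaf.germ_res_apply Y.presheaf (homOfLE hW) y hyW g').trans
      (TopCat.Presheaf.germ_res_apply Y.presheaf (homOfLE hV) y (hW hyW) g)
  change (Y.presheaf.germ O y hyO).hom g ∈ _ ∨ ∃ a ∈ _, a * (Y.presheaf.germ O y hyO).hom g = _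
  rw [← hg]
  fin_cases l
  · obtain ⟨a, ha⟩ := hl 1
    have ha : (N.ι.app W).hom a * r' 1 = r' g' := ha
    rw [map_one, mul_one] at ha
    refine Or.inl ⟨N, (N.obj.presheaf.germ W _ hxW).hom a, ?_⟩
    rw [germ_app_eq_toCenter hy N W hxW hyW, ha]
  · obtain ⟨a, ha⟩ := hl 0
    have ha : (N.ι.app W).hom a * r' g' = r' 1 := ha
    refine Or.inr ⟨_, ⟨N, (N.obj.presheaf.germ W _ hxW).hom a, rfl⟩, ?_⟩
    rw [germ_app_eq_toCenter hy N W hxW hyW, ← map_mul, ha, map_one, map_one]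

variable (hf : IsDecomposable f) [CompactSpace X] [QuasiSeparatedSpace X]

include hf in
lemma maximalIdeal_le_regular {b : Y.presheaf.stalk y}
    (hb : b ∈ maximalIdeal (Y.presheaf.stalk y)) :
    b ∈ regular hy := by
  refine (regular_dichotomy hy hf b).resolve_right ?_
  rintro ⟨a, -, h⟩
  exact hb (.of_mul_eq_one_right _ h)

include hf in
/-- An element `α` with value `1` in the residue field is `1 + μ` on a bigger modification, with
`μ` from the maximal ideal at the center. As `μ` is not invertible on `Y`, it is not so in the
local ring of the modification. -/
lemma isUnit_of_residue_eq_one {M : Modification f} (α : M.obj.presheaf.stalk (x.1 M))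
    (h : (Y.residue y).hom ((toCenter hy M).hom α) = 1) : IsUnit α := by
  have h₁ : (toCenter hy M).hom α - 1 ∈ maximalIdeal (Y.presheaf.stalk y) := by
    rw [← residue_eq_zero_iff, map_sub, map_one]
    exact sub_eq_zero.mpr h
  obtain ⟨N, μ, hμ⟩ := maximalIdeal_le_regular hy hf h₁
  have h₂ : (toCenter hy (M.join N)).hom ((x.transition (M.joinLeft N)).hom α - 1 -
      (x.transition (M.joinRight N)).hom μ) = 0 := by
    rw [map_sub, map_sub, toCenter_transition, toCenter_transition, hμ, map_one, sub_self]
  obtain ⟨P, a, ha⟩ := exists_transition_eq_zero hy _ h₂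
  have := isLocalHom_transition (x := x) a
  have := isLocalHom_transition (x := x) (M.joinLeft N)
  apply isUnit_of_map_unit (x.transition (M.joinLeft N)).hom
  apply isUnit_of_map_unit (x.transition a).hom
  rw [map_sub, map_sub, map_one, sub_sub, sub_eq_zero] at ha
  rw [ha]
  -- the element `μ` is not invertible since its image on `Y` is not
  by_contra hu
  have hm : IsUnit ((x.transition a).hom ((x.transition (M.joinRight N)).hom μ)) := by
    by_contra hm
    have h₃ := add_mem (show _ ∈ maximalIdeal _ from hu) (neg_mem (show _ ∈ maximalIdeal _ from hm))
    rw [add_neg_cancel_right] at h₃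
    exact h₃ isUnit_one
  have h₄ := hm.map (toCenter hy P).hom
  rw [toCenter_transition, toCenter_transition, hμ] at h₄
  exact h₁ h₄

/-- The valuation ring of `κ(y)` defined by `x`, where `y` is the center of `x`: the image of the
regular elements. -/
def valuationSubring : ValuationSubring (Y.residueField y) where
  toSubring := (regular hy).map (Y.residue y).hom
  mem_or_inv_mem' := by
    intro r
    obtain ⟨b, rfl⟩ := IsLocalRing.residue_surjective r
    rcases regular_dichotomy hy hf b with h | ⟨a, ha, hab⟩
    · exact Or.inl ⟨b, h, rfl⟩
    · refine Or.inr ⟨a, ha, ?_⟩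
      apply eq_inv_of_mul_eq_one_left
      exact (map_mul _ _ _).symm.trans ((congrArg _ hab).trans (map_one _))

/-- The regular elements are the preimage of the valuation ring, as they contain the maximal
ideal. -/
lemma residue_mem_valuationSubring (b : Y.presheaf.stalk y) :
    (Y.residue y).hom b ∈ valuationSubring hy hf ↔ b ∈ regular hy := by
  refine ⟨?_, fun h ↦ ⟨b, h, rfl⟩⟩
  rintro ⟨a, ha, e⟩
  have : b - a ∈ maximalIdeal (Y.presheaf.stalk y) := by
    rw [← residue_eq_zero_iff, map_sub]
    exact sub_eq_zero.mpr e.symm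
  have := add_mem (maximalIdeal_le_regular hy hf this) ha
  rwa [sub_add_cancel] at this

/-- The homomorphism from the local ring of a modification to the valuation ring. -/
def toValuationSubring (M : Modification f) : M.obj.presheaf.stalk (x.1 M) →+*
    valuationSubring hy hf :=
  ((Y.residue y).hom.comp (toCenter hy M).hom).codRestrict (valuationSubring hy hf)
    fun α ↦ (residue_mem_valuationSubring hy hf _).mpr ⟨M, α, rfl⟩

/-- The valuation ring dominates the local rings of all modifications at the projections of `x`. -/
lemma isLocalHom_toValuationSubring (M : Modification f) :
    IsLocalHom (toValuationSubring hy hf M) := by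
  refine ⟨fun α hα ↦ ?_⟩
  obtain ⟨⟨r, hr⟩, hr'⟩ := hα.exists_right_inv
  obtain ⟨_, ⟨N, β, rfl⟩, rfl⟩ := hr
  have h : (Y.residue y).hom ((toCenter hy (M.join N)).hom
      ((x.transition (M.joinLeft N)).hom α * (x.transition (M.joinRight N)).hom β)) = 1 := by
    rw [map_mul, toCenter_transition, toCenter_transition, map_mul]
    exact congrArg Subtype.val hr'
  have := isLocalHom_transition (x := x) (M.joinLeft N)
  apply isUnit_of_map_unit (x.transition (M.joinLeft N)).hom
  exact isUnit_of_mul_isUnit_left (isUnit_of_residue_eq_one hy hf _ h)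

end Center

end RZ

end

/-! ### The section of `ψ` -/

section

variable {Y X : Scheme.{u}} {f : Y ⟶ X}

/-- A closed immersion to the fibre product over `N` is one to the fibre product over `X`, for `N`
separated over `X`. -/
lemma isClosedImmersion_pullback_lift {A B N X A' : Scheme.{u}} (φ : A ⟶ N) (i : B ⟶ N) (c : N ⟶ X)
    [IsSeparated c]
    {φ' : A ⟶ X} {f : B ⟶ X} (e : φ ≫ c = φ') (e' : i ≫ c = f) (q : A' ⟶ A) (r : A' ⟶ B)
      (h : q ≫ φ = r ≫ i)
    [IsClosedImmersion (pullback.lift q r h)] (h' : q ≫ φ' = r ≫ f) :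
    IsClosedImmersion (pullback.lift (f := φ') (g := f) q r h') := by
  subst e e'
  have : pullback.lift (f := φ ≫ c) (g := i ≫ c) q r h' = pullback.lift q r h ≫
      pullback.mapDesc φ i c := by
    refine pullback.hom_ext ((pullback.lift_fst _ _ _).trans ?_)
      ((pullback.lift_snd _ _ _).trans ?_)
    · refine Eq.symm ((Category.assoc _ _ _).trans ?_)
      exact (congrArg (pullback.lift q r h ≫ ·)
        ((pullback.lift_fst _ _ _).trans (Category.comp_id _))).trans
        (pullback.lift_fst _ _ _)
    · refine Eq.symm ((Category.assoc _ _ _).trans ?_)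
      exact (congrArg (pullback.lift q r h ≫ ·)
        ((pullback.lift_snd _ _ _).trans (Category.comp_id _))).trans
        (pullback.lift_snd _ _ _)
  rw [this]
  infer_instance

lemma pull_fromSpecStalk {y : Y} {O : Y.Opens} (hy : y ∈ O) (h : ⊤ ≤ Y.fromSpecStalk y ⁻¹ᵁ O)
    (g : Γ(Y, O)) :
    pull (Y.fromSpecStalk y) O h g =
      (Scheme.ΓSpecIso _).inv.hom ((Y.presheaf.germ O y hy).hom g) := by
  have e : (Y.fromSpecStalk y).appLE O ⊤ h = Y.presheaf.germ O y hy ≫ (Scheme.ΓSpecIso _).inv := by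
    rw [Scheme.Hom.appLE, Scheme.fromSpecStalk_app hy, Category.assoc, Category.assoc,
      ← Functor.map_comp]
    refine congrArg (Y.presheaf.germ O y hy ≫ ·) ?_
    refine (congrArg ((Scheme.ΓSpecIso _).inv ≫ ·) (CategoryTheory.Functor.map_id _ _)).trans ?_
    exact Category.comp_id _
  exact congrArg (fun k ↦ k.hom g) e

lemma pull_fromSpecResidueField {y : Y} {O : Y.Opens} (hy : y ∈ O)
    (h : ⊤ ≤ Y.fromSpecResidueField y ⁻¹ᵁ O)
    (g : Γ(Y, O)) : pull (Y.fromSpecResidueField y) O h g =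
      (Scheme.ΓSpecIso _).inv.hom ((Y.residue y).hom ((Y.presheaf.germ O y hy).hom g)) := by
  have h' : ⊤ ≤ Y.fromSpecStalk y ⁻¹ᵁ O := by
    intro z _
    have : Y.fromSpecStalk y z ⤳ y := by
      have hz : Y.fromSpecStalk y z ∈ Set.range (Y.fromSpecStalk y) := ⟨z, rfl⟩
      rwa [Scheme.range_fromSpecStalk] at hz
    exact this.mem_open O.2 hy
  refine (pull_comp (Spec.map (Y.residue y)) (Y.fromSpecStalk y) O h' h g).trans ?_
  rw [pull_fromSpecStalk hy h']
  exact (congrArg (fun k ↦ k.hom ((Y.presheaf.germ O y hy).hom g))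
    (Scheme.ΓSpecIso_inv_naturality (Y.residue y))).symm

namespace RZ

variable {x : RZ f} {y : Y} (hy : ∀ O : Y.Opens, y ∈ O ↔ x.IsBig O) [QuasiCompact f]
  (hf : IsDecomposable f) [CompactSpace X] [QuasiSeparatedSpace X]

/-- The morphism from the spectrum of the valuation ring of `x` to a modification. -/
def specTo (M : Modification f) : Spec (CommRingCat.of (valuationSubring hy hf)) ⟶ M.obj :=
  Spec.map (CommRingCat.ofHom (toValuationSubring hy hf M)) ≫ M.obj.fromSpecStalk (x.1 M)

lemma specTo_hom {N M : Modification f} (a : N.Dom M) :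
    specTo hy hf N ≫ a.hom = specTo hy hf M := by
  have e₁ : CommRingCat.ofHom (toValuationSubring hy hf M) =
      x.transition a ≫ CommRingCat.ofHom (toValuationSubring hy hf N) := by
    ext α
    exact congrArg (Y.residue y).hom (toCenter_transition hy a α).symm
  have e₂ : Spec.map (x.transition a) ≫ M.obj.fromSpecStalk (x.1 M) =
      N.obj.fromSpecStalk (x.1 N) ≫ a.hom := by
    rw [transition, Spec.map_comp, Category.assoc, TopCat.Presheaf.stalkCongr_hom]
    refine (congrArg (Spec.map (a.hom.stalkMap (x.1 N)) ≫ ·)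
      (Scheme.SpecMap_stalkSpecializes_fromSpecStalk _)).trans ?_
    exact Scheme.SpecMap_stalkMap_fromSpecStalk a.hom
  refine (Category.assoc _ _ _).trans ((congrArg (Spec.map _ ≫ ·) e₂.symm).trans ?_)
  refine (Category.assoc _ _ _).symm.trans (congrArg (· ≫ M.obj.fromSpecStalk (x.1 M)) ?_)
  exact (Spec.map_comp _ _).symm.trans (congrArg Spec.map e₁.symm)

lemma specIncl_specTo (M : Modification f) :
    specIncl (valuationSubring hy hf) ≫ specTo hy hf M = Y.fromSpecResidueField y ≫ M.ι := by
  have e₁ : CommRingCat.ofHom (toValuationSubring hy hf M) ≫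
      CommRingCat.ofHom (valuationSubring hy hf).subtype =
      toCenter hy M ≫ Y.residue y := rfl
  have e₂ : Spec.map (toCenter hy M) ≫ M.obj.fromSpecStalk (x.1 M) = Y.fromSpecStalk y ≫ M.ι := by
    rw [toCenter, toStalk, Spec.map_comp, Category.assoc,
      Scheme.SpecMap_stalkSpecializes_fromSpecStalk,
      Scheme.SpecMap_stalkMap_fromSpecStalk]
  refine (Category.assoc _ _ _).symm.trans ?_
  refine (congrArg (· ≫ M.obj.fromSpecStalk (x.1 M)) ((Spec.map_comp _ _).symm.trans
    ((congrArg Spec.map e₁).trans (Spec.map_comp _ _)))).trans ?_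
  rw [Category.assoc, e₂, Scheme.fromSpecResidueField, Category.assoc]

lemma specTo_closedPoint (M : Modification f) :
    specTo hy hf M (closedPoint (valuationSubring hy hf)) = x.1 M := by
  have := isLocalHom_toValuationSubring hy hf M
  refine (Scheme.Hom.comp_apply _ _ _).trans ?_
  refine (congrArg (M.obj.fromSpecStalk (x.1 M))
    (IsLocalRing.comap_closedPoint (toValuationSubring hy hf M))).trans ?_
  exact Scheme.fromSpecStalk_closedPoint

lemma specTo_π (M N : Modification f) : specTo hy hf M ≫ M.π = specTo hy hf N ≫ N.π := by
  rw [← specTo_hom hy hf (M.joinLeft N), ← specTo_hom hy hf (M.joinRight N), Category.assoc,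
    Category.assoc,
    (M.joinLeft N).hom_π, (M.joinRight N).hom_π]

lemma top_le_preimage_specTo (M : Modification f) {V : M.obj.Opens} (h : x.1 M ∈ V) :
    ⊤ ≤ specTo hy hf M ⁻¹ᵁ V := by
  intro z _
  have := ((IsLocalRing.specializes_closedPoint z).map (specTo hy hf M).continuous)
  refine this.mem_open V.2 ?_
  have e := specTo_closedPoint hy hf M
  exact e ▸ h

/-- The morphism `Spec κ(y) ⟶ Spec R ×[M] Y` is a closed immersion of affine schemes: a function
on a neighborhood `O` of `y` is one on the preimage of an open subset of a bigger modification
`N`, hence on `Spec R ×[N] Y`, which is a closed subscheme of `Spec R ×[M] Y`. -/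
lemma isClosedImmersion_lift (M : Modification f) [IsAffineHom M.ι] :
    IsClosedImmersion (pullback.lift _ _ (specIncl_specTo hy hf M)) := by
  have (N : Modification f) [IsAffineHom N.ι] : IsAffine (pullback (specTo hy hf N) N.ι) :=
    isAffine_of_isAffineHom (pullback.fst _ _)
  refine IsClosedImmersion.of_surjective_of_isAffine _ fun r ↦ ?_
  obtain ⟨r, rfl⟩ := (ConcreteCategory.bijective_of_isIso
      (Scheme.ΓSpecIso (Y.residueField y)).inv).2 r
  obtain ⟨b, rfl⟩ := Scheme.residue_surjective Y y r
  obtain ⟨O, hyO, g, rfl⟩ := TopCat.Presheaf.exists_germ_eq _ b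
  obtain ⟨M', V', hx', hV'⟩ := (hy O).mp hyO
  let N := M.join M'
  let a : N.Dom M := M.joinLeft M'
  let a' : N.Dom M' := M.joinRight M'
  have := a.isAffineHom
  have hxN : x.1 N ∈ a'.hom ⁻¹ᵁ V' := by
    change a'.hom _ ∈ V'
    rwa [x.2]
  have hle : N.ι ⁻¹ᵁ a'.hom ⁻¹ᵁ V' ≤ O := (a'.preimage_le le_rfl).trans hV'
  -- `Spec R ×[N] Y` maps to `O`, so that `g` becomes a function on it
  have hP : ⊤ ≤ pullback.snd (specTo hy hf N) N.ι ⁻¹ᵁ O := by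
    refine le_trans ?_ (Scheme.Hom.preimage_mono _ hle)
    rw [← Scheme.Hom.comp_preimage, ← pullback.condition, Scheme.Hom.comp_preimage]
    exact fun z _ ↦ top_le_preimage_specTo hy hf N hxN trivial
  let j : pullback (specTo hy hf N) N.ι ⟶ pullback (specTo hy hf M) M.ι :=
    pullback.lift (pullback.fst _ _) (pullback.snd _ _) (by
      rw [← specTo_hom hy hf a, ← a.ι_hom, pullback.condition_assoc])
  have hj : IsClosedImmersion j := by
    have : IsSeparated (a.hom ≫ M.π) := by rw [a.hom_π]; infer_instance
    have : IsSeparated a.hom := .of_comp a.hom M.π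
    have : IsClosedImmersion (pullback.lift (pullback.fst (specTo hy hf N) N.ι)
        (pullback.snd (specTo hy hf N) N.ι) pullback.condition) := by
      have e : pullback.lift (pullback.fst (specTo hy hf N) N.ι)
        (pullback.snd (specTo hy hf N) N.ι) pullback.condition = 𝟙 _ := by
        apply pullback.hom_ext <;> simp
      rw [e]; infer_instance
    exact isClosedImmersion_pullback_lift (specTo hy hf N) N.ι a.hom (specTo_hom hy hf a)
      a.ι_hom _ _
      pullback.condition _
  have hq : pullback.lift _ _ (specIncl_specTo hy hf M) =
      pullback.lift _ _ (specIncl_specTo hy hf N) ≫ j := by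
    refine pullback.hom_ext ((pullback.lift_fst _ _ _).trans ?_)
      ((pullback.lift_snd _ _ _).trans ?_)
    · refine Eq.symm ((Category.assoc _ _ _).trans ?_)
      exact (congrArg (_ ≫ ·) (pullback.lift_fst _ _ _)).trans (pullback.lift_fst _ _ _)
    · refine Eq.symm ((Category.assoc _ _ _).trans ?_)
      exact (congrArg (_ ≫ ·) (pullback.lift_snd _ _ _)).trans (pullback.lift_snd _ _ _)
  obtain ⟨s, hs⟩ := (IsClosedImmersion.isAffine_surjective_of_isAffine j).2
    (pull (pullback.snd (specTo hy hf N) N.ι) O hP g)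
  refine ⟨s, ?_⟩
  have h₁ : pullback.lift _ _ (specIncl_specTo hy hf N) ≫ pullback.snd (specTo hy hf N) N.ι =
      Y.fromSpecResidueField y := pullback.lift_snd _ _ _
  have h₂ : ⊤ ≤ Y.fromSpecResidueField y ⁻¹ᵁ O := by
    rw [← h₁]; exact fun z _ ↦ hP trivial
  rw [hq, Scheme.Hom.comp_appTop]
  refine (congrArg (pullback.lift _ _ (specIncl_specTo hy hf N)).appTop.hom hs).trans ?_
  rw [← pull_comp _ _ _ _ (by rw [h₁]; exact h₂), pull_congr h₁ _ _ h₂]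
  exact pull_fromSpecResidueField hyO h₂ g

/-- The point of `Val_Y(X)` defined by a point of `RZ_Y(X)`. The morphism `Spec R ⟶ X` does not
depend on the modification `M`, by `specTo_π`. -/
def toVal (M : Modification f) [IsAffineHom M.ι] : Val f where
  y := y
  R := valuationSubring hy hf
  φ := specTo hy hf M ≫ M.π
  comm := by rw [← Category.assoc, specIncl_specTo, Category.assoc, M.fac]
  closed := by
    have := isClosedImmersion_lift hy hf M
    exact isClosedImmersion_pullback_lift (specTo hy hf M)
      M.ι M.π rfl M.fac _ _ (specIncl_specTo hy hf M) _

lemma lift_toVal (M N : Modification f) [IsAffineHom M.ι] :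
    (toVal hy hf M).lift N = specTo hy hf N :=
  ((toVal hy hf M).existsUnique_lift N).unique ⟨Val.lift_π _ _, Val.specIncl_lift _ _⟩
    ⟨specTo_π hy hf N M, specIncl_specTo hy hf N⟩

lemma psi_toVal (M : Modification f) [IsAffineHom M.ι] : (toVal hy hf M).psi = x := by
  refine Subtype.ext (funext fun N ↦ ?_)
  change (toVal hy hf M).lift N (closedPoint (valuationSubring hy hf)) = x.1 N
  rw [lift_toVal]
  exact specTo_closedPoint hy hf N

end RZ

end

/-! ### The stalks of the structure sheaf -/

section

variable {Y X : Scheme.{u}} {f : Y ⟶ X}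

/-- The sections over `U` of the presheaf colimit given by the sections of a chart `(M, V)` such
that `U ⊆ π_M⁻¹ V`. -/
def chartSec (c : Chart f) (U : Opens (TopCat.of (RZ f))) (h : U ≤ RZ.preimage c.M c.V) :
    (chartSections f ⋙ uliftRing).obj c ⟶ (preStructureSheaf f).obj (op U) :=
  ((chartOpen f).leftKanExtensionUnit (chartSections f ⋙ uliftRing)).app c ≫
    (preStructureSheaf f).map (homOfLE h : U ⟶ RZ.preimage c.M c.V).op

lemma chartSec_map (c : Chart f) {U W : Opens (TopCat.of (RZ f))} (i : W ⟶ U)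
    (h : U ≤ RZ.preimage c.M c.V)
    (h' : W ≤ RZ.preimage c.M c.V) :
    chartSec c U h ≫ (preStructureSheaf f).map i.op = chartSec c W h' := by
  refine (Category.assoc _ _ _).trans ?_
  exact congrArg (_ ≫ ·) ((preStructureSheaf f).map_comp _ _).symm

lemma map_chartSec {c d : Chart f} (a : c ⟶ d) (U : Opens (TopCat.of (RZ f)))
    (h : U ≤ RZ.preimage c.M c.V)
    (h' : U ≤ RZ.preimage d.M d.V) :
    (chartSections f ⋙ uliftRing).map a ≫ chartSec d U h' = chartSec c U h := by
  have := ((chartOpen f).leftKanExtensionUnit (chartSections f ⋙ uliftRing)).naturality a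
  refine (Category.assoc _ _ _).symm.trans ((congrArg (· ≫ _) this).trans ?_)
  refine (Category.assoc _ _ _).trans ?_
  exact congrArg (_ ≫ ·) ((preStructureSheaf f).map_comp _ _).symm

lemma Chart.exists_common [QuasiCompact f] (c d : Chart f) :
    ∃ (e : Chart f) (_ : c ⟶ e) (_ : d ⟶ e),
      RZ.preimage c.M c.V ⊓ RZ.preimage d.M d.V ≤ RZ.preimage e.M e.V := by
  refine ⟨⟨c.M.join d.M, (c.M.joinLeft d.M).hom ⁻¹ᵁ c.V ⊓ (c.M.joinRight d.M).hom ⁻¹ᵁ d.V⟩,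
    ⟨c.M.joinLeft d.M, inf_le_left⟩, ⟨c.M.joinRight d.M, inf_le_right⟩, fun x hx ↦ ⟨?_, ?_⟩⟩
  · change (c.M.joinLeft d.M).hom (x.1 _) ∈ c.V
    rw [x.2]
    exact hx.1
  · change (c.M.joinRight d.M).hom (x.1 _) ∈ d.V
    rw [x.2]
    exact hx.2

/-- The sections of the presheaf colimit that come from a single chart. -/
def chartSubring (hf : IsDecomposable f) (U : Opens (TopCat.of (RZ f))) :
    Subring ((preStructureSheaf f).obj (op U)) :=
  have := hf.quasiCompact
  have key (c d : Chart f) (hc : U ≤ RZ.preimage c.M c.V) (hd : U ≤ RZ.preimage d.M d.V) (s t) :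
      ∃ (e : Chart f) (he : U ≤ RZ.preimage e.M e.V) (s' t' : _),
        (chartSec c U hc).hom s = (chartSec e U he).hom s' ∧
        (chartSec d U hd).hom t = (chartSec e U he).hom t' := by
    obtain ⟨e, a, b, he⟩ := c.exists_common d
    have he' := (le_inf hc hd).trans he
    exact ⟨e, he', _, _, congrArg (fun k ↦ k.hom s) (map_chartSec a U hc he').symm,
      congrArg (fun k ↦ k.hom t) (map_chartSec b U hd he').symm⟩
  { carrier := {s | ∃ (c : Chart f) (h : U ≤ RZ.preimage c.M c.V) (a : _),
      (chartSec c U h).hom a = s}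
    mul_mem' := by
      rintro _ _ ⟨c, hc, s, rfl⟩ ⟨d, hd, t, rfl⟩
      obtain ⟨e, he, s', t', h₁, h₂⟩ := key c d hc hd s t
      exact ⟨e, he, s' * t', by rw [map_mul, h₁, h₂]⟩
    add_mem' := by
      rintro _ _ ⟨c, hc, s, rfl⟩ ⟨d, hd, t, rfl⟩
      obtain ⟨e, he, s', t', h₁, h₂⟩ := key c d hc hd s t
      exact ⟨e, he, s' + t', by rw [map_add, h₁, h₂]⟩
    one_mem' := ⟨⟨(Modification.exists_isAffineHom hf).choose, ⊤⟩, fun _ _ ↦ trivial, 1, map_one _⟩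
    zero_mem' := ⟨⟨(Modification.exists_isAffineHom hf).choose, ⊤⟩, fun _ _ ↦
      trivial, 0, map_zero _⟩
    neg_mem' := by
      rintro _ ⟨c, hc, s, rfl⟩
      exact ⟨c, hc, -s, map_neg _ _⟩ }

/-- Every section of the presheaf colimit comes from a single chart: the sections with this
property form a subring through which the colimit cocone factors. -/
lemma exists_chartSec (hf : IsDecomposable f) (U : Opens (TopCat.of (RZ f)))
    (s : (preStructureSheaf f).obj (op U)) :
    ∃ (c : Chart f) (h : U ≤ RZ.preimage c.M c.V) (a : _), (chartSec c U h).hom a = s := by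
  let S := chartSubring hf U
  let E := (chartOpen f).isPointwiseLeftKanExtensionLeftKanExtensionUnit
      (chartSections f ⋙ uliftRing) (op U)
  have hle (c : CostructuredArrow (chartOpen f) (op U)) :
      U ≤ RZ.preimage c.left.M c.left.V := c.hom.unop.le
  let K : Cocone (CostructuredArrow.proj (chartOpen f) (op U) ⋙ chartSections f ⋙ uliftRing) :=
    { pt := CommRingCat.of S
      ι :=
        { app := fun c ↦ CommRingCat.ofHom ((chartSec c.left U (hle c)).hom.codRestrict S fun a ↦
          ⟨_, _, a, rfl⟩)
          naturality := fun c d a ↦ by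
            refine CommRingCat.hom_ext (RingHom.ext fun t ↦ Subtype.ext ?_)
            exact congrArg (fun k ↦ k.hom t) (map_chartSec a.left U (hle c) (hle d)) } }
  have h : E.desc K ≫ CommRingCat.ofHom S.subtype = 𝟙 _ := by
    refine E.hom_ext fun c ↦ ?_
    rw [E.fac_assoc]
    exact (Category.comp_id _).symm
  have h' := congrArg (fun k ↦ k.hom s) h
  have h'' : ((E.desc K).hom s : (preStructureSheaf f).obj (op U)) = s := h'
  obtain ⟨c, hc, a, ha⟩ := ((E.desc K).hom s).2
  exact ⟨c, hc, a, ha.trans h''⟩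

lemma germ_stalkDesc {T : TopCat.{u + 1}} (F : TopCat.Presheaf CommRingCat.{u + 1} T) (x : T)
    {A : CommRingCat.{u + 1}} (g : ∀ U : Opens T, x ∈ U → (F.obj (op U) ⟶ A))
    (hg : ∀ (U W : Opens T) (i : U ⟶ W) (hU : x ∈ U) (hW : x ∈ W),
      F.map i.op ≫ g U hU = g W hW) (U : Opens T) (hU : x ∈ U) :
    F.germ U x hU ≫ stalkDesc F x g hg = g U hU := by
  unfold stalkDesc TopCat.Presheaf.germ
  exact colimit.ι_desc _ _

namespace Val

variable (v : Val f)

lemma coe_sectionsToRing (c : Chart f) (h : v.center c.M ∈ c.V) (h' : v.y ∈ c.M.ι ⁻¹ᵁ c.V)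
    (s : Γ(c.M.obj, c.V)) :
    (((v.sectionsToRing c h).hom s : v.ring) : Y.presheaf.stalk v.y) =
      (Y.presheaf.germ (c.M.ι ⁻¹ᵁ c.V) v.y h').hom ((c.M.ι.app c.V).hom s) := by
  have e := v.germ_stalkToStalk c.M c.V h h'
  rw [Scheme.Hom.appLE_eq_app] at e
  exact congrArg (fun k ↦ k.hom s) e

lemma chartSec_preSectionsToRing (c : Chart f) (U : Opens (TopCat.of (RZ f)))
    (h : U ≤ RZ.preimage c.M c.V)
    (hU : v.psi ∈ U) :
    chartSec c U h ≫ v.preSectionsToRing U hU = uliftRing.map (v.sectionsToRing c (h hU)) :=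
  ((chartOpen f).isPointwiseLeftKanExtensionLeftKanExtensionUnit
    (chartSections f ⋙ uliftRing) (op U)).fac (v.preSectionsCocone U hU)
      (CostructuredArrow.mk (Y := c) (homOfLE h : U ⟶ RZ.preimage c.M c.V).op)

/-- A criterion for the comparison homomorphism to be bijective, in terms of charts. -/
lemma bijective_comparison (hf : IsDecomposable f) {x : RZ f} (h : v.psi = x)
    (hinj : ∀ (c : Chart f) (_ : x.1 c.M ∈ c.V) (hy : v.y ∈ c.M.ι ⁻¹ᵁ c.V) (s : Γ(c.M.obj, c.V)),
      (Y.presheaf.germ (c.M.ι ⁻¹ᵁ c.V) v.y hy).hom ((c.M.ι.app c.V).hom s) = 0 →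
        ∃ (d : Chart f) (a : c ⟶ d), x.1 d.M ∈ d.V ∧ ((chartSections f).map a).hom s = 0)
    (hsurj : ∀ r ∈ v.ring, ∃ (c : Chart f) (_ : x.1 c.M ∈ c.V) (hy : v.y ∈ c.M.ι ⁻¹ᵁ c.V)
      (s : Γ(c.M.obj, c.V)),
      (Y.presheaf.germ (c.M.ι ⁻¹ᵁ c.V) v.y hy).hom ((c.M.ι.app c.V).hom s) = r) :
    Function.Bijective (v.comparison x h) := by
  subst h
  let F := preStructureSheaf f
  let x : TopCat.of (RZ f) := v.psi
  let D : F.stalk x ⟶ uliftRing.obj (CommRingCat.of v.ring) :=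
    stalkDesc F x (fun U hU ↦ v.preSectionsToRing U hU)
      (fun _ _ i hU hW ↦ v.map_preSectionsToRing i hU hW)
  have hmem (c : Chart f) (hc : v.psi.1 c.M ∈ c.V) : v.y ∈ c.M.ι ⁻¹ᵁ c.V :=
    (v.specializes_center c.M).mem_open c.V.isOpen hc
  have hD (c : Chart f) (U : Opens (TopCat.of (RZ f))) (hU : x ∈ U) (hc : U ≤ RZ.preimage c.M c.V)
      (s : ULift.{u + 1} Γ(c.M.obj, c.V)) :
      D.hom ((F.germ U x hU).hom ((chartSec c U hc).hom s)) =
        ULift.up ((v.sectionsToRing c (hc hU)).hom s.down) := by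
    refine (congrArg (fun k ↦ k.hom ((chartSec c U hc).hom s)) (germ_stalkDesc F x
      (fun U hU ↦ v.preSectionsToRing U hU) (fun _ _ i hU hW ↦ v.map_preSectionsToRing i hU hW)
        U hU)).trans ?_
    exact congrArg (fun k ↦ k.hom s) (v.chartSec_preSectionsToRing c U hc hU)
  have hbij : Function.Bijective D.hom := by
    refine ⟨(injective_iff_map_eq_zero _).mpr fun t ht ↦ ?_, fun r ↦ ?_⟩
    · obtain ⟨U, hU, t, rfl⟩ := TopCat.Presheaf.exists_germ_eq F t
      obtain ⟨c, hc, ⟨s⟩, rfl⟩ := exists_chartSec hf U t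
      have h₀ := (hD c U hU hc ⟨s⟩).symm.trans ht
      have h₁ : (v.sectionsToRing c (hc hU)).hom s = 0 := congrArg ULift.down h₀
      have h₂ := (v.coe_sectionsToRing c (hc hU) (hmem c (hc hU)) s).symm.trans
          (congrArg Subtype.val h₁)
      obtain ⟨d, a, hd, ha⟩ := hinj c (hc hU) (hmem c (hc hU)) s h₂
      let W : Opens (TopCat.of (RZ f)) := U ⊓ RZ.preimage d.M d.V
      have hW : x ∈ W := ⟨hU, hd⟩
      have hWc : W ≤ RZ.preimage c.M c.V := inf_le_left.trans hc
      have hWd : W ≤ RZ.preimage d.M d.V := inf_le_right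
      have e₁ : (F.map (homOfLE (inf_le_left : W ≤ U)).op).hom ((chartSec c U hc).hom ⟨s⟩) =
          (chartSec d W hWd).hom (((chartSections f ⋙ uliftRing).map a).hom ⟨s⟩) :=
        congrArg (fun k ↦ k.hom ⟨s⟩) ((chartSec_map c (homOfLE (inf_le_left : W ≤ U)) hc hWc).trans
          (map_chartSec a W hWc hWd).symm)
      have e₂ : ((chartSections f ⋙ uliftRing).map a).hom ⟨s⟩ = 0 := congrArg ULift.up ha
      rw [e₂, map_zero] at e₁
      refine (TopCat.Presheaf.germ_res_apply F (homOfLE (inf_le_left : W ≤ U)) x hW _).symm.trans ?_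
      exact (congrArg (F.germ W x hW).hom e₁).trans (map_zero (F.germ W x hW).hom)
    · obtain ⟨⟨r, hr⟩⟩ := r
      obtain ⟨c, hc, hy, s, hs⟩ := hsurj r hr
      refine ⟨(F.germ (RZ.preimage c.M c.V) x hc).hom ((chartSec c _ le_rfl).hom ⟨s⟩), ?_⟩
      refine (hD c _ hc le_rfl ⟨s⟩).trans (congrArg ULift.up (Subtype.ext ?_))
      exact (v.coe_sectionsToRing c _ hy s).trans hs
  have hinv : Function.Bijective (stalkSheafifyInv (T := TopCat.of (RZ f)) F x).hom := by
    have : IsIso (stalkSheafifyInv (T := TopCat.of (RZ f)) F x) := by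
      unfold stalkSheafifyInv; exact Iso.isIso_inv _
    exact ConcreteCategory.bijective_of_isIso (stalkSheafifyInv (T := TopCat.of (RZ f)) F x)
  exact (ULift.ringEquiv (R := v.ring)).bijective.comp (hbij.comp hinv)

/-- The valuation of `𝒪_v` makes it a semi-valuation ring: an element of non-zero value is
invertible in the local ring of `Y`. -/
lemma isSemivaluation : IsSemivaluation v.valuation := by
  have hu (a : v.ring) (ha : v.valuation a ≠ 0) : IsUnit (a : Y.presheaf.stalk v.y) := by
    by_contra h
    apply ha
    have : (Y.residue v.y).hom (a : Y.presheaf.stalk v.y) = 0 := (residue_eq_zero_iff _).mpr h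
    change v.R.valuation ((Y.residue v.y).hom (a : Y.presheaf.stalk v.y)) = 0
    rw [this, map_zero]
  refine ⟨fun a b hb hab ↦ ?_, fun g h hgh hh ↦ ?_⟩
  · by_contra ha
    apply hb
    have h₀ : (a : Y.presheaf.stalk v.y) * b = 0 := congrArg Subtype.val hab
    exact Subtype.ext ((hu a ha).mul_right_eq_zero.mp h₀)
  · obtain ⟨w, hw⟩ := hu h hh
    have hc : (↑w⁻¹ * (g : Y.presheaf.stalk v.y)) ∈ v.ring := by
      change (Y.residue v.y).hom (↑w⁻¹ * (g : Y.presheaf.stalk v.y)) ∈ v.R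
      rw [← v.R.valuation_le_one_iff]
      have h₁ : v.R.valuation ((Y.residue v.y).hom (h : Y.presheaf.stalk v.y)) *
          v.R.valuation ((Y.residue v.y).hom (↑w⁻¹ * (g : Y.presheaf.stalk v.y))) ≤
            v.R.valuation ((Y.residue v.y).hom (h : Y.presheaf.stalk v.y)) * 1 := by
        rw [← map_mul, ← map_mul, ← hw, Units.mul_inv_cancel_left, hw, mul_one]
        exact hgh
      exact le_of_mul_le_mul_left h₁ (zero_lt_iff.mpr hh)
    exact ⟨⟨_, hc⟩, Subtype.ext (by
      change (g : Y.presheaf.stalk v.y) = h * (↑w⁻¹ * g)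
      rw [← hw, Units.mul_inv_cancel_left])⟩

end Val

lemma IsSemivaluation.comap {A B Γ : Type*} [CommRing A] [CommRing B]
    [LinearOrderedCommGroupWithZero Γ]
    {w : Valuation B Γ} (h : IsSemivaluation w) {φ : A →+* B} (hφ : Function.Bijective φ) :
    IsSemivaluation (w.comap φ) := by
  refine ⟨fun a b hb hab ↦ ?_, fun a b hab hb ↦ ?_⟩
  · exact h.eq_zero_of_mul_eq_zero (φ a) (φ b) ((map_ne_zero_iff φ hφ.1).mpr hb)
      (by rw [← map_mul, hab, map_zero])
  · obtain ⟨c, hc⟩ := h.dvd_of_le (φ a) (φ b) hab hb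
    obtain ⟨c, rfl⟩ := hφ.2 c
    exact ⟨c, hφ.1 (by rw [hc, map_mul])⟩

namespace RZ

variable {x : RZ f} {y : Y} (hy : ∀ O : Y.Opens, y ∈ O ↔ x.IsBig O) [QuasiCompact f]
  (hf : IsDecomposable f) [CompactSpace X] [QuasiSeparatedSpace X]

/-- Injectivity: what vanishes at the center vanishes on a bigger modification. Surjectivity: the
preimage of the valuation ring consists of the regular elements. -/
lemma bijective_comparison_toVal (M : Modification f) [IsAffineHom M.ι]
    (h : (toVal hy hf M).psi = x) :
    Function.Bijective ((toVal hy hf M).comparison x h) := by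
  refine Val.bijective_comparison _ hf h (fun c hc hyc s hs ↦ ?_) fun r hr ↦ ?_
  · have h₁ : (toCenter hy c.M).hom ((c.M.obj.presheaf.germ c.V (x.1 c.M) hc).hom s) = 0 :=
      (germ_app_eq_toCenter hy c.M c.V hc hyc s).trans hs
    obtain ⟨N, a, ha⟩ := exists_transition_eq_zero hy _ h₁
    have hxN : x.1 N ∈ a.hom ⁻¹ᵁ c.V := by
      change a.hom _ ∈ c.V
      rwa [x.2]
    have h₂ : (N.obj.presheaf.germ (a.hom ⁻¹ᵁ c.V) (x.1 N) hxN).hom ((a.hom.app c.V).hom s) =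
        (N.obj.presheaf.germ (a.hom ⁻¹ᵁ c.V) (x.1 N) hxN).hom 0 := by
      rw [map_zero, ← ha]
      exact (congrArg (fun k ↦ k.hom s) (germ_transition a c.V hc hxN)).symm
    obtain ⟨W, hxW, i, j, e⟩ := TopCat.Presheaf.germ_eq N.obj.presheaf (x.1 N) hxN hxN _ _ h₂
    refine ⟨⟨N, W⟩, ⟨a, leOfHom i⟩, hxW, ?_⟩
    exact e.trans (map_zero (N.obj.presheaf.map j.op).hom)
  · obtain ⟨N, α, hα⟩ := (residue_mem_valuationSubring hy hf r).mp hr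
    obtain ⟨V, hV, s, rfl⟩ := TopCat.Presheaf.exists_germ_eq _ α
    have hyV : y ∈ N.ι ⁻¹ᵁ V := (hy _).mpr (isBig_preimage hV)
    exact ⟨⟨N, V⟩, hV, hyV, s, (germ_app_eq_toCenter hy N V hV hyV s).symm.trans hα⟩

end RZ

end

end RelativeRZ

end

theorem proposition2 {Y X : Scheme.{u}} (f : Y ⟶ X)
    [CompactSpace Y] [QuasiSeparatedSpace Y] [CompactSpace X] [QuasiSeparatedSpace X]
    [IsSeparated f] (hf : RelativeRZ.IsDecomposable f) :
    ∃ (lam : RelativeRZ.RZ f → RelativeRZ.Val f)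
      (hlam : Function.RightInverse lam (RelativeRZ.Val.psi (f := f))),
      (∀ x : RelativeRZ.RZ f,
        Function.Bijective ((lam x).comparison x (hlam x)) ∧
        RelativeRZ.IsSemivaluation
          ((lam x).valuation.comap ((lam x).comparison x (hlam x)))) ∧
      Function.Surjective (RelativeRZ.Val.psi (f := f)) := by
  have := hf.quasiCompact
  obtain ⟨M, hM⟩ := RelativeRZ.Modification.exists_isAffineHom hf
  choose y hy using fun x : RelativeRZ.RZ f ↦ x.exists_center hf
  have hlam (x : RelativeRZ.RZ f) : (RelativeRZ.RZ.toVal (hy x) hf M).psi = x :=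
    RelativeRZ.RZ.psi_toVal (hy x) hf M
  refine ⟨fun x ↦ RelativeRZ.RZ.toVal (hy x) hf M, hlam, fun x ↦ ?_, fun x ↦ ⟨_, hlam x⟩⟩
  have hb := RelativeRZ.RZ.bijective_comparison_toVal (hy x) hf M (hlam x)
  exact ⟨hb, (RelativeRZ.Val.isSemivaluation _).comap hb⟩
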